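/- Let $n\ge 2$, let $B_R\subset\mathbb R^n$ be the open ball of radius $R$ about the origin, and let $x\mapsto V(|x|)$ be a radial function, $C^\infty$ on $\overline{B_1}$, with $V\ge 0$ and $V\not\equiv 0$. For $s\in(0,1)$ let $G(\cdot,s)$ be the Green function, with pole $s$, of the operator $$\mathcal L u=-u''-\frac{n-1}{r}u'+V(r)u\quad\text{on }(0,1),\qquad u'(0)=u'(1)=0,$$ that is, the function continuous on $[0,1]$ with $\mathcal L G(\cdot,s)=0$ on $(0,1)\setminus\{s\}$, $\partial_rG(0^+,s)=\partial_rG(1^-,s)=0$ and $\partial_rG(s^+,s)-\partial_rG(s^-,s)=-1$. Put $G(r,1)=\lim_{s\to1^-}G(r,s)$ and $$F(r)=\frac{|\partial B_1|\,r^{n-1}}{G(r,r)},\qquad r\in(0,1].$$ Then $G(\cdot,s)$ exists and is unique for every $s\in(0,1)$, the limit $G(r,1)$ exists for every $r\in[0,1]$, and $G(r,r)>0$ for every $r\in(0,1]$, so that $F$ is well defined. Let $\bar r\in(0,1]$ be a strict local minimum point of $F$ on $(0,1]$. Then there are radial functions $u_p=u_p(|x|)$ such that, for all sufficiently large real $p$,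 $u_p\in C^2(\overline{B_1})$ is a classical solution of $$-\Delta u+V(|x|)u=u^p\ \text{ in }B_1,\qquad u>0\ \text{ in }B_1,\qquad \frac{\partial u}{\partial\nu}=0\ \text{ on }\partial B_1,$$ and $$u_p\to\frac{G(|\cdot|,\bar r)}{G(\bar r,\bar r)}\quad\text{as }p\to+\infty\quad\text{in }H^1(B_1)\cap L^\infty(B_1).$$ Moreover, these solutions are, up to positive factors, constrained minimizers of the energy $Q(u)=\int_{B_1}\left(|\nabla u|^2+V(|x|)u^2\right)dx$, and the pointwise constraint is natural. Precisely, there are $0<R_1<\bar r$, a number $R_2$ with $\bar r<R_2<1$ if $\bar r<1$ and $R_2=1$ if $\bar r=1$, and $c<1$, with $F(r)>F(\bar r)$ for all $r\in[R_1,R_2]\setminus\{\bar r\}$, with $G(R_1,\bar r)/G(\bar r,\bar r)<c$ and, if $\bar r<1$, $G(R_2,\bar r)/G(\bar r,\bar r)<c$, such that for all sufficiently large $p$ some positive multiple $w_p=t_pu_p$ minimizes $Q$ over the set of radial $u\in H^1(B_1)$ with $\left(|B_1|^{-1}\int_{B_1}|u|^{p+1}\right)^{1/(p+1)}=1$ and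 $|u|\le c$ a.e. in $B_{R_1}\cup(B_1\setminus B_{R_2})$, and $|w_p|<c$ everywhere in $B_{R_1}\cup(B_1\setminus B_{R_2})$. -/

import Mathlib

open Set Filter Topology MeasureTheory

open scoped ContDiff ENNReal

noncomputable section

namespace RadialNeumann

/-- `ℝⁿ` with its Euclidean norm. -/
abbrev E (n : ℕ) : Type := EuclideanSpace ℝ (Fin n)

/-- The open unit ball `B₁` of `ℝⁿ`. -/
def B (n : ℕ) : Set (E n) := Metric.ball 0 1

/-- Lebesgue measure on `B₁`. -/
def volB (n : ℕ) : Measure (E n) := volume.restrict (B n)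

/-! ### The Green function of the radial Neumann operator -/

/-- For `0 < s < 1`, `g = G(·, s)` is the Green function, with pole at `s`, of
`𝓛 u = - u'' - (n - 1) / r * u' + V u` on `(0,1)` with `u'(0) = u'(1) = 0`, that is, `𝓛 g = δ_s`:
`g` is continuous on `[0,1]`, solves `𝓛 g = 0` away from `s`, satisfies the two boundary
conditions, and its derivative jumps by `-1` at `s`. -/
structure IsGreenAt (n : ℕ) (V : ℝ → ℝ) (s : ℝ) (g : ℝ → ℝ) : Prop where
  continuousOn : ContinuousOn g (Icc 0 1)
  differentiableAt : ∀ r ∈ Ioo (0 : ℝ) 1, r ≠ s → DifferentiableAt ℝ g r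
  differentiableAt_deriv : ∀ r ∈ Ioo (0 : ℝ) 1, r ≠ s → DifferentiableAt ℝ (deriv g) r
  equation : ∀ r ∈ Ioo (0 : ℝ) 1, r ≠ s →
    - deriv (deriv g) r - ((n : ℝ) - 1) / r * deriv g r + V r * g r = 0
  deriv_zero : Tendsto (deriv g) (𝓝[>] 0) (𝓝 0)
  deriv_one : Tendsto (deriv g) (𝓝[<] 1) (𝓝 0)
  jump : ∃ a : ℝ, Tendsto (deriv g) (𝓝[<] s) (𝓝 a) ∧ Tendsto (deriv g) (𝓝[>] s) (𝓝 (a - 1))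

open Classical in
/-- The Green function `r ↦ G(r, s)` with pole `s ∈ (0,1)` (zero if there is none). -/
def interiorGreen (n : ℕ) (V : ℝ → ℝ) (s : ℝ) : ℝ → ℝ :=
  if h : ∃ g, IsGreenAt n V s g then h.choose else 0

open Classical in
/-- The Green function `G(r, s)`, `0 < s ≤ 1`; `G(r, 1)` is the pointwise limit of `G(r, s)`
as `s → 1`. -/
def green (n : ℕ) (V : ℝ → ℝ) (r s : ℝ) : ℝ :=
  if s = 1 then limUnder (𝓝[<] (1 : ℝ)) (fun σ => interiorGreen n V σ r)
  else interiorGreen n V s r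

/-- `|∂B₁|`, the surface measure of the unit sphere. -/
def sphereArea (n : ℕ) : ℝ := ((volume : Measure (E n)).toSphere univ).toReal

/-- `F(r) = |∂B₁| r ^ (n - 1) / G(r, r)`. -/
def F (n : ℕ) (V : ℝ → ℝ) (r : ℝ) : ℝ := sphereArea n * r ^ (n - 1) / green n V r r

/-- `rbar` is a strict local minimum point of `f` on `(0,1]`. -/
def IsStrictLocalMin (f : ℝ → ℝ) (rbar : ℝ) : Prop :=
  rbar ∈ Ioc (0 : ℝ) 1 ∧ ∀ᶠ r in 𝓝[Ioc (0 : ℝ) 1 \ {rbar}] rbar, f rbar < f r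

/-- The limit profile `x ↦ G(|x|, rbar) / G(rbar, rbar)`. -/
def profile (n : ℕ) (V : ℝ → ℝ) (rbar : ℝ) (x : E n) : ℝ :=
  green n V ‖x‖ rbar / green n V rbar rbar

/-! ### The Sobolev space `H¹(B₁)` -/

/-- `g` is the weak gradient of `u` in `B₁`. -/
def IsWeakGrad (n : ℕ) (u : E n → ℝ) (g : E n → E n) : Prop :=
  ∀ φ : E n → ℝ, ContDiff ℝ ∞ φ → HasCompactSupport φ → tsupport φ ⊆ B n →
    ∀ i : Fin n,
      ∫ x, u x * fderiv ℝ φ x (EuclideanSpace.single i 1) ∂(volB n) =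
        - ∫ x, g x i * φ x ∂(volB n)

/-- `u ∈ L²(B₁)` has the weak gradient `g ∈ L²(B₁; ℝⁿ)`. -/
def HasH1Grad (n : ℕ) (u : E n → ℝ) (g : E n → E n) : Prop :=
  MemLp u 2 (volB n) ∧ MemLp g 2 (volB n) ∧ IsWeakGrad n u g

/-- `u ∈ H¹(B₁)`. -/
def MemH1 (n : ℕ) (u : E n → ℝ) : Prop := ∃ g, HasH1Grad n u g

open Classical in
/-- The weak gradient of `u ∈ H¹(B₁)` (unique almost everywhere; zero if `u ∉ H¹(B₁)`). -/
def weakGrad (n : ℕ) (u : E n → ℝ) : E n → E n :=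
  if h : MemH1 n u then h.choose else 0

open Classical in
/-- The `H¹(B₁)` norm, `∞` outside `H¹(B₁)`. -/
def h1Norm (n : ℕ) (u : E n → ℝ) : ℝ≥0∞ :=
  if MemH1 n u then
    (eLpNorm u 2 (volB n) ^ 2 + eLpNorm (weakGrad n u) 2 (volB n) ^ 2) ^ (1 / 2 : ℝ)
  else ⊤

/-- `u p → w` in `H¹(B₁)` as `p → +∞`. -/
def TendstoH1 (n : ℕ) (u : ℝ → E n → ℝ) (w : E n → ℝ) : Prop :=
  (∀ᶠ p in atTop, MemH1 n (u p)) ∧ MemH1 n w ∧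
    Tendsto (fun p => h1Norm n (fun x => u p x - w x)) atTop (𝓝 0)

/-- `u p → w` in `L^∞(B₁)` as `p → +∞`. -/
def TendstoLinfty (n : ℕ) (u : ℝ → E n → ℝ) (w : E n → ℝ) : Prop :=
  (∀ᶠ p in atTop, MemLp (u p) ∞ (volB n)) ∧ MemLp w ∞ (volB n) ∧
    Tendsto (fun p => eLpNorm (fun x => u p x - w x) ∞ (volB n)) atTop (𝓝 0)

/-! ### The nonlinear Neumann problem -/

/-- `u` is a classical solution, of class `C²` up to the boundary, of `-Δu + V(|x|) u = u ^ p`,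
`u > 0` in `B₁`, `∂u/∂ν = 0` on `∂B₁` (the outer normal at `x ∈ ∂B₁` is `x`). -/
structure IsNeumannSolution (n : ℕ) (V : ℝ → ℝ) (p : ℝ) (u : E n → ℝ) : Prop where
  contDiffOn : ContDiffOn ℝ 2 u (Metric.closedBall 0 1)
  equation : ∀ x ∈ B n, - Laplacian.laplacian u x + V ‖x‖ * u x = u x ^ p
  pos : ∀ x ∈ B n, 0 < u x
  neumann : ∀ x ∈ Metric.sphere (0 : E n) 1,
    fderivWithin ℝ u (Metric.closedBall 0 1) x x = 0

/-! ### The constrained minimization problem -/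

/-- The energy `Q(u) = ∫_{B₁} |∇u|² + V(|x|) u²`. -/
def Q (n : ℕ) (V : ℝ → ℝ) (u : E n → ℝ) : ℝ :=
  ∫ x, (‖weakGrad n u x‖ ^ 2 + V ‖x‖ * u x ^ 2) ∂(volB n)

/-- The region `B_{R₁} ∪ (B₁ ∖ B_{R₂})`; for `R₂ = 1` it is `B_{R₁}`. -/
def region (n : ℕ) (R₁ R₂ : ℝ) : Set (E n) :=
  Metric.ball 0 R₁ ∪ (B n \ Metric.ball 0 R₂)

/-- The constraint set `K_p`: radial `u ∈ H¹(B₁)` with normalized `L^{p+1}` norm equal to `1` and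
`|u| ≤ c` in `B_{R₁} ∪ (B₁ ∖ B_{R₂})`. -/
def K (n : ℕ) (R₁ R₂ c p : ℝ) : Set (E n → ℝ) :=
  {u | MemH1 n u ∧ (∃ f : ℝ → ℝ, ∀ᵐ x ∂(volB n), u x = f ‖x‖) ∧
    ((volume (B n)).toReal⁻¹ * ∫ x, |u x| ^ (p + 1) ∂(volB n)) ^ (1 / (p + 1)) = 1 ∧
    ∀ᵐ x ∂(volB n), x ∈ region n R₁ R₂ → |u x| ≤ c}

/-- The admissible choices of `R₁, R₂, c` at a strict local minimum point `rbar` of `F`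
(`R₂ = 1`, so that there is no outer constraint, if `rbar = 1`). -/
structure Admissible (n : ℕ) (V : ℝ → ℝ) (rbar R₁ R₂ c : ℝ) : Prop where
  R₁_pos : 0 < R₁
  R₁_lt : R₁ < rbar
  outer : (rbar < R₂ ∧ R₂ < 1 ∧ green n V R₂ rbar / green n V rbar rbar < c) ∨
    (rbar = 1 ∧ R₂ = 1)
  isMin : ∀ r ∈ Icc R₁ R₂, r ≠ rbar → F n V rbar < F n V r
  inner : green n V R₁ rbar / green n V rbar rbar < c
  c_lt : c < 1

/-- `w` minimizes `Q` on `K_p`, and the pointwise constraint `|w| ≤ c` is natural: it is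
satisfied with strict inequality. -/
def IsNaturalMinimizer (n : ℕ) (V : ℝ → ℝ) (R₁ R₂ c p : ℝ) (w : E n → ℝ) : Prop :=
  w ∈ K n R₁ R₂ c p ∧ (∀ v ∈ K n R₁ R₂ c p, Q n V w ≤ Q n V v) ∧
    ∀ x ∈ region n R₁ R₂, |w x| < c

end RadialNeumann

end

noncomputable section

namespace RadialNeumann

/-! ### Weighted averages and the regular solution of the radial equation -/

/-! The theorem is a variational statement about evaluation functionals in one variable. Let `φ` and
`ψ` be the positive solutions of the homogeneous radial equation that satisfy the Neumann condition
at 0 and at 1, and let `C` be their Wronskian. The Green function is then `s ^ (n - 1) / C * φ (min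
r s) * ψ (max r s)`. Divided by its value at the pole it becomes `peak φ ψ s`, which represents
evaluation: `form (peak s, ζ) = Γ(s) ζ(s)` with `Γ = peakEnergy = C / (φ ψ)` (`form_peak`). By
Cauchy-Schwarz, `Γ(s) u(s)² ≤ form (u, u)`, so `Γ(s)` is the least energy of a function of modulus
at least 1 at `s`. Since `F = |∂B₁| Γ` (`F_eq`), a strict local minimum of `F` is a radius at which
reaching height 1 is locally cheapest.

For large `p` the normalized `L^(p+1)` constraint acts like a constraint on the supremum. Minimize
the energy under mass at least 1 and `|u| ≤ c < 1` off a neighbourhood of the pole `s`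
(`exists_isFeasMin`, by the direct method). Slightly enlarged peaks are competitors, so the minimum
is at most `Γ(s) + o(1)`. A minimizer `w` has `|w r| ≥ 1` at some `r` off the constraint set, hence
energy at least `Γ(r)`. Strictness of the minimum forces `r` towards `s`, after a choice of sign `w
s` is almost at least 1, and `form (w - peak, w - peak) = form (w, w) - 2 Γ(s) w(s) + Γ(s)` tends to
0 (`eventually_energy_close`).

Energy controls values uniformly only away from the origin. On `(0, R)` the constraint makes the
nonlinearity of size `c ^ p`. The Lagrange multiplier is bounded uniformly in `p`
(`eventually_multiplier`), so comparison with a small paraboloid shows that `w` is close to `w(R) *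
peak R` there (`eventually_close_inner`). The convergence is therefore uniform on `(0, 1]`. As the
limit lies strictly below `c` on the constraint set, the constraint is inactive and `w` satisfies
the Euler equation with multiplier `n * form (w, w)` (`eventually_natural`).

Weak solutions are written with ball averages, which are regular at the origin, so they are `C²` on
the ball (`exists_radialSol`, `contDiff_radialSol`). The factor `(n * form (w, w)) ^ (1 / (p - 1))`
removes the multiplier and tends to 1. Finally, every radial `H¹` competitor has an absolutely
continuous profile of no larger energy (`exists_feas_of_mem_K`), which carries minimality over to
the original constraint set. -/

/-- The weighted average `∫₀¹ τ ^ (n - 1) h (r τ) dτ`. -/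
def ballAvg (n : ℕ) (h : ℝ → ℝ) (r : ℝ) : ℝ := ∫ τ in (0 : ℝ)..1, τ ^ (n - 1) * h (r * τ)

lemma continuous_ballAvg (n : ℕ) {h : ℝ → ℝ} (hh : Continuous h) :
    Continuous (ballAvg n h) := by
  unfold ballAvg
  exact intervalIntegral.continuous_parametric_intervalIntegral_of_continuous' (by fun_prop) 0 1

/-- Substitute `s = r τ`. The flux is thus `r ^ n` times a function continuous through `r = 0`,
which keeps the singular coefficient `(n - 1) / r` out of every argument at the origin. -/
lemma pow_mul_ballAvg {n : ℕ} (hn : 1 ≤ n) (h : ℝ → ℝ) (r : ℝ) :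
    r ^ n * ballAvg n h r = ∫ s in (0 : ℝ)..r, s ^ (n - 1) * h s := by
  have h1 := intervalIntegral.smul_integral_comp_mul_left (a := 0) (b := 1)
    (fun s => s ^ (n - 1) * h s) r
  simp only [mul_zero, mul_one, smul_eq_mul] at h1
  rw [← h1, ballAvg]
  obtain ⟨m, rfl⟩ := Nat.exists_eq_add_of_le' hn
  rw [pow_succ', mul_assoc, ← intervalIntegral.integral_const_mul]
  simp [mul_pow, mul_assoc]

lemma hasDerivAt_integral_pow_mul (n : ℕ) {h : ℝ → ℝ} (hh : Continuous h) (r : ℝ) :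
    HasDerivAt (fun r => ∫ s in (0 : ℝ)..r, s ^ (n - 1) * h s) (r ^ (n - 1) * h r) r :=
  intervalIntegral.integral_hasDerivAt_right
    ((by fun_prop : Continuous fun s => s ^ (n - 1) * h s).intervalIntegrable _ _)
    ((by fun_prop : Continuous fun s => s ^ (n - 1) * h s).stronglyMeasurableAtFilter _ _)
    (by fun_prop)

lemma hasDerivAt_ballAvg {n : ℕ} (hn : 1 ≤ n) {h : ℝ → ℝ} (hh : Continuous h) {r : ℝ}
    (hr : r ≠ 0) : HasDerivAt (ballAvg n h) ((h r - n * ballAvg n h r) / r) r := by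
  have h1 := (hasDerivAt_integral_pow_mul n hh r).div (hasDerivAt_pow n r) (pow_ne_zero n hr)
  have h2 : ballAvg n h =ᶠ[𝓝 r]
      (fun r => (∫ s in (0 : ℝ)..r, s ^ (n - 1) * h s) / r ^ n) := by
    filter_upwards [isOpen_ne.mem_nhds hr] with t ht
    rw [← pow_mul_ballAvg hn, mul_div_cancel_left₀ _ (pow_ne_zero n ht)]
  refine (h1.congr_of_eventuallyEq h2).congr_deriv ?_
  rw [← pow_mul_ballAvg hn]
  obtain ⟨m, rfl⟩ := Nat.exists_eq_add_of_le' hn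
  simp only [Nat.add_sub_cancel]
  field_simp
  ring

/-- This value makes `h - n * ballAvg n h` vanish at 0, as is needed for the Hessian and the
Laplacian of radial functions at the origin. -/
lemma ballAvg_zero_arg {n : ℕ} (hn : 1 ≤ n) (h : ℝ → ℝ) : n * ballAvg n h 0 = h 0 := by
  simp only [ballAvg, zero_mul, intervalIntegral.integral_mul_const, integral_pow]
  rw [Nat.sub_add_cancel hn]
  have : (n : ℝ) ≠ 0 := by positivity
  have h1 : ((n - 1 : ℕ) : ℝ) + 1 = n := by rw [Nat.cast_sub hn]; simp
  rw [h1, zero_pow (by omega)]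
  field_simp
  simp

lemma ballAvg_congr {n : ℕ} {h k : ℝ → ℝ} {r : ℝ} (hr : 0 ≤ r)
    (H : ∀ t ∈ Icc 0 r, h t = k t) : ballAvg n h r = ballAvg n k r := by
  refine intervalIntegral.integral_congr fun τ hτ => ?_
  rw [uIcc_of_le zero_le_one] at hτ
  rw [H _ ⟨mul_nonneg hr hτ.1, mul_le_of_le_one_right hr hτ.2⟩]

lemma abs_ballAvg_le {n : ℕ} {h : ℝ → ℝ} {r M : ℝ} (hr : 0 ≤ r)
    (H : ∀ t ∈ Icc 0 r, |h t| ≤ M) : |ballAvg n h r| ≤ M := by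
  have := intervalIntegral.norm_integral_le_of_norm_le_const (a := 0) (b := 1) (C := M)
    (f := fun τ => τ ^ (n - 1) * h (r * τ)) (by
      intro τ hτ
      rw [uIoc_of_le zero_le_one] at hτ
      rw [norm_mul, norm_pow, Real.norm_of_nonneg hτ.1.le]
      calc τ ^ (n - 1) * ‖h (r * τ)‖ ≤ 1 * ‖h (r * τ)‖ := by
            gcongr; exact pow_le_one₀ hτ.1.le hτ.2
        _ ≤ M := by
            rw [one_mul]
            exact H _ ⟨mul_nonneg hr hτ.1.le, mul_le_of_le_one_right hr hτ.2⟩)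
  simpa [ballAvg] using this

lemma ballAvg_sub {n : ℕ} {h k : ℝ → ℝ} (hh : Continuous h) (hk : Continuous k) (r : ℝ) :
    ballAvg n h r - ballAvg n k r = ballAvg n (fun t => h t - k t) r := by
  unfold ballAvg
  rw [← intervalIntegral.integral_sub]
  · simp only [mul_sub]
  · exact (by fun_prop : Continuous fun τ : ℝ => τ ^ (n - 1) * h (r * τ)).intervalIntegrable _ _
  · exact (by fun_prop : Continuous fun τ : ℝ => τ ^ (n - 1) * k (r * τ)).intervalIntegrable _ _

/-- The Picard operator of the radial equation, conjugated by `exp (L r)`. -/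
def picardOp (n : ℕ) (L : ℝ) (V : C(ℝ, ℝ)) (v : C(Icc (0 : ℝ) 1, ℝ)) : C(Icc (0 : ℝ) 1, ℝ) where
  toFun r := Real.exp (-(L * r)) * (1 + ∫ s in (0 : ℝ)..r, s * ballAvg n
    (fun t => V t * (Real.exp (L * t) * IccExtend zero_le_one v t)) s)
  continuous_toFun := by
    have h1 : Continuous (IccExtend zero_le_one v) := v.continuous.Icc_extend'
    have h2 : Continuous fun s => s * ballAvg n
        (fun t => V t * (Real.exp (L * t) * IccExtend zero_le_one v t)) s :=
      continuous_id.mul (continuous_ballAvg n (by fun_prop))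
    have h3 : Continuous fun r : ℝ => ∫ s in (0 : ℝ)..r, s * ballAvg n
        (fun t => V t * (Real.exp (L * t) * IccExtend zero_le_one v t)) s :=
      intervalIntegral.continuous_primitive (fun a b => h2.intervalIntegrable a b) 0
    have := h3.comp (continuous_subtype_val (p := fun x => x ∈ Icc (0 : ℝ) 1))
    simp only [Function.comp_def] at this
    fun_prop

/-- Conjugation by the exponential is a weighted sup norm. It gains a factor `M / L ≤ 1 / 2`, so one
fixed point covers all of `[0, 1]` and no continuation is needed. -/
lemma contracting_picardOp (n : ℕ) {L M : ℝ} (V : C(ℝ, ℝ)) (hM : 0 ≤ M)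
    (hV : ∀ r ∈ Icc (0 : ℝ) 1, |V r| ≤ M) (hL : L = 2 * M + 1) :
    ContractingWith (1 / 2) (picardOp n L V) := by
  have hL0 : 0 < L := by linarith
  refine ⟨by norm_num, LipschitzWith.of_dist_le_mul fun u v => ?_⟩
  rw [ContinuousMap.dist_le (by positivity)]
  rintro ⟨r, hr⟩
  set D := dist u v
  have hD : 0 ≤ D := dist_nonneg
  have hu : Continuous (IccExtend zero_le_one u) := u.continuous.Icc_extend'
  have hv : Continuous (IccExtend zero_le_one v) := v.continuous.Icc_extend'
  have huv : ∀ t, |IccExtend zero_le_one u t - IccExtend zero_le_one v t| ≤ D := fun t => by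
    rw [← Real.dist_eq]
    exact ContinuousMap.dist_apply_le_dist _
  set hu' := fun t => V t * (Real.exp (L * t) * IccExtend zero_le_one u t)
  set hv' := fun t => V t * (Real.exp (L * t) * IccExtend zero_le_one v t)
  have cu : Continuous hu' := by fun_prop
  have cv : Continuous hv' := by fun_prop
  have key : ∀ s ∈ Icc (0 : ℝ) 1, |s * ballAvg n hu' s - s * ballAvg n hv' s| ≤
      M * D * Real.exp (L * s) := by
    intro s hs
    rw [← mul_sub, ballAvg_sub cu cv, abs_mul, abs_of_nonneg hs.1]
    calc s * _ ≤ 1 * |ballAvg n (fun t => hu' t - hv' t) s| := by gcongr; exact hs.2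
      _ ≤ _ := by
        rw [one_mul]
        refine abs_ballAvg_le hs.1 fun t ht => ?_
        have h1 := huv t
        have h2 := hV t ⟨ht.1, ht.2.trans hs.2⟩
        have h3 : Real.exp (L * t) ≤ Real.exp (L * s) := by
          gcongr; exact ht.2
        calc |hu' t - hv' t| = |V t| * |IccExtend zero_le_one u t - IccExtend zero_le_one v t|
              * Real.exp (L * t) := by
              rw [← abs_of_pos (Real.exp_pos (L * t)), ← abs_mul, ← abs_mul]
              congr 1; simp only [hu', hv']; ring
          _ ≤ _ := by gcongr
  have hint : ∀ a b, IntervalIntegrable (fun s => s * ballAvg n hu' s) volume a b := fun a b =>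
    (continuous_id.mul (continuous_ballAvg n cu)).intervalIntegrable _ _
  have hint' : ∀ a b, IntervalIntegrable (fun s => s * ballAvg n hv' s) volume a b := fun a b =>
    (continuous_id.mul (continuous_ballAvg n cv)).intervalIntegrable _ _
  have hI : |(∫ s in (0 : ℝ)..r, s * ballAvg n hu' s) - ∫ s in (0 : ℝ)..r, s * ballAvg n hv' s| ≤
      ∫ s in (0 : ℝ)..r, M * D * Real.exp (L * s) := by
    rw [← intervalIntegral.integral_sub (hint _ _) (hint' _ _)]
    rw [← Real.norm_eq_abs]
    refine intervalIntegral.norm_integral_le_of_norm_le hr.1 ?_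
      ((by fun_prop : Continuous fun s => M * D * Real.exp (L * s)).intervalIntegrable _ _)
    exact Eventually.of_forall fun s hs => key s ⟨hs.1.le, hs.2.trans hr.2⟩
  have hE : ∫ s in (0 : ℝ)..r, M * D * Real.exp (L * s) ≤ M * D * (Real.exp (L * r) / L) := by
    rw [intervalIntegral.integral_const_mul]
    gcongr
    rw [intervalIntegral.integral_comp_mul_left (fun s => Real.exp s) hL0.ne', integral_exp]
    simp only [mul_zero, Real.exp_zero, smul_eq_mul]
    rw [div_eq_inv_mul]
    gcongr
    linarith
  rw [Real.dist_eq]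
  change |Real.exp (-(L * r)) * (1 + ∫ s in (0 : ℝ)..r, s * ballAvg n hu' s) -
    Real.exp (-(L * r)) * (1 + ∫ s in (0 : ℝ)..r, s * ballAvg n hv' s)| ≤ _
  rw [← mul_sub, add_sub_add_left_eq_sub, abs_mul, abs_of_pos (Real.exp_pos _)]
  calc _ ≤ Real.exp (-(L * r)) * (M * D * (Real.exp (L * r) / L)) := by
        gcongr; exact hI.trans hE
    _ = M / L * D := by
        rw [Real.exp_neg]; field_simp
    _ ≤ _ := by
        gcongr
        rw [div_le_iff₀ hL0, hL]
        push_cast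
        linarith

/-- Integrating `r ^ (n - 1) φ' = ∫₀ʳ s ^ (n - 1) V φ` once more gives a Volterra equation with no
singularity at 0, in which `φ 0 = 1` and the Neumann condition are built in. -/
theorem exists_regular_solution (n : ℕ) {V : ℝ → ℝ} (hV : Continuous V) :
    ∃ φ : ℝ → ℝ, Continuous φ ∧ φ 0 = 1 ∧
      ∀ r ∈ Icc (0 : ℝ) 1, HasDerivAt φ (r * ballAvg n (fun t => V t * φ t) r) r := by
  obtain ⟨M, hM⟩ := (isCompact_Icc (a := (0 : ℝ)) (b := 1)).exists_bound_of_continuousOn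
    hV.continuousOn
  have hM0 : 0 ≤ M := (norm_nonneg _).trans (hM 0 ⟨le_rfl, zero_le_one⟩)
  have hc := contracting_picardOp n (L := 2 * M + 1) ⟨V, hV⟩ hM0 hM rfl
  set L := 2 * M + 1
  set v := hc.fixedPoint
  have hfix : picardOp n L ⟨V, hV⟩ v = v := hc.fixedPoint_isFixedPt
  have hvc : Continuous (IccExtend zero_le_one v) := v.continuous.Icc_extend'
  set k := fun t => V t * (Real.exp (L * t) * IccExtend zero_le_one v t) with hk
  have hkc : Continuous k := by fun_prop
  have hkc' : Continuous fun s => s * ballAvg n k s :=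
    continuous_id.mul (continuous_ballAvg n hkc)
  -- This function lives on the whole line, but it agrees with `exp (L r) v` only on `[0, 1]`, so
  -- the equation is claimed only there.
  set φ := fun r : ℝ => 1 + ∫ s in (0 : ℝ)..r, s * ballAvg n k s with hφ
  have hder : ∀ r, HasDerivAt φ (r * ballAvg n k r) r := fun r =>
    (intervalIntegral.integral_hasDerivAt_right (hkc'.intervalIntegrable _ _)
      (hkc'.stronglyMeasurableAtFilter _ _) hkc'.continuousAt).const_add 1
  have heq : ∀ r ∈ Icc (0 : ℝ) 1, Real.exp (L * r) * IccExtend zero_le_one v r = φ r := by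
    intro r hr
    rw [IccExtend_of_mem _ _ hr]
    conv_lhs => rw [← hfix]
    change Real.exp (L * r) * (Real.exp (-(L * r)) * φ r) = _
    rw [← mul_assoc, ← Real.exp_add]
    simp
  refine ⟨φ, continuous_iff_continuousAt.2 fun r => (hder r).continuousAt, by simp [hφ],
    fun r hr => ?_⟩
  convert hder r using 2
  refine ballAvg_congr hr.1 fun t ht => ?_
  simp only [hk]
  rw [heq t ⟨ht.1, ht.2.trans hr.2⟩]

/-! ### A fundamental pair of solutions -/

/-- `φ` and `ψ` are the positive solutions of the homogeneous radial equation satisfying the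
Neumann condition at `0` and at `1`; `P` and `S` are their fluxes `r ^ (n - 1) φ'` and
`r ^ (n - 1) ψ'`, and `C` is the Wronskian. -/
structure FundPair (n : ℕ) (V φ ψ P S : ℝ → ℝ) (C : ℝ) : Prop where
  φ_cont : Continuous φ
  φ_deriv : ∀ r ∈ Ioc (0 : ℝ) 1, HasDerivAt φ (P r / r ^ (n - 1)) r
  φ_deriv_zero : Tendsto (fun r => P r / r ^ (n - 1)) (𝓝[>] 0) (𝓝 0)
  P_eq : ∀ r ∈ Icc (0 : ℝ) 1, P r = ∫ s in (0 : ℝ)..r, s ^ (n - 1) * (V s * φ s)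
  P_deriv : ∀ r ∈ Ioc (0 : ℝ) 1, HasDerivAt P (r ^ (n - 1) * (V r * φ r)) r
  ψ_deriv : ∀ r ∈ Ioc (0 : ℝ) 1, HasDerivAt ψ (S r / r ^ (n - 1)) r
  S_deriv : ∀ r ∈ Ioc (0 : ℝ) 1, HasDerivAt S (r ^ (n - 1) * (V r * ψ r)) r
  ψ_one : ψ 1 = 1
  S_one : S 1 = 0
  wronskian : ∀ r ∈ Ioc (0 : ℝ) 1, P r * ψ r - S r * φ r = C
  C_pos : 0 < C
  one_le_φ : ∀ r ∈ Icc (0 : ℝ) 1, 1 ≤ φ r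
  ψ_pos : ∀ r ∈ Ioc (0 : ℝ) 1, 0 < ψ r
  P_nonneg : ∀ r ∈ Icc (0 : ℝ) 1, 0 ≤ P r
  S_nonpos : ∀ r ∈ Ioc (0 : ℝ) 1, S r ≤ 0

/-- Positivity at a point of the closed interval spreads to an open set, hence to an interior point
different from a prescribed pole. -/
lemma exists_pos_mem_Ioo {V : ℝ → ℝ} (hV : Continuous V)
    (hV0 : ∀ r, 0 ≤ V r) (hV1 : ∃ r ∈ Icc (0 : ℝ) 1, V r ≠ 0) (s : ℝ) :
    ∃ r ∈ Ioo (0 : ℝ) 1, r ≠ s ∧ 0 < V r := by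
  obtain ⟨r₀, hr₀, hne⟩ := hV1
  have ho : IsOpen {r | 0 < V r} := isOpen_lt continuous_const hV
  have hmem : r₀ ∈ {r | 0 < V r} := lt_of_le_of_ne (hV0 r₀) (Ne.symm hne)
  rw [← closure_Ioo zero_ne_one] at hr₀
  obtain ⟨r₁, hr₁, hr₁'⟩ := mem_closure_iff.1 hr₀ _ ho hmem
  have hd : Dense ({s}ᶜ : Set ℝ) := dense_compl_singleton s
  obtain ⟨r, hr, hrs⟩ := hd.inter_open_nonempty _ (ho.inter isOpen_Ioo) ⟨r₁, hr₁, hr₁'⟩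
  exact ⟨r, hr.2, hrs, hr.1⟩

/-- `φ` is the regular solution and `ψ` comes from it by reduction of order. All signs follow from
monotonicity of products with their fluxes. -/
theorem exists_fundPair {n : ℕ} (hn : 1 ≤ n) {V : ℝ → ℝ} (hV : Continuous V)
    (hV0 : ∀ r, 0 ≤ V r) (hV1 : ∃ r ∈ Icc (0 : ℝ) 1, V r ≠ 0) :
    ∃ φ ψ P S C, FundPair n V φ ψ P S C := by
  obtain ⟨φ, hφc, hφ0, hφd⟩ := exists_regular_solution n hV
  have hVφ : Continuous fun t => V t * φ t := hV.mul hφc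
  set K := ballAvg n (fun t => V t * φ t) with hK
  set P : ℝ → ℝ := fun r => ∫ s in (0 : ℝ)..r, s ^ (n - 1) * (V s * φ s) with hP
  have hPK : ∀ r, P r = r ^ n * K r := fun r => (pow_mul_ballAvg hn _ r).symm
  have hPd : ∀ r, HasDerivAt P (r ^ (n - 1) * (V r * φ r)) r :=
    fun r => hasDerivAt_integral_pow_mul n hVφ r
  have hPc : Continuous P := continuous_iff_continuousAt.2 fun r => (hPd r).continuousAt
  have hPr : ∀ r, r ≠ 0 → P r / r ^ (n - 1) = r * K r := fun r hr => by
    rw [hPK]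
    obtain ⟨m, rfl⟩ := Nat.exists_eq_add_of_le' hn
    simp only [Nat.add_sub_cancel]
    field_simp
    ring
  have hφd' : ∀ r ∈ Ioc (0 : ℝ) 1, HasDerivAt φ (P r / r ^ (n - 1)) r := fun r hr => by
    rw [hPr r hr.1.ne']; exact hφd r ⟨hr.1.le, hr.2⟩
  have hP0 : P 0 = 0 := by simp [hP]
  -- The derivative of `φ P` is `P² / r ^ (n - 1) + r ^ (n - 1) V φ²`, nonnegative whatever the sign
  -- of `φ`. This makes `φ²` nondecreasing, and the intermediate value theorem then excludes a
  -- change of sign.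
  have hφP : ∀ r ∈ Icc (0 : ℝ) 1, 0 ≤ φ r * P r := by
    have hm : MonotoneOn (fun r => φ r * P r) (Icc 0 1) := by
      refine monotoneOn_of_hasDerivWithinAt_nonneg (convex_Icc 0 1) (hφc.mul hPc).continuousOn
        (f' := fun r => P r / r ^ (n - 1) * P r + φ r * (r ^ (n - 1) * (V r * φ r))) ?_ ?_
      · intro r hr
        rw [interior_Icc] at hr
        exact ((hφd' r ⟨hr.1, hr.2.le⟩).mul (hPd r)).hasDerivWithinAt
      · intro r hr
        rw [interior_Icc] at hr
        have h1 : 0 < r ^ (n - 1) := pow_pos hr.1 _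
        have h2 : P r / r ^ (n - 1) * P r + φ r * (r ^ (n - 1) * (V r * φ r)) =
          P r ^ 2 / r ^ (n - 1) + r ^ (n - 1) * V r * φ r ^ 2 := by ring
        rw [h2]
        have := hV0 r
        positivity
    intro r hr
    have := hm ⟨le_rfl, zero_le_one⟩ hr hr.1
    simpa [hP0] using this
  have hφsq : ∀ r ∈ Icc (0 : ℝ) 1, 1 ≤ φ r ^ 2 := by
    have hm : MonotoneOn (fun r => φ r ^ 2) (Icc 0 1) := by
      refine monotoneOn_of_hasDerivWithinAt_nonneg (convex_Icc 0 1) (hφc.pow 2).continuousOn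
        (f' := fun r => 2 * (φ r * P r) / r ^ (n - 1)) ?_ ?_
      · intro r hr
        rw [interior_Icc] at hr
        refine (((hφd' r ⟨hr.1, hr.2.le⟩).pow 2).congr_deriv ?_).hasDerivWithinAt
        simp only [Nat.cast_ofNat, Nat.add_one_sub_one, pow_one]
        ring
      · intro r hr
        rw [interior_Icc] at hr
        have h1 : 0 < r ^ (n - 1) := pow_pos hr.1 _
        have := hφP r ⟨hr.1.le, hr.2.le⟩
        positivity
    intro r hr
    have := hm ⟨le_rfl, zero_le_one⟩ hr hr.1
    simpa [hφ0] using this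
  have hφ1 : ∀ r ∈ Icc (0 : ℝ) 1, 1 ≤ φ r := by
    intro r hr
    have hpos : 0 < φ r := by
      by_contra hle
      push Not at hle
      obtain ⟨t, ht, ht0⟩ := intermediate_value_Icc' hr.1 (hφc.continuousOn (s := Icc 0 r))
        (show (0 : ℝ) ∈ Icc (φ r) (φ 0) from ⟨hle, by rw [hφ0]; exact zero_le_one⟩)
      have := hφsq t ⟨ht.1, ht.2.trans hr.2⟩
      rw [ht0] at this
      norm_num at this
    have := hφsq r hr
    nlinarith
  have hPn : ∀ r ∈ Icc (0 : ℝ) 1, 0 ≤ P r := fun r hr =>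
    nonneg_of_mul_nonneg_right (hφP r hr) (by linarith [hφ1 r hr])
  -- The potential must be nonzero somewhere for the Wronskian `P 1` to be positive.
  have hC : 0 < P 1 := by
    obtain ⟨r, hr, -, hVr⟩ := exists_pos_mem_Ioo hV hV0 hV1 0
    refine intervalIntegral.integral_pos zero_lt_one (by fun_prop) ?_
      ⟨r, ⟨hr.1.le, hr.2.le⟩, ?_⟩
    · intro x hx
      have := hφ1 x ⟨hx.1.le, hx.2⟩
      have := hV0 x
      have := hx.1
      positivity
    · have := hφ1 r ⟨hr.1.le, hr.2.le⟩
      have := hr.1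
      positivity
  -- Reduction of order: `(ψ / φ)' = - C / (r ^ (n - 1) φ²)` with `C = P 1`. The constant `1 / φ 1`
  -- below normalizes `ψ 1 = 1`.
  set I : ℝ → ℝ := fun r => ∫ t in (1 : ℝ)..r, P 1 / (t ^ (n - 1) * φ t ^ 2) with hI
  have hnz : ∀ r ∈ Ioc (0 : ℝ) 1, r ^ (n - 1) * φ r ^ 2 ≠ 0 := fun r hr => by
    have h1 := hφ1 r ⟨hr.1.le, hr.2⟩
    have h2 := hr.1
    positivity
  have hIc : ∀ r ∈ Ioc (0 : ℝ) 1,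
      ContinuousAt (fun t => P 1 / (t ^ (n - 1) * φ t ^ 2)) r := fun r hr => by
    refine ContinuousAt.div (by fun_prop) (by fun_prop) (hnz r hr)
  have hIi : ∀ r ∈ Ioc (0 : ℝ) 1,
      IntervalIntegrable (fun t => P 1 / (t ^ (n - 1) * φ t ^ 2)) volume 1 r := fun r hr => by
    refine ContinuousOn.intervalIntegrable fun t ht => ?_
    rw [uIcc_of_ge hr.2] at ht
    exact (hIc t ⟨hr.1.trans_le ht.1, ht.2⟩).continuousWithinAt
  have hmeas : Measurable (fun t => P 1 / (t ^ (n - 1) * φ t ^ 2)) :=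
    measurable_const.div (by fun_prop)
  have hId : ∀ r ∈ Ioc (0 : ℝ) 1, HasDerivAt I (P 1 / (r ^ (n - 1) * φ r ^ 2)) r := fun r hr =>
    intervalIntegral.integral_hasDerivAt_right (hIi r hr)
      (hmeas.stronglyMeasurable.stronglyMeasurableAtFilter) (hIc r hr)
  have hIn : ∀ r ∈ Ioc (0 : ℝ) 1, I r ≤ 0 := fun r hr => by
    rw [hI]
    simp only
    rw [intervalIntegral.integral_symm, neg_nonpos]
    refine intervalIntegral.integral_nonneg hr.2 fun t ht => ?_
    have h1 := hr.1.trans_le ht.1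
    positivity
  set ψ : ℝ → ℝ := fun r => φ r * (1 / φ 1 - I r) with hψ
  -- `S` is solved from the Wronskian identity, so that identity is automatic, and `S 1 = 0` because
  -- the constant is `P 1`.
  set S : ℝ → ℝ := fun r => (P r * ψ r - P 1) / φ r with hS
  have hψp : ∀ r ∈ Ioc (0 : ℝ) 1, 0 < ψ r := fun r hr => by
    have h1 := hφ1 r ⟨hr.1.le, hr.2⟩
    have h2 := hφ1 1 ⟨zero_le_one, le_rfl⟩
    have h3 := hIn r hr
    have h4 : 0 < 1 / φ 1 := by positivity
    exact mul_pos (by linarith) (by linarith)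
  have hψd : ∀ r ∈ Ioc (0 : ℝ) 1, HasDerivAt ψ (S r / r ^ (n - 1)) r := fun r hr => by
    refine ((hφd' r hr).mul ((hId r hr).const_sub (1 / φ 1))).congr_deriv ?_
    have h1 := hφ1 r ⟨hr.1.le, hr.2⟩
    have h2 : φ r ≠ 0 := by linarith
    have h3 : r ≠ 0 := hr.1.ne'
    have h4 : φ 1 ≠ 0 := by linarith [hφ1 1 ⟨zero_le_one, le_rfl⟩]
    simp only [hS, hψ]
    field_simp
    ring
  have hSd : ∀ r ∈ Ioc (0 : ℝ) 1, HasDerivAt S (r ^ (n - 1) * (V r * ψ r)) r := fun r hr => by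
    have h1 := hφ1 r ⟨hr.1.le, hr.2⟩
    have h2 : φ r ≠ 0 := by linarith
    have h3 : r ≠ 0 := hr.1.ne'
    refine ((((hPd r).mul (hψd r hr)).sub_const (P 1)).div (hφd' r hr) h2).congr_deriv ?_
    simp only [hS, Pi.mul_apply]
    field_simp
    ring
  have hψ1 : ψ 1 = 1 := by
    have h4 : φ 1 ≠ 0 := by linarith [hφ1 1 ⟨zero_le_one, le_rfl⟩]
    simp [hψ, hI, h4]
  have hS1 : S 1 = 0 := by simp [hS, hψ1]
  refine ⟨φ, ψ, P, S, P 1, hφc, hφd', ?_, fun r _ => rfl, fun r _ => hPd r, hψd, hSd, hψ1, hS1, ?_,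
    hC, hφ1, hψp, hPn, ?_⟩
  · have h1 : Tendsto (fun r => r * K r) (𝓝[>] 0) (𝓝 0) := by
      have := (continuous_id.mul (continuous_ballAvg n hVφ)).tendsto 0
      simp only [Pi.mul_apply, id, zero_mul] at this
      exact this.mono_left nhdsWithin_le_nhds
    refine h1.congr' ?_
    filter_upwards [self_mem_nhdsWithin] with r hr
    rw [hPr r (ne_of_gt hr)]
  · intro r hr
    have h1 := hφ1 r ⟨hr.1.le, hr.2⟩
    have h2 : φ r ≠ 0 := by linarith
    simp only [hS]
    field_simp
    ring
  · intro r hr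
    have hm : MonotoneOn S (Icc r 1) := by
      refine monotoneOn_of_hasDerivWithinAt_nonneg (convex_Icc r 1)
        (f' := fun r => r ^ (n - 1) * (V r * ψ r)) ?_ ?_ ?_
      · exact fun t ht => (hSd t ⟨hr.1.trans_le ht.1, ht.2⟩).continuousAt.continuousWithinAt
      · intro t ht
        rw [interior_Icc] at ht
        exact (hSd t ⟨hr.1.trans ht.1, ht.2.le⟩).hasDerivWithinAt
      · intro t ht
        rw [interior_Icc] at ht
        have := hr.1.trans ht.1
        have := hV0 t
        have := hψp t ⟨hr.1.trans ht.1, ht.2.le⟩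
        positivity
    have := hm ⟨le_rfl, hr.2⟩ ⟨hr.2, le_rfl⟩ hr.2
    rwa [hS1] at this

namespace FundPair

variable {n : ℕ} {V φ ψ P S : ℝ → ℝ} {C : ℝ}

lemma φ_pos (hp : FundPair n V φ ψ P S C) {r : ℝ} (hr : r ∈ Icc (0 : ℝ) 1) : 0 < φ r :=
  zero_lt_one.trans_le (hp.one_le_φ r hr)

lemma φ_mono (hp : FundPair n V φ ψ P S C) : MonotoneOn φ (Icc 0 1) := by
  refine monotoneOn_of_hasDerivWithinAt_nonneg (convex_Icc 0 1) hp.φ_cont.continuousOn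
    (f' := fun r => P r / r ^ (n - 1)) ?_ ?_
  · intro r hr
    rw [interior_Icc] at hr
    exact (hp.φ_deriv r ⟨hr.1, hr.2.le⟩).hasDerivWithinAt
  · intro r hr
    rw [interior_Icc] at hr
    exact div_nonneg (hp.P_nonneg r ⟨hr.1.le, hr.2.le⟩) (pow_nonneg hr.1.le _)

lemma ψ_anti (hp : FundPair n V φ ψ P S C) : AntitoneOn ψ (Ioc 0 1) := by
  refine antitoneOn_of_hasDerivWithinAt_nonpos (convex_Ioc 0 1)
    (f' := fun r => S r / r ^ (n - 1)) ?_ ?_ ?_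
  · exact fun r hr => (hp.ψ_deriv r hr).continuousAt.continuousWithinAt
  · intro r hr
    rw [interior_Ioc] at hr
    exact (hp.ψ_deriv r ⟨hr.1, hr.2.le⟩).hasDerivWithinAt
  · intro r hr
    rw [interior_Ioc] at hr
    exact div_nonpos_of_nonpos_of_nonneg (hp.S_nonpos r ⟨hr.1, hr.2.le⟩) (pow_nonneg hr.1.le _)

lemma ψ_cont (hp : FundPair n V φ ψ P S C) : ContinuousOn ψ (Ioc 0 1) :=
  fun r hr => (hp.ψ_deriv r hr).continuousAt.continuousWithinAt

end FundPair

/-! ### The Green function -/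

/-- The explicit Green function built from a fundamental pair. -/
def pairGreen (n : ℕ) (φ ψ : ℝ → ℝ) (C r s : ℝ) : ℝ :=
  s ^ (n - 1) / C * (φ (min r s) * ψ (max r s))

/-- On each side of the pole the function is a multiple of `φ` or `ψ`. The prefactor `s ^ (n - 1) /
C` is the one for which the Wronskian identity gives the jump `-1`. -/
lemma isGreenAt_pairGreen {n : ℕ} (hn : 1 ≤ n) {V φ ψ P S : ℝ → ℝ} {C s : ℝ}
    (hp : FundPair n V φ ψ P S C) (hs : s ∈ Ioo (0 : ℝ) 1) :
    IsGreenAt n V s (fun r => pairGreen n φ ψ C r s) := by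
  set g : ℝ → ℝ := fun r => pairGreen n φ ψ C r s with hg
  set A := s ^ (n - 1) / C with hA
  have hs' : s ∈ Ioc (0 : ℝ) 1 := ⟨hs.1, hs.2.le⟩
  have hsn : s ^ (n - 1) ≠ 0 := pow_ne_zero _ hs.1.ne'
  have hleft : ∀ r, r < s → g =ᶠ[𝓝 r] fun r => A * ψ s * φ r := fun r hr => by
    filter_upwards [Iio_mem_nhds hr] with t (ht : t < s)
    simp only [hg, pairGreen, min_eq_left ht.le, max_eq_right ht.le]
    ring
  have hright : ∀ r, s < r → g =ᶠ[𝓝 r] fun r => A * φ s * ψ r := fun r hr => by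
    filter_upwards [Ioi_mem_nhds hr] with t (ht : s < t)
    simp only [hg, pairGreen, min_eq_right ht.le, max_eq_left ht.le]
    ring
  have hdl : ∀ r, 0 < r → r < s → HasDerivAt g (A * ψ s * (P r / r ^ (n - 1))) r :=
    fun r h0 h1 => ((hp.φ_deriv r ⟨h0, (h1.trans hs.2).le⟩).const_mul _).congr_of_eventuallyEq
      (hleft r h1)
  have hdr : ∀ r, s < r → r < 1 → HasDerivAt g (A * φ s * (S r / r ^ (n - 1))) r :=
    fun r h0 h1 => ((hp.ψ_deriv r ⟨hs.1.trans h0, h1.le⟩).const_mul _).congr_of_eventuallyEq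
      (hright r h0)
  have hdl' : ∀ r, 0 < r → r < s → deriv g =ᶠ[𝓝 r] fun r => A * ψ s * (P r / r ^ (n - 1)) :=
    fun r h0 h1 => by
      filter_upwards [Ioo_mem_nhds h0 h1] with t ht using (hdl t ht.1 ht.2).deriv
  have hdr' : ∀ r, s < r → r < 1 → deriv g =ᶠ[𝓝 r] fun r => A * φ s * (S r / r ^ (n - 1)) :=
    fun r h0 h1 => by
      filter_upwards [Ioo_mem_nhds h0 h1] with t ht using (hdr t ht.1 ht.2).deriv
  have hddl : ∀ r, 0 < r → r < s → HasDerivAt (deriv g) (A * ψ s *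
      ((r ^ (n - 1) * (V r * φ r) * r ^ (n - 1) - P r * (((n - 1 : ℕ) : ℝ) * r ^ (n - 1 - 1)))
        / (r ^ (n - 1)) ^ 2)) r := fun r h0 h1 =>
    (((hp.P_deriv r ⟨h0, (h1.trans hs.2).le⟩).div (hasDerivAt_pow (n - 1) r)
      (pow_ne_zero _ h0.ne')).const_mul _).congr_of_eventuallyEq (hdl' r h0 h1)
  have hddr : ∀ r, s < r → r < 1 → HasDerivAt (deriv g) (A * φ s *
      ((r ^ (n - 1) * (V r * ψ r) * r ^ (n - 1) - S r * (((n - 1 : ℕ) : ℝ) * r ^ (n - 1 - 1)))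
        / (r ^ (n - 1)) ^ 2)) r := fun r h0 h1 =>
    (((hp.S_deriv r ⟨hs.1.trans h0, h1.le⟩).div (hasDerivAt_pow (n - 1) r)
      (pow_ne_zero _ (hs.1.trans h0).ne')).const_mul _).congr_of_eventuallyEq (hdr' r h0 h1)
  -- Passage from divergence form to the expanded equation. The case `n = 1` is separate because the
  -- exponent `n - 1 - 1` truncates.
  have key : ∀ r : ℝ, 0 < r → ∀ X f : ℝ,
      -((r ^ (n - 1) * (V r * f) * r ^ (n - 1) - X * (((n - 1 : ℕ) : ℝ) * r ^ (n - 1 - 1)))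
        / (r ^ (n - 1)) ^ 2) - ((n : ℝ) - 1) / r * (X / r ^ (n - 1)) + V r * f = 0 := by
    intro r hr X f
    obtain ⟨m, rfl⟩ := Nat.exists_eq_add_of_le' hn
    simp only [Nat.add_sub_cancel, Nat.cast_add, Nat.cast_one, add_sub_cancel_right]
    rcases m with _ | m
    · simp
    · simp only [Nat.add_sub_cancel]
      have : r ≠ 0 := hr.ne'
      field_simp
      ring
  refine ⟨?_, ?_, ?_, ?_, ?_, ?_, ?_⟩
  · simp only [hg, pairGreen]
    refine continuousOn_const.mul (ContinuousOn.mul ?_ ?_)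
    · exact (hp.φ_cont.comp (continuous_id.min continuous_const)).continuousOn
    · exact hp.ψ_cont.comp (by fun_prop) fun r hr =>
        ⟨hs.1.trans_le (le_max_right _ _), max_le hr.2 hs.2.le⟩
  · intro r hr hrs
    rcases lt_or_gt_of_ne hrs with h | h
    · exact (hdl r hr.1 h).differentiableAt
    · exact (hdr r h hr.2).differentiableAt
  · intro r hr hrs
    rcases lt_or_gt_of_ne hrs with h | h
    · exact (hddl r hr.1 h).differentiableAt
    · exact (hddr r h hr.2).differentiableAt
  · intro r hr hrs
    rcases lt_or_gt_of_ne hrs with h | h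
    · rw [(hddl r hr.1 h).deriv, (hdl r hr.1 h).deriv, (hleft r h).eq_of_nhds]
      linear_combination A * ψ s * key r hr.1 (P r) (φ r)
    · rw [(hddr r h hr.2).deriv, (hdr r h hr.2).deriv, (hright r h).eq_of_nhds]
      linear_combination A * φ s * key r hr.1 (S r) (ψ r)
  · have h1 := hp.φ_deriv_zero.const_mul (A * ψ s)
    rw [mul_zero] at h1
    refine h1.congr' ?_
    filter_upwards [Ioo_mem_nhdsGT hs.1] with r hr using (hdl r hr.1 hr.2).deriv.symm
  · have h1 : Tendsto (fun r => A * φ s * (S r / r ^ (n - 1))) (𝓝[<] 1) (𝓝 0) := by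
      have h2 : ContinuousAt (fun r => A * φ s * (S r / r ^ (n - 1))) 1 :=
        continuousAt_const.mul ((hp.S_deriv 1 ⟨zero_lt_one, le_rfl⟩).continuousAt.div
          (by fun_prop) (by simp))
      have h3 := h2.tendsto
      simp only [hp.S_one, zero_div, mul_zero] at h3
      exact h3.mono_left nhdsWithin_le_nhds
    refine h1.congr' ?_
    filter_upwards [Ioo_mem_nhdsLT hs.2] with r hr using (hdr r hr.1 hr.2).deriv.symm
  · refine ⟨A * ψ s * (P s / s ^ (n - 1)), ?_, ?_⟩
    · have h2 : ContinuousAt (fun r => A * ψ s * (P r / r ^ (n - 1))) s :=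
        continuousAt_const.mul ((hp.P_deriv s hs').continuousAt.div (by fun_prop) hsn)
      refine (h2.tendsto.mono_left nhdsWithin_le_nhds).congr' ?_
      filter_upwards [Ioo_mem_nhdsLT hs.1] with r hr using (hdl r hr.1 hr.2).deriv.symm
    · have h2 : ContinuousAt (fun r => A * φ s * (S r / r ^ (n - 1))) s :=
        continuousAt_const.mul ((hp.S_deriv s hs').continuousAt.div (by fun_prop) hsn)
      have h3 : A * ψ s * (P s / s ^ (n - 1)) - 1 = A * φ s * (S s / s ^ (n - 1)) := by
        have hC := hp.C_pos.ne'
        have := hp.wronskian s hs'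
        rw [hA]
        field_simp
        linarith
      rw [h3]
      refine (h2.tendsto.mono_left nhdsWithin_le_nhds).congr' ?_
      filter_upwards [Ioo_mem_nhdsGT hs.2] with r hr using (hdr r hr.1 hr.2).deriv.symm

/-- The jumps cancel in the difference `h`, so `r ^ (n - 1) h h'` is continuous across the pole. It
is nondecreasing with limit 0 at both ends, hence zero. Then `h' = 0` and `V h² = 0`, and `V` is
positive somewhere. -/
lemma isGreenAt_unique {n : ℕ} (hn : 1 ≤ n) {V : ℝ → ℝ} (hV : Continuous V)
    (hV0 : ∀ r, 0 ≤ V r) (hV1 : ∃ r ∈ Icc (0 : ℝ) 1, V r ≠ 0) {s : ℝ} (hs : s ∈ Ioo (0 : ℝ) 1)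
    {g₁ g₂ : ℝ → ℝ} (h₁ : IsGreenAt n V s g₁) (h₂ : IsGreenAt n V s g₂) :
    ∀ r ∈ Icc (0 : ℝ) 1, g₁ r = g₂ r := by
  obtain ⟨a₁, hl₁, hr₁⟩ := h₁.jump
  obtain ⟨a₂, hl₂, hr₂⟩ := h₂.jump
  set h : ℝ → ℝ := fun r => g₁ r - g₂ r with hh
  have hhc : ContinuousOn h (Icc 0 1) := h₁.continuousOn.sub h₂.continuousOn
  -- The derivative at the pole itself is not under control, so it is replaced by the common
  -- one-sided limit.
  set k : ℝ → ℝ := Function.update (fun r => deriv g₁ r - deriv g₂ r) s (a₁ - a₂) with hk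
  have hkne : ∀ r, r ≠ s → k r = deriv g₁ r - deriv g₂ r := fun r hr => by
    simp [hk, Function.update_of_ne hr]
  have hks : k s = a₁ - a₂ := by simp [hk]
  have hkl : Tendsto k (𝓝[<] s) (𝓝 (k s)) := by
    rw [hks]
    refine (hl₁.sub hl₂).congr' ?_
    filter_upwards [self_mem_nhdsWithin] with r hr using (hkne r (ne_of_lt hr)).symm
  have hkr : Tendsto k (𝓝[>] s) (𝓝 (k s)) := by
    rw [hks]
    have := hr₁.sub hr₂
    rw [sub_sub_sub_cancel_right] at this
    refine this.congr' ?_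
    filter_upwards [self_mem_nhdsWithin] with r hr using (hkne r (ne_of_gt hr)).symm
  have hkcs : ContinuousAt k s := by
    rw [continuousAt_iff_continuous_left'_right']
    exact ⟨hkl, hkr⟩
  have hhd : ∀ r ∈ Ioo (0 : ℝ) 1, r ≠ s → HasDerivAt h (k r) r := fun r hr hrs => by
    rw [hkne r hrs]
    exact (h₁.differentiableAt r hr hrs).hasDerivAt.sub (h₂.differentiableAt r hr hrs).hasDerivAt
  have hkd : ∀ r ∈ Ioo (0 : ℝ) 1, r ≠ s →
      HasDerivAt k (V r * h r - ((n : ℝ) - 1) / r * k r) r := fun r hr hrs => by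
    have h3 := (h₁.differentiableAt_deriv r hr hrs).hasDerivAt.sub
      (h₂.differentiableAt_deriv r hr hrs).hasDerivAt
    have h4 : k =ᶠ[𝓝 r] fun r => deriv g₁ r - deriv g₂ r := by
      filter_upwards [isOpen_ne.mem_nhds hrs] with t ht using hkne t ht
    refine (h3.congr_of_eventuallyEq h4).congr_deriv ?_
    rw [hkne r hrs]
    linear_combination h₂.equation r hr hrs - h₁.equation r hr hrs
  have hkc : ContinuousOn k (Ioo 0 1) := fun r hr => by
    by_cases hrs : r = s
    · rw [hrs]; exact hkcs.continuousWithinAt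
    · exact (hkd r hr hrs).continuousAt.continuousWithinAt
  set Y : ℝ → ℝ := fun r => r ^ (n - 1) * (h r * k r) with hY
  have hYc : ContinuousOn Y (Ioo 0 1) :=
    (by fun_prop : Continuous fun r : ℝ => r ^ (n - 1)).continuousOn.mul
      ((hhc.mono Ioo_subset_Icc_self).mul hkc)
  have hYd : ∀ r ∈ Ioo (0 : ℝ) 1, r ≠ s →
      HasDerivAt Y (r ^ (n - 1) * (k r ^ 2 + V r * h r ^ 2)) r := fun r hr hrs => by
    refine ((hasDerivAt_pow (n - 1) r).mul ((hhd r hr hrs).mul (hkd r hr hrs))).congr_deriv ?_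
    have : r ≠ 0 := hr.1.ne'
    obtain ⟨m, rfl⟩ := Nat.exists_eq_add_of_le' hn
    simp only [Nat.add_sub_cancel, Nat.cast_add, Nat.cast_one, add_sub_cancel_right, Pi.mul_apply]
    rcases m with _ | m
    · simp; ring
    · simp only [Nat.add_sub_cancel]
      field_simp
      ring
  have hYn : ∀ r ∈ Ioo (0 : ℝ) 1, 0 ≤ r ^ (n - 1) * (k r ^ 2 + V r * h r ^ 2) := fun r hr => by
    have := hr.1
    have := hV0 r
    positivity
  have hml : MonotoneOn Y (Ioc 0 s) := by
    refine monotoneOn_of_hasDerivWithinAt_nonneg (convex_Ioc 0 s)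
      (f' := fun r => r ^ (n - 1) * (k r ^ 2 + V r * h r ^ 2))
      (hYc.mono fun r hr => ⟨hr.1, hr.2.trans_lt hs.2⟩) ?_ ?_
    · intro r hr
      rw [interior_Ioc] at hr
      exact (hYd r ⟨hr.1, hr.2.trans hs.2⟩ hr.2.ne).hasDerivWithinAt
    · intro r hr
      rw [interior_Ioc] at hr
      exact hYn r ⟨hr.1, hr.2.trans hs.2⟩
  have hmr : MonotoneOn Y (Ico s 1) := by
    refine monotoneOn_of_hasDerivWithinAt_nonneg (convex_Ico s 1)
      (f' := fun r => r ^ (n - 1) * (k r ^ 2 + V r * h r ^ 2))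
      (hYc.mono fun r hr => ⟨hs.1.trans_le hr.1, hr.2⟩) ?_ ?_
    · intro r hr
      rw [interior_Ico] at hr
      exact (hYd r ⟨hs.1.trans hr.1, hr.2⟩ hr.1.ne').hasDerivWithinAt
    · intro r hr
      rw [interior_Ico] at hr
      exact hYn r ⟨hs.1.trans hr.1, hr.2⟩
  have hmono : MonotoneOn Y (Ioo 0 1) := by
    have := hml.union_right hmr ⟨⟨hs.1, le_rfl⟩, fun x hx => hx.2⟩
      ⟨⟨le_rfl, hs.2⟩, fun x hx => hx.1⟩
    rwa [Ioc_union_Ico_eq_Ioo hs.1 hs.2] at this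
  have hY0 : Tendsto Y (𝓝[>] 0) (𝓝 0) := by
    have e1 : Tendsto (fun r : ℝ => r ^ (n - 1)) (𝓝[>] 0) (𝓝 (0 ^ (n - 1))) :=
      ((continuous_pow (n - 1)).tendsto 0).mono_left nhdsWithin_le_nhds
    have e2 : Tendsto h (𝓝[>] 0) (𝓝 (h 0)) := by
      have := (hhc 0 ⟨le_rfl, zero_le_one⟩).tendsto
      rw [nhdsWithin_Icc_eq_nhdsGE zero_lt_one] at this
      exact this.mono_left (nhdsWithin_mono _ Ioi_subset_Ici_self)
    have e3 : Tendsto k (𝓝[>] 0) (𝓝 (0 - 0)) := by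
      refine (h₁.deriv_zero.sub h₂.deriv_zero).congr' ?_
      filter_upwards [Ioo_mem_nhdsGT hs.1] with r hr using (hkne r hr.2.ne).symm
    simpa using e1.mul (e2.mul e3)
  have hY1 : Tendsto Y (𝓝[<] 1) (𝓝 0) := by
    have e1 : Tendsto (fun r : ℝ => r ^ (n - 1)) (𝓝[<] 1) (𝓝 (1 ^ (n - 1))) :=
      ((continuous_pow (n - 1)).tendsto 1).mono_left nhdsWithin_le_nhds
    have e2 : Tendsto h (𝓝[<] 1) (𝓝 (h 1)) := by
      have := (hhc 1 ⟨zero_le_one, le_rfl⟩).tendsto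
      rw [nhdsWithin_Icc_eq_nhdsLE zero_lt_one] at this
      exact this.mono_left (nhdsWithin_mono _ Iio_subset_Iic_self)
    have e3 : Tendsto k (𝓝[<] 1) (𝓝 (0 - 0)) := by
      refine (h₁.deriv_one.sub h₂.deriv_one).congr' ?_
      filter_upwards [Ioo_mem_nhdsLT hs.2] with r hr using (hkne r hr.1.ne').symm
    simpa using e1.mul (e2.mul e3)
  have hYz : ∀ r ∈ Ioo (0 : ℝ) 1, Y r = 0 := by
    intro r hr
    refine le_antisymm ?_ ?_
    · refine ge_of_tendsto hY1 ?_
      filter_upwards [Ioo_mem_nhdsLT hr.2] with t ht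
      exact hmono hr ⟨hr.1.trans ht.1, ht.2⟩ ht.1.le
    · refine le_of_tendsto hY0 ?_
      filter_upwards [Ioo_mem_nhdsGT hr.1] with t ht
      exact hmono ⟨ht.1, ht.2.trans hr.2⟩ hr ht.2.le
  have hz : ∀ r ∈ Ioo (0 : ℝ) 1, r ≠ s → k r = 0 ∧ V r * h r ^ 2 = 0 := by
    intro r hr hrs
    have h5 : Y =ᶠ[𝓝 r] fun _ => 0 := by
      filter_upwards [Ioo_mem_nhds hr.1 hr.2] with t ht using hYz t ht
    have h6 := (hYd r hr hrs).unique ((hasDerivAt_const r (0 : ℝ)).congr_of_eventuallyEq h5)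
    have h7 : k r ^ 2 + V r * h r ^ 2 = 0 :=
      (mul_eq_zero.1 h6).resolve_left (pow_ne_zero _ hr.1.ne')
    have h8 : 0 ≤ V r * h r ^ 2 := mul_nonneg (hV0 r) (sq_nonneg _)
    have h9 := sq_nonneg (k r)
    exact ⟨pow_eq_zero_iff (two_ne_zero) |>.1 (by linarith), by linarith⟩
  have hconst : ∀ a b : ℝ, a ∈ Icc (0 : ℝ) 1 → b ∈ Icc (0 : ℝ) 1 → a ≤ b → s ∉ Ioo a b →
      h a = h b := by
    intro a b ha hb hab hsab
    rcases hab.eq_or_lt with rfl | hab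
    · rfl
    obtain ⟨c, hc, hc'⟩ := exists_hasDerivAt_eq_slope h k hab
      (hhc.mono (Icc_subset_Icc ha.1 hb.2))
      fun x hx => hhd x ⟨ha.1.trans_lt hx.1, hx.2.trans_le hb.2⟩ fun hxs => hsab (hxs ▸ hx)
    rw [(hz c ⟨ha.1.trans_lt hc.1, hc.2.trans_le hb.2⟩ fun hxs => hsab (hxs ▸ hc)).1, eq_comm,
      div_eq_zero_iff] at hc'
    rcases hc' with hc' | hc' <;> linarith
  have hsI : s ∈ Icc (0 : ℝ) 1 := ⟨hs.1.le, hs.2.le⟩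
  have hhs : ∀ r ∈ Icc (0 : ℝ) 1, h r = h s := fun r hr => by
    rcases le_total r s with hrs | hrs
    · exact hconst r s hr hsI hrs fun hx => lt_irrefl _ hx.2
    · exact (hconst s r hsI hr hrs fun hx => lt_irrefl _ hx.1).symm
  obtain ⟨t, ht, hts, hVt⟩ := exists_pos_mem_Ioo hV hV0 hV1 s
  have ht0 : h t = 0 := by
    have := (mul_eq_zero.1 (hz t ht hts).2).resolve_left hVt.ne'
    exact pow_eq_zero_iff two_ne_zero |>.1 this
  intro r hr
  have : h r = 0 := by rw [hhs r hr, ← hhs t ⟨ht.1.le, ht.2.le⟩, ht0]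
  exact sub_eq_zero.1 this

lemma interiorGreen_spec {n : ℕ} (hn : 1 ≤ n) {V φ ψ P S : ℝ → ℝ} {C s : ℝ}
    (hp : FundPair n V φ ψ P S C) (hs : s ∈ Ioo (0 : ℝ) 1) :
    IsGreenAt n V s (interiorGreen n V s) := by
  have h : ∃ g, IsGreenAt n V s g := ⟨_, isGreenAt_pairGreen hn hp hs⟩
  rw [interiorGreen, dif_pos h]
  exact h.choose_spec

lemma interiorGreen_eq {n : ℕ} (hn : 1 ≤ n) {V φ ψ P S : ℝ → ℝ} {C s : ℝ} (hV : Continuous V)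
    (hV0 : ∀ r, 0 ≤ V r) (hV1 : ∃ r ∈ Icc (0 : ℝ) 1, V r ≠ 0)
    (hp : FundPair n V φ ψ P S C) (hs : s ∈ Ioo (0 : ℝ) 1) :
    ∀ r ∈ Icc (0 : ℝ) 1, interiorGreen n V s r = pairGreen n φ ψ C r s :=
  isGreenAt_unique hn hV hV0 hV1 hs (interiorGreen_spec hn hp hs) (isGreenAt_pairGreen hn hp hs)

lemma tendsto_interiorGreen {n : ℕ} (hn : 1 ≤ n) {V φ ψ P S : ℝ → ℝ} {C : ℝ} (hV : Continuous V)
    (hV0 : ∀ r, 0 ≤ V r) (hV1 : ∃ r ∈ Icc (0 : ℝ) 1, V r ≠ 0)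
    (hp : FundPair n V φ ψ P S C) {r : ℝ} (hr : r ∈ Icc (0 : ℝ) 1) :
    Tendsto (fun σ => interiorGreen n V σ r) (𝓝[<] 1) (𝓝 (pairGreen n φ ψ C r 1)) := by
  have h1 : ContinuousWithinAt (fun σ => pairGreen n φ ψ C r σ) (Ioc 0 1) 1 := by
    unfold pairGreen
    refine ContinuousWithinAt.mul (by fun_prop) (ContinuousWithinAt.mul ?_ ?_)
    · exact (hp.φ_cont.comp (continuous_const.min continuous_id)).continuousWithinAt
    · refine (hp.ψ_cont (max r 1) ⟨zero_lt_one.trans_le (le_max_right _ _),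
        max_le hr.2 le_rfl⟩).comp (f := fun σ => max r σ) (t := Ioc 0 1) (by fun_prop) fun σ hσ =>
          ⟨hσ.1.trans_le (le_max_right _ _), max_le hr.2 hσ.2⟩
  have h2 : 𝓝[<] (1 : ℝ) ≤ 𝓝[Ioc 0 1] 1 := by
    rw [nhdsWithin_Ioc_eq_nhdsLE zero_lt_one]
    exact nhdsWithin_mono _ Iio_subset_Iic_self
  refine (h1.tendsto.mono_left h2).congr' ?_
  filter_upwards [Ioo_mem_nhdsLT zero_lt_one] with σ hσ
  exact (interiorGreen_eq hn hV hV0 hV1 hp hσ r hr).symm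

lemma green_eq {n : ℕ} (hn : 1 ≤ n) {V φ ψ P S : ℝ → ℝ} {C : ℝ} (hV : Continuous V)
    (hV0 : ∀ r, 0 ≤ V r) (hV1 : ∃ r ∈ Icc (0 : ℝ) 1, V r ≠ 0)
    (hp : FundPair n V φ ψ P S C) {r s : ℝ} (hr : r ∈ Icc (0 : ℝ) 1) (hs : s ∈ Ioc (0 : ℝ) 1) :
    green n V r s = pairGreen n φ ψ C r s := by
  by_cases h : s = 1
  · subst h
    rw [green, if_pos rfl]
    exact (tendsto_interiorGreen hn hV hV0 hV1 hp hr).limUnder_eq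
  · rw [green, if_neg h]
    exact interiorGreen_eq hn hV hV0 hV1 hp ⟨hs.1, lt_of_le_of_ne hs.2 h⟩ r hr

theorem green_spec {n : ℕ} (hn : 1 ≤ n) {V φ ψ P S : ℝ → ℝ} {C : ℝ} (hV : Continuous V)
    (hV0 : ∀ r, 0 ≤ V r) (hV1 : ∃ r ∈ Icc (0 : ℝ) 1, V r ≠ 0) (hp : FundPair n V φ ψ P S C) :
    (∀ s ∈ Ioo (0 : ℝ) 1, IsGreenAt n V s (fun r => green n V r s) ∧
        ∀ g, IsGreenAt n V s g → ∀ r ∈ Icc (0 : ℝ) 1, g r = green n V r s) ∧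
      (∀ r ∈ Icc (0 : ℝ) 1,
        Tendsto (fun s => green n V r s) (𝓝[<] 1) (𝓝 (green n V r 1))) ∧
      ∀ r ∈ Ioc (0 : ℝ) 1, 0 < green n V r r := by
  have hint : ∀ s ∈ Ioo (0 : ℝ) 1, (fun r => green n V r s) = interiorGreen n V s := fun s hs => by
    ext r; rw [green, if_neg hs.2.ne]
  refine ⟨fun s hs => ?_, fun r hr => ?_, fun r hr => ?_⟩
  · have h1 := interiorGreen_spec hn hp hs
    rw [← hint s hs] at h1
    exact ⟨h1, fun g hg => isGreenAt_unique hn hV hV0 hV1 hs hg h1⟩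
  · rw [green_eq hn hV hV0 hV1 hp hr ⟨zero_lt_one, le_rfl⟩]
    refine (tendsto_interiorGreen hn hV hV0 hV1 hp hr).congr' ?_
    filter_upwards [self_mem_nhdsWithin] with s hs
    rw [green, if_neg (ne_of_lt hs)]
  · have hr' : r ∈ Icc (0 : ℝ) 1 := ⟨hr.1.le, hr.2⟩
    rw [green_eq hn hV hV0 hV1 hp hr' hr, pairGreen, min_self, max_self]
    have := hp.C_pos
    have := hp.φ_pos hr'
    have := hp.ψ_pos r hr
    have := hr.1
    positivity

/-! ### The weighted measure `r ^ (n - 1) dr` -/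

/-- The measure `r ^ (n - 1) dr` on `(0, 1]`. -/
def wt (n : ℕ) : Measure ℝ :=
  (volume.restrict (Ioc 0 1)).withDensity (fun r => ENNReal.ofReal (r ^ (n - 1)))

/-- The density is positive on `(0, 1]`, so both measures have the same null sets. -/
lemma ae_wt_iff {n : ℕ} {p : ℝ → Prop} :
    (∀ᵐ r ∂(wt n), p r) ↔ ∀ᵐ r ∂(volume.restrict (Ioc (0 : ℝ) 1)), p r := by
  rw [wt, ae_withDensity_iff (by fun_prop)]
  refine ⟨fun h => ?_, fun h => h.mono fun r hr _ => hr⟩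
  filter_upwards [h, ae_restrict_mem measurableSet_Ioc] with r hr hr'
  refine hr ?_
  have := pow_pos hr'.1 (n - 1)
  simpa using this

lemma ae_wt_of_forall {n : ℕ} {p : ℝ → Prop} (h : ∀ r ∈ Ioc (0 : ℝ) 1, p r) :
    ∀ᵐ r ∂(wt n), p r := by
  rw [ae_wt_iff]
  filter_upwards [ae_restrict_mem measurableSet_Ioc] with r hr using h r hr

lemma restrict_ac_wt (n : ℕ) : volume.restrict (Ioc (0 : ℝ) 1) ≪ wt n :=
  fun s hs => by
    have h1 : ∀ᵐ r ∂(wt n), r ∉ s := measure_eq_zero_iff_ae_notMem.1 hs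
    exact measure_eq_zero_iff_ae_notMem.2 (ae_wt_iff.1 h1)

lemma wt_ac_restrict (n : ℕ) : wt n ≪ volume.restrict (Ioc (0 : ℝ) 1) :=
  withDensity_absolutelyContinuous _ _

lemma integral_wt' (n : ℕ) (f : ℝ → ℝ) :
    ∫ r, f r ∂(wt n) = ∫ r in Ioc (0 : ℝ) 1, r ^ (n - 1) * f r := by
  rw [wt, integral_withDensity_eq_integral_toReal_smul (by fun_prop) (by simp)]
  refine setIntegral_congr_fun measurableSet_Ioc fun r hr => ?_
  simp [ENNReal.toReal_ofReal (pow_nonneg hr.1.le _)]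

lemma integral_wt (n : ℕ) (f : ℝ → ℝ) :
    ∫ r, f r ∂(wt n) = ∫ r in (0 : ℝ)..1, r ^ (n - 1) * f r := by
  rw [integral_wt', intervalIntegral.integral_of_le zero_le_one]

lemma integrable_wt_iff {n : ℕ} {f : ℝ → ℝ} :
    Integrable f (wt n) ↔ IntegrableOn (fun r => r ^ (n - 1) * f r) (Ioc 0 1) := by
  rw [wt, integrable_withDensity_iff_integrable_smul' (by fun_prop) (by simp)]
  refine integrableOn_congr_fun (fun r hr => ?_) measurableSet_Ioc
  simp [ENNReal.toReal_ofReal (pow_nonneg hr.1.le _)]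

instance (n : ℕ) : IsFiniteMeasure (wt n) := by
  refine isFiniteMeasure_withDensity_ofReal ?_
  exact ((continuous_pow (n - 1)).integrableOn_Ioc (μ := volume)).2

lemma integral_wt_const {n : ℕ} (hn : 1 ≤ n) (c : ℝ) : ∫ _, c ∂(wt n) = c / n := by
  rw [integral_wt, intervalIntegral.integral_mul_const, integral_pow, Nat.sub_add_cancel hn]
  have h1 : ((n - 1 : ℕ) : ℝ) + 1 = n := by rw [Nat.cast_sub hn]; simp
  rw [h1, zero_pow (by omega)]
  simp
  ring

lemma aesm_wt {n : ℕ} {f : ℝ → ℝ} (hc : ContinuousOn f (Ioc 0 1)) :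
    AEStronglyMeasurable f (wt n) :=
  (hc.aestronglyMeasurable measurableSet_Ioc).mono_ac (wt_ac_restrict n)

lemma memLp_wt {n : ℕ} {f : ℝ → ℝ} {M : ℝ} (p : ℝ≥0∞) (hc : ContinuousOn f (Ioc 0 1))
    (hb : ∀ r ∈ Ioc (0 : ℝ) 1, |f r| ≤ M) : MemLp f p (wt n) :=
  MemLp.of_bound (aesm_wt hc) M (ae_wt_of_forall hb)

lemma integrable_wt {n : ℕ} {f : ℝ → ℝ} {M : ℝ} (hc : ContinuousOn f (Ioc 0 1))
    (hb : ∀ r ∈ Ioc (0 : ℝ) 1, |f r| ≤ M) : Integrable f (wt n) :=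
  memLp_one_iff_integrable.1 (memLp_wt 1 hc hb)

/-- On `(r, 1]` the density is at least `r ^ (n - 1)`, so weighted square integrability is ordinary
square integrability away from the origin, and primitives make sense there. -/
lemma memLp_restrict_of_wt {n : ℕ} {d : ℝ → ℝ} {r : ℝ} (hr : 0 < r)
    (hd : MemLp d 2 (wt n)) : MemLp d 2 (volume.restrict (Ioc r 1)) := by
  refine hd.of_measure_le_smul (c := ENNReal.ofReal ((r ^ (n - 1))⁻¹)) ENNReal.ofReal_ne_top ?_
  have hrn : 0 < r ^ (n - 1) := pow_pos hr _
  refine Measure.le_iff.2 fun s hs => ?_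
  rw [Measure.smul_apply, wt, withDensity_apply _ hs, smul_eq_mul, Measure.restrict_restrict hs,
    Measure.restrict_apply hs]
  calc volume (s ∩ Ioc r 1) = ENNReal.ofReal ((r ^ (n - 1))⁻¹) *
        ∫⁻ _ in s ∩ Ioc r 1, ENNReal.ofReal (r ^ (n - 1)) := by
        rw [lintegral_const, Measure.restrict_apply_univ, ← mul_assoc, ← ENNReal.ofReal_mul
          (by positivity), inv_mul_cancel₀ hrn.ne', ENNReal.ofReal_one, one_mul]
    _ ≤ ENNReal.ofReal ((r ^ (n - 1))⁻¹) *
        ∫⁻ a in s ∩ Ioc r 1, ENNReal.ofReal (a ^ (n - 1)) := by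
        gcongr 1
        refine setLIntegral_mono' (hs.inter measurableSet_Ioc) fun a ha => ?_
        have := ha.2.1
        gcongr
    _ ≤ _ := by
        gcongr 1
        refine lintegral_mono_set (inter_subset_inter_right _ (Ioc_subset_Ioc_left hr.le))

lemma intervalIntegrable_of_wt {n : ℕ} {d : ℝ → ℝ} (hd : MemLp d 2 (wt n)) {r s : ℝ}
    (hr : r ∈ Ioc (0 : ℝ) 1) (hs : s ∈ Ioc (0 : ℝ) 1) : IntervalIntegrable d volume r s := by
  rw [intervalIntegrable_iff]
  have h := (memLp_restrict_of_wt (lt_min hr.1 hs.1) hd).integrable one_le_two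
  refine IntegrableOn.mono_set (t := Ioc (min r s) 1) h ?_
  rw [uIoc]
  exact Ioc_subset_Ioc_right (max_le hr.2 hs.2)

/-- Integration by parts against the weight, with one factor given as a primitive. -/
theorem weighted_integration_by_parts {n : ℕ} {h ζ ξ : ℝ → ℝ} {M : ℝ}
    (hc : ContinuousOn h (Ioc 0 1)) (hb : ∀ r ∈ Ioc (0 : ℝ) 1, |h r| ≤ M)
    (hξ : MemLp ξ 2 (wt n)) (hζ : ∀ r ∈ Ioc (0 : ℝ) 1, ζ r = ζ 1 - ∫ t in r..1, ξ t) :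
    Integrable (fun t => ξ t * ((∫ s in (0 : ℝ)..t, s ^ (n - 1) * h s) / t ^ (n - 1))) (wt n) ∧
    Integrable (fun r => h r * ζ r) (wt n) ∧
    ∫ r, h r * ζ r ∂(wt n) = ζ 1 * (∫ s in (0 : ℝ)..1, s ^ (n - 1) * h s) -
      ∫ t, ξ t * ((∫ s in (0 : ℝ)..t, s ^ (n - 1) * h s) / t ^ (n - 1)) ∂(wt n) := by
  set ν := volume.restrict (Ioc (0 : ℝ) 1) with hν
  set a : ℝ → ℝ := fun s => s ^ (n - 1) * h s with ha
  have hM : 0 ≤ M := (abs_nonneg _).trans (hb 1 ⟨zero_lt_one, le_rfl⟩)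
  have hac : ContinuousOn a (Ioc 0 1) := (continuous_pow (n - 1)).continuousOn.mul hc
  have haM : AEStronglyMeasurable a ν := hac.aestronglyMeasurable measurableSet_Ioc
  have hξM : AEStronglyMeasurable ξ ν := hξ.aestronglyMeasurable.mono_ac (restrict_ac_wt n)
  have hai : IntegrableOn a (Ioc 0 1) :=
    integrable_wt_iff.1 (integrable_wt hc hb)
  have hξi : IntegrableOn (fun t => t ^ (n - 1) * ξ t) (Ioc 0 1) :=
    integrable_wt_iff.1 (hξ.integrable one_le_two)
  -- The formula is Fubini on the triangle `s < t`, which needs no differentiability of `h` and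
  -- produces no boundary term at 0.
  set F : ℝ → ℝ → ℝ := fun s t => (Ioi s).indicator (fun t => a s * ξ t) t with hF
  have hFi : Integrable (Function.uncurry F) (ν.prod ν) := by
    -- For `s < t` the weight satisfies `s ^ (n - 1) ≤ t ^ (n - 1)`, so `M t ^ (n - 1) |ξ t|`
    -- dominates. No bound on `ζ` near 0 is required.
    have h1 := (hξi.norm.const_mul M).comp_snd ν
    refine h1.mono' ?_ ?_
    · have h2 : Function.uncurry F = {q : ℝ × ℝ | q.1 < q.2}.indicator
          (fun q => a q.1 * ξ q.2) := by
        ext ⟨s, t⟩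
        simp [hF, indicator]
      rw [h2]
      exact ((haM.comp_fst (ν := ν)).mul (hξM.comp_snd (μ := ν))).indicator
        (measurableSet_lt measurable_fst measurable_snd)
    · rw [hν, Measure.prod_restrict]
      filter_upwards [ae_restrict_mem (measurableSet_Ioc.prod measurableSet_Ioc)]
      rintro ⟨s, t⟩ ⟨hs, ht⟩
      simp only [Function.uncurry, hF, norm_mul, norm_pow, Real.norm_of_nonneg ht.1.le]
      by_cases hst : s < t
      · rw [indicator_of_mem (show t ∈ Ioi s from hst)]
        rw [norm_mul]
        simp only [ha]
        rw [norm_mul, norm_pow, Real.norm_of_nonneg hs.1.le]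
        calc s ^ (n - 1) * ‖h s‖ * ‖ξ t‖ ≤ t ^ (n - 1) * M * ‖ξ t‖ := by
              gcongr
              · exact pow_nonneg ht.1.le _
              · exact hs.1.le
              · exact hb s hs
          _ = _ := by ring
      · rw [indicator_of_notMem (show t ∉ Ioi s from hst)]
        simp only [norm_zero]
        have := ht.1
        positivity
  have hswap := integral_integral_swap hFi
  have h3 : ∀ s ∈ Ioc (0 : ℝ) 1, ∫ t, F s t ∂ν = a s * ∫ t in s..1, ξ t := by
    intro s hs
    simp only [hF]
    rw [integral_indicator measurableSet_Ioi, hν, Measure.restrict_restrict measurableSet_Ioi,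
      integral_const_mul, intervalIntegral.integral_of_le hs.2, inter_comm,
      Ioc_inter_Ioi, max_eq_right hs.1.le]
  have h4 : ∀ t ∈ Ioc (0 : ℝ) 1, ∫ s, F s t ∂ν = ξ t * ∫ s in (0 : ℝ)..t, a s := by
    intro t ht
    have : ∀ s, F s t = (Iio t).indicator (fun s => a s * ξ t) s := fun s => by
      simp [hF, indicator]
    simp only [this]
    rw [integral_indicator measurableSet_Iio, hν, Measure.restrict_restrict measurableSet_Iio,
      integral_mul_const, intervalIntegral.integral_of_le ht.1.le, mul_comm, inter_comm]
    congr 1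
    have h5 : Ioc (0 : ℝ) 1 ∩ Iio t = Ioo 0 t := by
      ext x
      simp only [mem_inter_iff, mem_Ioc, mem_Iio, mem_Ioo]
      exact ⟨fun h => ⟨h.1.1, h.2⟩, fun h => ⟨⟨h.1, h.2.le.trans ht.2⟩, h.2⟩⟩
    rw [h5, integral_Ioc_eq_integral_Ioo]
  have hi1 : IntegrableOn (fun s => a s * ∫ t in s..1, ξ t) (Ioc 0 1) :=
    IntegrableOn.congr_fun hFi.integral_prod_left (fun s hs => h3 s hs) measurableSet_Ioc
  have hi2 : IntegrableOn (fun t => ξ t * ∫ s in (0 : ℝ)..t, a s) (Ioc 0 1) :=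
    IntegrableOn.congr_fun hFi.integral_prod_right (fun s hs => h4 s hs) measurableSet_Ioc
  have e1 : ∫ s, ∫ t, F s t ∂ν ∂ν = ∫ s in Ioc (0 : ℝ) 1, a s * ∫ t in s..1, ξ t :=
    setIntegral_congr_fun measurableSet_Ioc fun s hs => h3 s hs
  have e2 : ∫ t, ∫ s, F s t ∂ν ∂ν = ∫ t in Ioc (0 : ℝ) 1, ξ t * ∫ s in (0 : ℝ)..t, a s :=
    setIntegral_congr_fun measurableSet_Ioc fun s hs => h4 s hs
  have e3 : ∀ t ∈ Ioc (0 : ℝ) 1, t ^ (n - 1) * (ξ t * ((∫ s in (0 : ℝ)..t, a s) / t ^ (n - 1))) =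
      ξ t * ∫ s in (0 : ℝ)..t, a s := fun t ht => by
    have := (pow_pos ht.1 (n - 1)).ne'
    field_simp
  have e4 : ∀ s ∈ Ioc (0 : ℝ) 1, s ^ (n - 1) * (h s * ζ s) =
      ζ 1 * a s - a s * ∫ t in s..1, ξ t := fun s hs => by
    rw [hζ s hs]
    simp only [ha]
    ring
  refine ⟨?_, ?_, ?_⟩
  · rw [integrable_wt_iff]
    exact hi2.congr_fun (fun t ht => (e3 t ht).symm) measurableSet_Ioc
  · rw [integrable_wt_iff]
    exact IntegrableOn.congr_fun ((hai.const_mul (ζ 1)).sub hi1) (fun s hs => (e4 s hs).symm)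
      measurableSet_Ioc
  · rw [integral_wt', integral_wt', setIntegral_congr_fun measurableSet_Ioc e4,
      setIntegral_congr_fun measurableSet_Ioc e3,
      integral_sub (hai.const_mul (ζ 1)) hi1, integral_const_mul, ← e1, ← e2, hswap,
      intervalIntegral.integral_of_le zero_le_one]

/-! ### Bounded radial functions of finite energy -/

/-- `u` is bounded on `(0, 1]` and absolutely continuous away from `0`, with derivative `d` in the
weighted `L²` space. -/
structure Rad (n : ℕ) (u d : ℝ → ℝ) : Prop where
  memLp : MemLp d 2 (wt n)
  eq : ∀ r ∈ Ioc (0 : ℝ) 1, u r = u 1 - ∫ t in r..1, d t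
  bdd : ∃ M, ∀ r ∈ Ioc (0 : ℝ) 1, |u r| ≤ M

lemma one_mem : (1 : ℝ) ∈ Ioc (0 : ℝ) 1 := ⟨zero_lt_one, le_rfl⟩

lemma continuousOn_of_primitive {n : ℕ} {u d : ℝ → ℝ} (hd : MemLp d 2 (wt n))
    (hu : ∀ r ∈ Ioc (0 : ℝ) 1, u r = u 1 - ∫ t in r..1, d t) : ContinuousOn u (Ioc 0 1) := by
  intro r hr
  have hr2 : r / 2 ∈ Ioc (0 : ℝ) 1 := ⟨by linarith [hr.1], by linarith [hr.1, hr.2]⟩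
  have h1 := intervalIntegral.continuousOn_primitive_interval' (a := 1)
    (intervalIntegrable_of_wt hd hr2 one_mem) right_mem_uIcc
  rw [uIcc_of_le hr2.2] at h1
  have h2 : ContinuousOn u (Icc (r / 2) 1) := by
    refine (continuousOn_const (c := u 1)).add h1 |>.congr fun t ht => ?_
    rw [hu t ⟨hr2.1.trans_le ht.1, ht.2⟩, intervalIntegral.integral_symm, sub_neg_eq_add]
    rfl
  have h3 : Icc (r / 2) 1 ∈ 𝓝[Ioc 0 1] r := by
    have h4 : Ioi (r / 2) ∈ 𝓝 r := Ioi_mem_nhds (by linarith [hr.1])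
    filter_upwards [mem_nhdsWithin_of_mem_nhds h4, self_mem_nhdsWithin] with t ht ht'
    exact ⟨le_of_lt ht, ht'.2⟩
  exact (h2 r ⟨by linarith [hr.1], hr.2⟩).mono_of_mem_nhdsWithin h3

namespace Rad

variable {n : ℕ} {u d v e : ℝ → ℝ}

lemma continuousOn (h : Rad n u d) : ContinuousOn u (Ioc 0 1) :=
  continuousOn_of_primitive h.memLp h.eq

lemma intervalIntegrable (h : Rad n u d) {r s : ℝ} (hr : r ∈ Ioc (0 : ℝ) 1)
    (hs : s ∈ Ioc (0 : ℝ) 1) : IntervalIntegrable d volume r s :=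
  intervalIntegrable_of_wt h.memLp hr hs

lemma sub_eq (h : Rad n u d) {r s : ℝ} (hr : r ∈ Ioc (0 : ℝ) 1) (hs : s ∈ Ioc (0 : ℝ) 1) :
    u s - u r = ∫ t in r..s, d t := by
  rw [h.eq r hr, h.eq s hs, ← intervalIntegral.integral_add_adjacent_intervals
    (h.intervalIntegrable hr hs) (h.intervalIntegrable hs one_mem)]
  ring

lemma add_mul (hu : Rad n u d) (hv : Rad n v e) (t : ℝ) :
    Rad n (fun r => u r + t * v r) (fun r => d r + t * e r) := by
  refine ⟨hu.memLp.add (hv.memLp.const_mul t), fun r hr => ?_, ?_⟩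
  · rw [intervalIntegral.integral_add (hu.intervalIntegrable hr one_mem)
      ((hv.intervalIntegrable hr one_mem).const_mul t), intervalIntegral.integral_const_mul,
      hu.eq r hr, hv.eq r hr]
    ring
  · obtain ⟨M, hM⟩ := hu.bdd
    obtain ⟨N, hN⟩ := hv.bdd
    refine ⟨M + |t| * N, fun r hr => (abs_add_le _ _).trans ?_⟩
    rw [abs_mul]
    gcongr
    exacts [hM r hr, hN r hr]

lemma const (n : ℕ) (c : ℝ) : Rad n (fun _ => c) (fun _ => 0) :=
  ⟨MemLp.zero, fun r _ => by simp, |c|, fun r _ => le_rfl⟩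

lemma const_mul (hu : Rad n u d) (t : ℝ) : Rad n (fun r => t * u r) (fun r => t * d r) := by
  simpa using (Rad.const n 0).add_mul hu t

lemma neg (hu : Rad n u d) : Rad n (fun r => - u r) (fun r => - d r) := by
  simpa using hu.const_mul (-1)

lemma sub (hu : Rad n u d) (hv : Rad n v e) : Rad n (fun r => u r - v r) (fun r => d r - e r) := by
  simpa [sub_eq_add_neg] using hu.add_mul hv (-1)

lemma congr (hu : Rad n u d) (h : ∀ r ∈ Ioc (0 : ℝ) 1, v r = u r) : Rad n v d := by
  refine ⟨hu.memLp, fun r hr => ?_, ?_⟩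
  · rw [h r hr, h 1 one_mem, hu.eq r hr]
  · obtain ⟨M, hM⟩ := hu.bdd
    exact ⟨M, fun r hr => by rw [h r hr]; exact hM r hr⟩

lemma of_hasDerivAt {s : Set ℝ} (hs : s.Countable) (hc : ContinuousOn u (Ioc 0 1))
    (hub : ∃ M, ∀ r ∈ Ioc (0 : ℝ) 1, |u r| ≤ M)
    (hd : ∀ r ∈ Ioo (0 : ℝ) 1, r ∉ s → HasDerivAt u (d r) r)
    (hm : AEStronglyMeasurable d (wt n)) {M : ℝ}
    (hb : ∀ r ∈ Ioo (0 : ℝ) 1, r ∉ s → |d r| ≤ M) : Rad n u d := by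
  have hae : ∀ᵐ r ∂(wt n), ‖d r‖ ≤ M := by
    rw [ae_wt_iff]
    filter_upwards [ae_restrict_mem measurableSet_Ioc,
      ae_restrict_of_ae ((hs.insert 1).ae_notMem volume)] with r hr hrs
    simp only [mem_insert_iff, not_or] at hrs
    exact hb r ⟨hr.1, lt_of_le_of_ne hr.2 hrs.1⟩ hrs.2
  have hL : MemLp d 2 (wt n) := MemLp.of_bound hm M hae
  refine ⟨hL, fun r hr => ?_, hub⟩
  rw [integral_eq_of_hasDerivAt_off_countable u d hs]
  · ring
  · rw [uIcc_of_le hr.2]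
    exact hc.mono fun t ht => ⟨hr.1.trans_le ht.1, ht.2⟩
  · rintro x ⟨hx, hxs⟩
    rw [min_eq_left hr.2, max_eq_right hr.2] at hx
    exact hd x ⟨hr.1.trans hx.1, hx.2⟩ hxs
  · exact intervalIntegrable_of_wt hL hr one_mem

/-- Restriction to an interval at whose endpoints the function vanishes. -/
lemma cut (hu : Rad n u d) {α β : ℝ} (hα : 0 ≤ α) (hαβ : α < β) (hβ : β ≤ 1) (huβ : u β = 0)
    (huα : α = 0 ∨ u α = 0) :
    Rad n ((Ioo α β).indicator u) ((Ioo α β).indicator d) := by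
  have hβ0 : 0 < β := hα.trans_lt hαβ
  have hβm : β ∈ Ioc (0 : ℝ) 1 := ⟨hβ0, hβ⟩
  refine ⟨hu.memLp.indicator measurableSet_Ioo, fun r hr => ?_, ?_⟩
  · have h1 : (Ioo α β).indicator u 1 = 0 :=
      indicator_of_notMem (fun h => absurd h.2 (not_lt.2 hβ)) _
    rw [h1, intervalIntegral.integral_of_le hr.2, setIntegral_indicator measurableSet_Ioo]
    have h2 : Ioc r 1 ∩ Ioo α β = Ioo (max r α) β ∩ Ioc r 1 := by
      ext x
      simp only [mem_inter_iff, mem_Ioc, mem_Ioo, max_lt_iff]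
      tauto
    have h3 : Ioo (max r α) β ∩ Ioc r 1 = Ioo (max r α) β := by
      refine inter_eq_left.2 fun x hx => ?_
      exact ⟨(le_max_left _ _).trans_lt hx.1, hx.2.le.trans hβ⟩
    rw [h2, h3, ← integral_Ioc_eq_integral_Ioo]
    by_cases hrβ : r < β
    · have hmax : max r α ∈ Ioc (0 : ℝ) 1 :=
        ⟨hr.1.trans_le (le_max_left _ _), max_le hr.2 (hαβ.le.trans hβ)⟩
      rw [← intervalIntegral.integral_of_le (max_le hrβ.le hαβ.le), ← hu.sub_eq hmax hβm, huβ]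
      by_cases hrα : α < r
      · rw [indicator_of_mem (show r ∈ Ioo α β from ⟨hrα, hrβ⟩), max_eq_left hrα.le]
        ring
      · push Not at hrα
        rw [indicator_of_notMem (fun h => absurd h.1 (not_lt.2 hrα)), max_eq_right hrα,
          huα.resolve_left (hr.1.trans_le hrα).ne']
        ring
    · rw [indicator_of_notMem (fun h => absurd h.2 hrβ)]
      have : Ioc (max r α) β = ∅ := Ioc_eq_empty (by simp; intro h; exact absurd h hrβ)
      simp [this]
  · obtain ⟨M, hM⟩ := hu.bdd
    refine ⟨max M 0, fun r hr => ?_⟩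
    by_cases h : r ∈ Ioo α β
    · rw [indicator_of_mem h]; exact (hM r hr).trans (le_max_left _ _)
    · rw [indicator_of_notMem h]; simp

/-- A continuous bounded coefficient times the product of two functions is integrable. -/
lemma integrable_coef_mul {V : ℝ → ℝ} (hV : Continuous V) (hu : Rad n u d) (hv : Rad n v e) :
    Integrable (fun r => V r * (u r * v r)) (wt n) := by
  obtain ⟨M, hM⟩ := hu.bdd
  obtain ⟨N, hN⟩ := hv.bdd
  obtain ⟨A, hA⟩ := (isCompact_Icc (a := (0 : ℝ)) (b := 1)).exists_bound_of_continuousOn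
    hV.continuousOn
  refine integrable_wt (M := A * (M * N))
    (hV.continuousOn.mul (hu.continuousOn.mul hv.continuousOn)) fun r hr => ?_
  rw [abs_mul, abs_mul]
  have h1 := hA r ⟨hr.1.le, hr.2⟩
  have h2 := hM r hr
  have h3 := hN r hr
  rw [Real.norm_eq_abs] at h1
  have : 0 ≤ A := (abs_nonneg _).trans h1
  have : 0 ≤ M := (abs_nonneg _).trans h2
  gcongr

end Rad

/-! ### The energy form -/

/-- The energy form `∫ (u' v' + V u v) r ^ (n - 1) dr`; `d` and `e` stand for `u'` and `v'`. -/
def form (n : ℕ) (V u d v e : ℝ → ℝ) : ℝ := ∫ r, (d r * e r + V r * (u r * v r)) ∂(wt n)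

section Form

variable {n : ℕ} {V u d v e z f : ℝ → ℝ}

lemma integrable_form (hV : Continuous V) (hu : Rad n u d) (hv : Rad n v e) :
    Integrable (fun r => d r * e r + V r * (u r * v r)) (wt n) :=
  (hu.memLp.integrable_mul hv.memLp).add (Rad.integrable_coef_mul hV hu hv)

lemma form_eq_add (hV : Continuous V) (hu : Rad n u d) (hv : Rad n v e) :
    form n V u d v e = ∫ r, d r * e r ∂(wt n) + ∫ r, V r * (u r * v r) ∂(wt n) :=
  integral_add (hu.memLp.integrable_mul hv.memLp) (Rad.integrable_coef_mul hV hu hv)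

lemma form_comm (n : ℕ) (V u d v e : ℝ → ℝ) : form n V u d v e = form n V v e u d := by
  unfold form
  congr 1; ext r; ring

lemma form_add_mul_left (hV : Continuous V) (hu : Rad n u d) (hv : Rad n v e) (hz : Rad n z f)
    (t : ℝ) : form n V (fun r => u r + t * v r) (fun r => d r + t * e r) z f =
      form n V u d z f + t * form n V v e z f := by
  unfold form
  rw [← integral_const_mul, ← integral_add (integrable_form hV hu hz)
    ((integrable_form hV hv hz).const_mul t)]
  congr 1; ext r; ring

lemma form_add_mul_right (hV : Continuous V) (hu : Rad n u d) (hv : Rad n v e) (hz : Rad n z f)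
    (t : ℝ) : form n V z f (fun r => u r + t * v r) (fun r => d r + t * e r) =
      form n V z f u d + t * form n V z f v e := by
  rw [form_comm, form_add_mul_left hV hu hv hz, form_comm n V u, form_comm n V v]

lemma form_add_mul_self (hV : Continuous V) (hu : Rad n u d) (hv : Rad n v e) (t : ℝ) :
    form n V (fun r => u r + t * v r) (fun r => d r + t * e r)
      (fun r => u r + t * v r) (fun r => d r + t * e r) =
      form n V u d u d + 2 * t * form n V u d v e + t ^ 2 * form n V v e v e := by
  rw [form_add_mul_left hV hu hv (hu.add_mul hv t), form_add_mul_right hV hu hv hu,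
    form_add_mul_right hV hu hv hv, form_comm n V v e u d]
  ring

lemma form_smul_self (t : ℝ) : form n V (fun r => t * u r) (fun r => t * d r)
    (fun r => t * u r) (fun r => t * d r) = t ^ 2 * form n V u d u d := by
  unfold form
  rw [← integral_const_mul]
  congr 1; ext r; ring

lemma form_self_nonneg (hV0 : ∀ r, 0 ≤ V r) : 0 ≤ form n V u d u d :=
  integral_nonneg fun r => by
    have := hV0 r
    have h1 := mul_self_nonneg (d r)
    have h2 := mul_self_nonneg (u r)
    simp only [Pi.zero_apply]
    positivity

lemma form_sub_self (hV : Continuous V) (hu : Rad n u d) (hv : Rad n v e) :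
    form n V (fun r => u r - v r) (fun r => d r - e r) (fun r => u r - v r) (fun r => d r - e r) =
      form n V u d u d - 2 * form n V u d v e + form n V v e v e := by
  have := form_add_mul_self hV hu hv (-1)
  simp only [neg_mul, one_mul, ← sub_eq_add_neg] at this
  rw [this]; ring

lemma form_cauchy_schwarz (hV : Continuous V) (hV0 : ∀ r, 0 ≤ V r) (hu : Rad n u d)
    (hv : Rad n v e) : form n V u d v e ^ 2 ≤ form n V u d u d * form n V v e v e := by
  have h := discrim_le_zero (a := form n V v e v e) (b := 2 * form n V u d v e)
    (c := form n V u d u d) fun t => by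
      have h1 := form_add_mul_self hV hu hv t
      have h2 := form_self_nonneg (n := n) (u := fun r => u r + t * v r)
        (d := fun r => d r + t * e r) hV0
      rw [h1] at h2
      linarith
  rw [discrim] at h
  linarith

end Form

/-! ### Normalized Green functions and the reproducing property -/

/-- The Green function with pole `s`, normalized to have the value `1` at `s`. -/
def peak (φ ψ : ℝ → ℝ) (s r : ℝ) : ℝ := φ (min r s) * ψ (max r s) / (φ s * ψ s)

/-- The energy of the normalized Green function with pole `s`. -/
def peakEnergy (φ ψ : ℝ → ℝ) (C s : ℝ) : ℝ := C / (φ s * ψ s)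

namespace FundPair

variable {n : ℕ} {V φ ψ P S : ℝ → ℝ} {C s r : ℝ}

lemma φ_pos' (hp : FundPair n V φ ψ P S C) (hr : r ∈ Ioc (0 : ℝ) 1) : 0 < φ r :=
  hp.φ_pos ⟨hr.1.le, hr.2⟩

lemma peakEnergy_pos (hp : FundPair n V φ ψ P S C) (hs : s ∈ Ioc (0 : ℝ) 1) :
    0 < peakEnergy φ ψ C s :=
  div_pos hp.C_pos (mul_pos (hp.φ_pos' hs) (hp.ψ_pos s hs))

lemma continuousOn_peakEnergy (hp : FundPair n V φ ψ P S C) :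
    ContinuousOn (peakEnergy φ ψ C) (Ioc 0 1) :=
  continuousOn_const.div (hp.φ_cont.continuousOn.mul hp.ψ_cont) fun s hs =>
    (mul_pos (hp.φ_pos' hs) (hp.ψ_pos s hs)).ne'

lemma peak_of_le (hp : FundPair n V φ ψ P S C) (hs : s ∈ Ioc (0 : ℝ) 1) (h : r ≤ s) :
    peak φ ψ s r = φ r / φ s := by
  rw [peak, min_eq_left h, max_eq_right h, mul_div_mul_right _ _ (hp.ψ_pos s hs).ne']

lemma peak_of_ge (hp : FundPair n V φ ψ P S C) (hs : s ∈ Ioc (0 : ℝ) 1) (h : s ≤ r) :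
    peak φ ψ s r = ψ r / ψ s := by
  rw [peak, min_eq_right h, max_eq_left h, mul_div_mul_left _ _ (hp.φ_pos' hs).ne']

lemma peak_self (hp : FundPair n V φ ψ P S C) (hs : s ∈ Ioc (0 : ℝ) 1) : peak φ ψ s s = 1 := by
  rw [hp.peak_of_le hs le_rfl, div_self (hp.φ_pos' hs).ne']

lemma peak_pos (hp : FundPair n V φ ψ P S C) (hs : s ∈ Ioc (0 : ℝ) 1) (hr : r ∈ Icc (0 : ℝ) 1) :
    0 < peak φ ψ s r := by
  rcases le_total r s with h | h
  · rw [hp.peak_of_le hs h]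
    exact div_pos (hp.φ_pos hr) (hp.φ_pos' hs)
  · rw [hp.peak_of_ge hs h]
    exact div_pos (hp.ψ_pos r ⟨hs.1.trans_le h, hr.2⟩) (hp.ψ_pos s hs)

lemma peak_le_one (hp : FundPair n V φ ψ P S C) (hs : s ∈ Ioc (0 : ℝ) 1)
    (hr : r ∈ Icc (0 : ℝ) 1) : peak φ ψ s r ≤ 1 := by
  rcases le_total r s with h | h
  · rw [hp.peak_of_le hs h, div_le_one (hp.φ_pos' hs)]
    exact hp.φ_mono hr ⟨hs.1.le, hs.2⟩ h
  · rw [hp.peak_of_ge hs h, div_le_one (hp.ψ_pos s hs)]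
    exact hp.ψ_anti hs ⟨hs.1.trans_le h, hr.2⟩ h

lemma continuousOn_peak (hp : FundPair n V φ ψ P S C) (hs : s ∈ Ioc (0 : ℝ) 1) :
    ContinuousOn (peak φ ψ s) (Icc 0 1) := by
  unfold peak
  refine (ContinuousOn.mul ?_ ?_).div_const _
  · exact (hp.φ_cont.comp (continuous_id.min continuous_const)).continuousOn
  · exact hp.ψ_cont.comp (by fun_prop) fun r hr =>
      ⟨hs.1.trans_le (le_max_right _ _), max_le hr.2 hs.2⟩

lemma hasDerivAt_peak_left (hp : FundPair n V φ ψ P S C) (hs : s ∈ Ioc (0 : ℝ) 1) (h0 : 0 < r)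
    (h : r < s) : HasDerivAt (peak φ ψ s) (P r / r ^ (n - 1) / φ s) r := by
  refine ((hp.φ_deriv r ⟨h0, h.le.trans hs.2⟩).div_const (φ s)).congr_of_eventuallyEq ?_
  filter_upwards [Iio_mem_nhds h] with t ht using hp.peak_of_le hs (le_of_lt ht)

lemma hasDerivAt_peak_right (hp : FundPair n V φ ψ P S C) (hs : s ∈ Ioc (0 : ℝ) 1) (h : s < r)
    (h1 : r ≤ 1) : HasDerivAt (peak φ ψ s) (S r / r ^ (n - 1) / ψ s) r := by
  refine ((hp.ψ_deriv r ⟨hs.1.trans h, h1⟩).div_const (ψ s)).congr_of_eventuallyEq ?_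
  filter_upwards [Ioi_mem_nhds h] with t ht using hp.peak_of_ge hs (le_of_lt ht)

lemma bound_deriv_φ (hp : FundPair n V φ ψ P S C) (hV : Continuous V) :
    ∃ M, ∀ r ∈ Ioc (0 : ℝ) 1, |P r / r ^ (n - 1)| ≤ M := by
  obtain ⟨A, hA⟩ := (isCompact_Icc (a := (0 : ℝ)) (b := 1)).exists_bound_of_continuousOn
    (hV.mul hp.φ_cont).continuousOn
  have hA0 : 0 ≤ A := (norm_nonneg _).trans (hA 0 ⟨le_rfl, zero_le_one⟩)
  refine ⟨A, fun r hr => ?_⟩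
  have hrn : 0 < r ^ (n - 1) := pow_pos hr.1 _
  rw [abs_div, abs_of_pos hrn, div_le_iff₀ hrn, hp.P_eq r ⟨hr.1.le, hr.2⟩]
  have := intervalIntegral.norm_integral_le_of_norm_le_const (a := 0) (b := r)
    (C := A * r ^ (n - 1)) (f := fun s => s ^ (n - 1) * (V s * φ s)) (by
      intro t ht
      rw [uIoc_of_le hr.1.le] at ht
      rw [norm_mul, norm_pow, Real.norm_of_nonneg ht.1.le, mul_comm]
      have h1 := hA t ⟨ht.1.le, ht.2.trans hr.2⟩
      have h2 := ht.1.le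
      have h3 := ht.2
      simp only [Pi.mul_apply] at h1
      gcongr)
  rw [sub_zero, abs_of_pos hr.1] at this
  rw [Real.norm_eq_abs] at this
  refine this.trans (mul_le_of_le_one_right (by positivity) hr.2)

lemma bound_deriv_peak (hp : FundPair n V φ ψ P S C) (hV : Continuous V)
    (hs : s ∈ Ioc (0 : ℝ) 1) :
    ∃ M, ∀ r ∈ Ioo (0 : ℝ) 1, r ≠ s → |deriv (peak φ ψ s) r| ≤ M := by
  obtain ⟨A, hA⟩ := hp.bound_deriv_φ hV
  have hc : ContinuousOn (fun r => S r / r ^ (n - 1) / ψ s) (Icc s 1) := fun r hr => by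
    have hr' : r ∈ Ioc (0 : ℝ) 1 := ⟨hs.1.trans_le hr.1, hr.2⟩
    exact (((hp.S_deriv r hr').continuousAt.div (continuous_pow (n - 1)).continuousAt
      (pow_pos hr'.1 _).ne').div_const _).continuousWithinAt
  obtain ⟨B, hB⟩ := isCompact_Icc.exists_bound_of_continuousOn hc
  refine ⟨max (A / φ s) B, fun r hr hrs => ?_⟩
  rcases lt_or_gt_of_ne hrs with h | h
  · rw [(hp.hasDerivAt_peak_left hs hr.1 h).deriv, abs_div, abs_of_pos (hp.φ_pos' hs)]
    refine le_trans ?_ (le_max_left _ _)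
    have := hA r ⟨hr.1, hr.2.le⟩
    have := hp.φ_pos' hs
    gcongr
  · rw [(hp.hasDerivAt_peak_right hs h hr.2.le).deriv]
    exact (hB r ⟨h.le, hr.2.le⟩).trans (le_max_right _ _)

lemma hasDerivAt_peak (hp : FundPair n V φ ψ P S C) (hs : s ∈ Ioc (0 : ℝ) 1)
    (hr : r ∈ Ioo (0 : ℝ) 1) (hrs : r ≠ s) :
    HasDerivAt (peak φ ψ s) (deriv (peak φ ψ s) r) r := by
  rcases lt_or_gt_of_ne hrs with h | h
  · exact (hp.hasDerivAt_peak_left hs hr.1 h).differentiableAt.hasDerivAt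
  · exact (hp.hasDerivAt_peak_right hs h hr.2.le).differentiableAt.hasDerivAt

lemma rad_peak (hp : FundPair n V φ ψ P S C) (hV : Continuous V) (hs : s ∈ Ioc (0 : ℝ) 1) :
    Rad n (peak φ ψ s) (deriv (peak φ ψ s)) := by
  obtain ⟨M, hM⟩ := hp.bound_deriv_peak hV hs
  refine Rad.of_hasDerivAt (s := {s}) (countable_singleton s)
    ((hp.continuousOn_peak hs).mono Ioc_subset_Icc_self) ⟨1, fun r hr => ?_⟩
    (fun r hr hrs => hp.hasDerivAt_peak hs hr hrs)
    (measurable_deriv _).aestronglyMeasurable (fun r hr hrs => hM r hr hrs)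
  have hr' : r ∈ Icc (0 : ℝ) 1 := ⟨hr.1.le, hr.2⟩
  rw [abs_of_pos (hp.peak_pos hs hr')]
  exact hp.peak_le_one hs hr'

/-- The normalized Green function with pole `s` represents evaluation at `s`. -/
theorem form_peak (hp : FundPair n V φ ψ P S C) (hV : Continuous V) (hs : s ∈ Ioc (0 : ℝ) 1)
    {ζ ξ : ℝ → ℝ} (hζ : Rad n ζ ξ) :
    form n V (peak φ ψ s) (deriv (peak φ ψ s)) ζ ξ = peakEnergy φ ψ C s * ζ s := by
  have hg := hp.rad_peak hV hs
  have hφs := (hp.φ_pos' hs).ne'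
  have hψs := (hp.ψ_pos s hs).ne'
  have hgc := hp.continuousOn_peak hs
  have hc : ContinuousOn (fun r => V r * peak φ ψ s r) (Icc 0 1) := hV.continuousOn.mul hgc
  obtain ⟨M, hM⟩ := isCompact_Icc.exists_bound_of_continuousOn hc
  have hac : ContinuousOn (fun r => r ^ (n - 1) * (V r * peak φ ψ s r)) (Icc 0 1) :=
    (continuous_pow (n - 1)).continuousOn.mul hc
  have hii : ∀ a b, a ∈ Icc (0 : ℝ) 1 → b ∈ Icc (0 : ℝ) 1 →
      IntervalIntegrable (fun r => r ^ (n - 1) * (V r * peak φ ψ s r)) volume a b := by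
    intro a b ha hb
    exact (hac.mono (uIcc_subset_Icc ha hb)).intervalIntegrable
  have h0m : (0 : ℝ) ∈ Icc (0 : ℝ) 1 := ⟨le_rfl, zero_le_one⟩
  have hsm : s ∈ Icc (0 : ℝ) 1 := ⟨hs.1.le, hs.2⟩
  -- `H` is the flux that the normalized Green function would have without its pole. It equals the
  -- true flux before `s` and exceeds it by `peakEnergy` after `s`.
  set H : ℝ → ℝ := fun t => ∫ r in (0 : ℝ)..t, r ^ (n - 1) * (V r * peak φ ψ s r) with hH
  have hHl : ∀ t ∈ Ioc (0 : ℝ) s, H t = P t / φ s := by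
    intro t ht
    rw [hp.P_eq t ⟨ht.1.le, ht.2.trans hs.2⟩, ← intervalIntegral.integral_div]
    refine intervalIntegral.integral_congr fun r hr => ?_
    rw [uIcc_of_le ht.1.le] at hr
    simp only [hp.peak_of_le hs (hr.2.trans ht.2)]
    ring
  -- The jump of the flux at the pole, from the Wronskian identity.
  have hΓ : P s / φ s - S s / ψ s = peakEnergy φ ψ C s := by
    rw [peakEnergy, ← hp.wronskian s hs]
    field_simp
  have hHr : ∀ t ∈ Icc s 1, H t = S t / ψ s + peakEnergy φ ψ C s := by
    intro t ht
    have h1 : H t = H s + ∫ r in s..t, r ^ (n - 1) * (V r * peak φ ψ s r) :=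
      (intervalIntegral.integral_add_adjacent_intervals (hii _ _ h0m hsm)
        (hii _ _ hsm ⟨hs.1.le.trans ht.1, ht.2⟩)).symm
    have h2 : ∫ r in s..t, r ^ (n - 1) * (V r * peak φ ψ s r) = S t / ψ s - S s / ψ s := by
      refine intervalIntegral.integral_eq_sub_of_hasDerivAt (f := fun r => S r / ψ s) ?_
        (hii _ _ hsm ⟨hs.1.le.trans ht.1, ht.2⟩)
      intro r hr
      rw [uIcc_of_le ht.1] at hr
      rw [hp.peak_of_ge hs hr.1]
      refine ((hp.S_deriv r ⟨hs.1.trans_le hr.1, hr.2.trans ht.2⟩).div_const (ψ s)).congr_deriv ?_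
      ring
    rw [h1, h2, hHl s ⟨hs.1, le_rfl⟩, ← hΓ]
    ring
  have hH1 : H 1 = peakEnergy φ ψ C s := by
    rw [hHr 1 ⟨hs.2, le_rfl⟩, hp.S_one]; simp
  obtain ⟨i1, i2, ibp⟩ := weighted_integration_by_parts (n := n) (hc.mono Ioc_subset_Icc_self)
    (fun r hr => hM r ⟨hr.1.le, hr.2⟩) hζ.memLp hζ.eq
  have hd : ∀ᵐ t ∂(wt n), deriv (peak φ ψ s) t * ξ t = ξ t * (H t / t ^ (n - 1)) -
      (Ioc s 1).indicator (fun t => peakEnergy φ ψ C s * (ξ t / t ^ (n - 1))) t := by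
    rw [ae_wt_iff]
    filter_upwards [ae_restrict_mem measurableSet_Ioc,
      ae_restrict_of_ae ((countable_singleton s).ae_notMem volume)] with t ht hts
    rcases lt_or_gt_of_ne (show t ≠ s from hts) with h | h
    · rw [indicator_of_notMem (fun h' => absurd h'.1 (not_lt.2 h.le)),
        (hp.hasDerivAt_peak_left hs ht.1 h).deriv, hHl t ⟨ht.1, h.le⟩]
      ring
    · rw [indicator_of_mem (show t ∈ Ioc s 1 from ⟨h, ht.2⟩),
        (hp.hasDerivAt_peak_right hs h ht.2).deriv, hHr t ⟨h.le, ht.2⟩]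
      ring
  -- The jump contributes `Γ (ζ 1 - ζ s)`. Since `H 1 = Γ`, the boundary term of the integration by
  -- parts is `Γ ζ 1`, and the difference is `Γ ζ s`.
  have hind : ∫ t, (Ioc s 1).indicator (fun t => peakEnergy φ ψ C s * (ξ t / t ^ (n - 1))) t
      ∂(wt n) = peakEnergy φ ψ C s * (ζ 1 - ζ s) := by
    rw [hζ.sub_eq hs one_mem, integral_wt', ← intervalIntegral.integral_const_mul,
      intervalIntegral.integral_of_le hs.2]
    have : ∀ r ∈ Ioc (0 : ℝ) 1, r ^ (n - 1) *
        (Ioc s 1).indicator (fun t => peakEnergy φ ψ C s * (ξ t / t ^ (n - 1))) r =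
        (Ioc s 1).indicator (fun t => peakEnergy φ ψ C s * ξ t) r := fun r hr => by
      have hr0 : r ≠ 0 := hr.1.ne'
      by_cases h : r ∈ Ioc s 1
      · rw [indicator_of_mem h, indicator_of_mem h]
        field_simp
      · rw [indicator_of_notMem h, indicator_of_notMem h, mul_zero]
    rw [setIntegral_congr_fun measurableSet_Ioc this, setIntegral_indicator measurableSet_Ioc,
      inter_eq_right.2 (Ioc_subset_Ioc_left hs.1.le)]
  have hindi : Integrable ((Ioc s 1).indicator
      (fun t => peakEnergy φ ψ C s * (ξ t / t ^ (n - 1)))) (wt n) := by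
    have h3 := i1.sub (hg.memLp.integrable_mul hζ.memLp)
    refine h3.congr ?_
    filter_upwards [hd] with t ht
    simp only [Pi.sub_apply, Pi.mul_apply]
    rw [ht]
    ring
  rw [form_eq_add hV hg hζ, integral_congr_ae hd, integral_sub i1 hindi, hind]
  have h4 : ∫ r, V r * (peak φ ψ s r * ζ r) ∂(wt n) = ∫ r, V r * peak φ ψ s r * ζ r ∂(wt n) := by
    congr 1; ext r; ring
  rw [h4, ibp, show (∫ r in (0 : ℝ)..1, r ^ (n - 1) * (V r * peak φ ψ s r)) = _ from hH1]
  ring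

lemma form_peak_self (hp : FundPair n V φ ψ P S C) (hV : Continuous V) (hs : s ∈ Ioc (0 : ℝ) 1) :
    form n V (peak φ ψ s) (deriv (peak φ ψ s)) (peak φ ψ s) (deriv (peak φ ψ s)) =
      peakEnergy φ ψ C s := by
  rw [hp.form_peak hV hs (hp.rad_peak hV hs), hp.peak_self hs, mul_one]

/-- Pointwise bound by the energy. -/
lemma peakEnergy_mul_sq_le (hp : FundPair n V φ ψ P S C) (hV : Continuous V) (hV0 : ∀ r, 0 ≤ V r)
    (hs : s ∈ Ioc (0 : ℝ) 1) {u d : ℝ → ℝ} (hu : Rad n u d) :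
    peakEnergy φ ψ C s * u s ^ 2 ≤ form n V u d u d := by
  have h := form_cauchy_schwarz hV hV0 (hp.rad_peak hV hs) hu
  rw [hp.form_peak hV hs hu, hp.form_peak_self hV hs] at h
  have hΓ := hp.peakEnergy_pos hs
  rw [mul_pow, sq (peakEnergy φ ψ C s), mul_assoc] at h
  exact le_of_mul_le_mul_left h hΓ

/-- Modulus of continuity in terms of the energy. -/
lemma sq_sub_le (hp : FundPair n V φ ψ P S C) (hV : Continuous V) (hV0 : ∀ r, 0 ≤ V r)
    (hs : s ∈ Ioc (0 : ℝ) 1) (hr : r ∈ Ioc (0 : ℝ) 1) {u d : ℝ → ℝ} (hu : Rad n u d) :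
    (u r - u s) ^ 2 ≤ form n V u d u d * ((peakEnergy φ ψ C r)⁻¹ + (peakEnergy φ ψ C s)⁻¹ -
      2 * ((peakEnergy φ ψ C s)⁻¹ * peak φ ψ s r)) := by
  have hΓr := hp.peakEnergy_pos hr
  have hΓs := hp.peakEnergy_pos hs
  have rr := hp.rad_peak hV hr
  have rs := hp.rad_peak hV hs
  have rr' := rr.const_mul (peakEnergy φ ψ C r)⁻¹
  -- The combination `Γ(r)⁻¹ peak r - Γ(s)⁻¹ peak s` represents `u ↦ u r - u s`. Cauchy-Schwarz
  -- against it gives the claim, the bracket being its squared energy norm.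
  have rd := rr'.add_mul rs (-(peakEnergy φ ψ C s)⁻¹)
  have hsm : ∀ {z f : ℝ → ℝ} (_ : Rad n z f),
      form n V (fun t => (peakEnergy φ ψ C r)⁻¹ * peak φ ψ r t)
        (fun t => (peakEnergy φ ψ C r)⁻¹ * deriv (peak φ ψ r) t) z f = z r := fun {z f} hz => by
    have := form_add_mul_left hV (Rad.const n 0) rr hz (peakEnergy φ ψ C r)⁻¹
    simp only [zero_add] at this
    rw [this, hp.form_peak hV hr hz]
    have h0 : form n V (fun _ => 0) (fun _ => 0) z f = 0 := by simp [form]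
    rw [h0]
    field_simp
    ring
  have h1 := form_cauchy_schwarz hV hV0 rd hu
  rw [form_add_mul_left hV rr' rs hu, hsm hu, hp.form_peak hV hs hu,
    form_add_mul_self hV rr' rs, hsm rr', hsm rs, hp.form_peak_self hV hs, hp.peak_self hr] at h1
  have e1 : u r + -(peakEnergy φ ψ C s)⁻¹ * (peakEnergy φ ψ C s * u s) = u r - u s := by
    field_simp; ring
  rw [e1] at h1
  refine h1.trans (le_of_eq ?_)
  rw [mul_comm]
  congr 1
  field_simp
  ring

end FundPair

/-! ### Existence of constrained minimizers -/

/-- Sequential Banach-Alaoglu in the dual of a separable space, carried back by the Riesz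
isomorphism. -/
lemma exists_weakly_convergent_subseq {H : Type*} [NormedAddCommGroup H] [InnerProductSpace ℝ H]
    [CompleteSpace H] [TopologicalSpace.SeparableSpace H] {x : ℕ → H} {A : ℝ}
    (hx : ∀ k, ‖x k‖ ≤ A) :
    ∃ (y : H) (j : ℕ → ℕ), StrictMono j ∧
      ∀ z, Tendsto (fun k => inner ℝ (x (j k)) z) atTop (𝓝 (inner ℝ y z)) := by
  have hc := WeakDual.isSeqCompact_closedBall ℝ (E := H) 0 A
  obtain ⟨f, -, j, hj, hlim⟩ := hc (x := fun k =>
    StrongDual.toWeakDual (InnerProductSpace.toDual ℝ H (x k))) (fun k => by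
      simpa using hx k)
  refine ⟨(InnerProductSpace.toDual ℝ H).symm (WeakDual.toStrongDual f), j, hj, fun z => ?_⟩
  have h1 := ((WeakDual.eval_continuous z).tendsto f).comp hlim
  rw [InnerProductSpace.toDual_symm_apply]
  exact h1

/-- The set on which the pointwise constraint is imposed. -/
def conSet (R b : ℝ) : Set ℝ := {r | r ∈ Ioc (0 : ℝ) 1 ∧ (r < R ∨ b ≤ r)}

/-- Admissible functions for the relaxed problem: normalized `L^(p+1)` mass at least `1`, and
`|u| ≤ c` on the constraint set. -/
structure Feas (n : ℕ) (R b c p : ℝ) (u d : ℝ → ℝ) : Prop where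
  rad : Rad n u d
  mass : 1 ≤ n * ∫ r, |u r| ^ (p + 1) ∂(wt n)
  bound : ∀ r ∈ conSet R b, |u r| ≤ c

/-- `u` minimizes the energy among admissible functions. -/
structure IsFeasMin (n : ℕ) (V : ℝ → ℝ) (R b c p : ℝ) (u d : ℝ → ℝ) : Prop
    extends Feas n R b c p u d where
  le : ∀ v e, Feas n R b c p v e → form n V u d u d ≤ form n V v e v e

/-- The increment over `[r, 1]` is a weighted `L²` pairing with a fixed function. Weak convergence
of derivatives therefore gives pointwise convergence of the functions. -/
lemma exists_kernel (n : ℕ) {r : ℝ} (hr : r ∈ Ioc (0 : ℝ) 1) :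
    ∃ k : ℝ → ℝ, MemLp k 2 (wt n) ∧
      ∀ d : ℝ → ℝ, ∫ t in r..1, d t = ∫ t, d t * k t ∂(wt n) := by
  have hrn : 0 < r ^ (n - 1) := pow_pos hr.1 _
  refine ⟨(Ioc r 1).indicator (fun t => (t ^ (n - 1))⁻¹), ?_, fun d => ?_⟩
  · refine MemLp.of_bound (Measurable.indicator (by fun_prop)
      measurableSet_Ioc).aestronglyMeasurable ((r ^ (n - 1))⁻¹) (Eventually.of_forall fun t => ?_)
    by_cases h : t ∈ Ioc r 1
    · rw [indicator_of_mem h, norm_inv, norm_pow, Real.norm_of_nonneg (hr.1.trans h.1).le]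
      have := hr.1.le
      have := h.1.le
      gcongr
    · rw [indicator_of_notMem h, norm_zero]
      positivity
  · rw [integral_wt', intervalIntegral.integral_of_le hr.2]
    have : ∀ t ∈ Ioc (0 : ℝ) 1, t ^ (n - 1) *
        (d t * (Ioc r 1).indicator (fun t => (t ^ (n - 1))⁻¹) t) = (Ioc r 1).indicator d t := by
      intro t ht
      have ht0 : t ≠ 0 := ht.1.ne'
      by_cases h : t ∈ Ioc r 1
      · rw [indicator_of_mem h, indicator_of_mem h]
        field_simp
      · rw [indicator_of_notMem h, indicator_of_notMem h, mul_zero, mul_zero]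
    rw [setIntegral_congr_fun measurableSet_Ioc this, setIntegral_indicator measurableSet_Ioc,
      inter_eq_right.2 (Ioc_subset_Ioc_left hr.1.le)]

lemma integrable_rpow {n : ℕ} {u d : ℝ → ℝ} (hu : Rad n u d) {q : ℝ} (hq : 0 ≤ q) :
    Integrable (fun r => |u r| ^ q) (wt n) := by
  obtain ⟨M, hM⟩ := hu.bdd
  refine integrable_wt (M := M ^ q) (hu.continuousOn.abs.rpow_const fun r _ => Or.inr hq)
    fun r hr => ?_
  rw [abs_of_nonneg (by positivity)]
  exact Real.rpow_le_rpow (abs_nonneg _) (hM r hr) hq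

namespace FundPair

variable {n : ℕ} {V φ ψ P S : ℝ → ℝ} {C : ℝ}

lemma exists_lower_bound_peakEnergy (hp : FundPair n V φ ψ P S C) {R : ℝ}
    (hR : R ∈ Ioc (0 : ℝ) 1) : ∃ γ > 0, ∀ r ∈ Icc R 1, γ ≤ peakEnergy φ ψ C r := by
  obtain ⟨r₀, hr₀, hmin⟩ := isCompact_Icc.exists_isMinOn (nonempty_Icc.2 hR.2)
    (hp.continuousOn_peakEnergy.mono fun r hr => ⟨hR.1.trans_le hr.1, hr.2⟩)
  exact ⟨_, hp.peakEnergy_pos ⟨hR.1.trans_le hr₀.1, hr₀.2⟩, fun r hr => hmin hr⟩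

/-- Functions of bounded energy subject to the pointwise constraint are uniformly bounded. -/
lemma exists_uniform_bound (hp : FundPair n V φ ψ P S C) (hV : Continuous V)
    (hV0 : ∀ r, 0 ≤ V r) {R : ℝ} (hR : R ∈ Ioc (0 : ℝ) 1) (b c A : ℝ) :
    ∃ B, ∀ u d, Rad n u d → (∀ r ∈ conSet R b, |u r| ≤ c) → form n V u d u d ≤ A →
      ∀ r ∈ Ioc (0 : ℝ) 1, |u r| ≤ B := by
  obtain ⟨γ, hγ, hγ'⟩ := hp.exists_lower_bound_peakEnergy hR
  -- Below `R` the constraint bounds the function; above `R` the energy does, because `peakEnergy`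
  -- is at least `γ` there.
  refine ⟨max c (Real.sqrt (A / γ)), fun u d hu hc hA r hr => ?_⟩
  by_cases h : r < R
  · exact (hc r ⟨hr, Or.inl h⟩).trans (le_max_left _ _)
  · refine le_trans (Real.abs_le_sqrt ?_) (le_max_right _ _)
    rw [le_div_iff₀ hγ, mul_comm]
    refine le_trans ?_ ((hp.peakEnergy_mul_sq_le hV hV0 hr hu).trans hA)
    have := hγ' r ⟨not_lt.1 h, hr.2⟩
    gcongr

/-- Direct method: along a minimizing sequence the values at 1 converge and the derivatives converge
weakly. This yields pointwise convergence with a uniform bound, so the mass and the constraint pass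
to the limit. -/
theorem exists_isFeasMin (hp : FundPair n V φ ψ P S C) (hV : Continuous V) (hV0 : ∀ r, 0 ≤ V r)
    {R b c p : ℝ} (hR : R ∈ Ioc (0 : ℝ) 1) (hpp : 0 ≤ p)
    (hne : ∃ u d, Feas n R b c p u d) : ∃ u d, IsFeasMin n V R b c p u d := by
  set I : Set ℝ := {x | ∃ u d, Feas n R b c p u d ∧ x = form n V u d u d} with hI
  have hbdd : BddBelow I := ⟨0, by rintro x ⟨u, d, -, rfl⟩; exact form_self_nonneg hV0⟩
  have hIne : I.Nonempty := by
    obtain ⟨u, d, h⟩ := hne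
    exact ⟨_, u, d, h, rfl⟩
  set m := sInf I with hm
  have hseq : ∀ k : ℕ, ∃ u d, Feas n R b c p u d ∧ form n V u d u d < m + 1 / ((k : ℝ) + 1) := by
    intro k
    obtain ⟨x, ⟨u, d, h, rfl⟩, hx⟩ := exists_lt_of_csInf_lt hIne
      (show sInf I < m + 1 / ((k : ℝ) + 1) by rw [← hm]; simp; positivity)
    exact ⟨u, d, h, hx⟩
  choose u d hfeas hlt using hseq
  have hA : ∀ k, form n V (u k) (d k) (u k) (d k) ≤ m + 1 := fun k => by
    refine (hlt k).le.trans ?_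
    have : 1 / ((k : ℝ) + 1) ≤ 1 := by
      rw [div_le_one (by positivity)]
      have : (0 : ℝ) ≤ k := k.cast_nonneg
      linarith
    linarith
  obtain ⟨B, hB⟩ := hp.exists_uniform_bound hV hV0 hR b c (m + 1)
  have hB' : ∀ k, ∀ r ∈ Ioc (0 : ℝ) 1, |u k r| ≤ B := fun k =>
    hB _ _ (hfeas k).rad (hfeas k).bound (hA k)
  have hB0 : 0 ≤ B := (abs_nonneg _).trans (hB' 0 1 one_mem)
  obtain ⟨a, -, j₁, hj₁, ha⟩ := (isCompact_Icc (a := -B) (b := B)).isSeqCompact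
    (x := fun k => u k 1) (fun k => abs_le.1 (hB' k 1 one_mem))
  set D : ℕ → Lp ℝ 2 (wt n) := fun k => (hfeas k).rad.memLp.toLp (d k) with hD
  have hinner : ∀ k (z : ℝ → ℝ) (hz : MemLp z 2 (wt n)),
      inner ℝ (D k) (hz.toLp z) = ∫ t, d k t * z t ∂(wt n) := fun k z hz => by
    rw [L2.inner_def]
    refine integral_congr_ae ?_
    filter_upwards [(hfeas k).rad.memLp.coeFn_toLp, hz.coeFn_toLp] with t h1 h2
    simp only [hD, h1, h2]
    simp [mul_comm]
  have hDn : ∀ k, ‖D k‖ ≤ Real.sqrt (m + 1) := fun k => by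
    refine Real.le_sqrt_of_sq_le ?_
    rw [← real_inner_self_eq_norm_sq]
    refine le_trans (le_of_eq (hinner k _ (hfeas k).rad.memLp)) (le_trans ?_ (hA k))
    rw [form_eq_add hV (hfeas k).rad (hfeas k).rad]
    refine le_add_of_nonneg_right (integral_nonneg fun r => ?_)
    exact mul_nonneg (hV0 r) (mul_self_nonneg _)
  have : Fact ((2 : ℝ≥0∞) ≠ ⊤) := ⟨by norm_num⟩
  obtain ⟨Dl, j₂, hj₂, hweak⟩ := exists_weakly_convergent_subseq (x := fun k => D (j₁ k))
    fun k => hDn _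
  set e : ℝ → ℝ := ⇑Dl with he
  have heL : MemLp e 2 (wt n) := Lp.memLp Dl
  set j : ℕ → ℕ := fun k => j₁ (j₂ k) with hj
  have hjt : Tendsto j atTop atTop := hj₁.tendsto_atTop.comp hj₂.tendsto_atTop
  have hlimI : ∀ z, MemLp z 2 (wt n) → Tendsto (fun k => ∫ t, d (j k) t * z t ∂(wt n)) atTop
      (𝓝 (∫ t, e t * z t ∂(wt n))) := fun z hz => by
    have h1 := hweak (hz.toLp z)
    have h2 : inner ℝ Dl (hz.toLp z) = ∫ t, e t * z t ∂(wt n) := by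
      rw [L2.inner_def]
      refine integral_congr_ae ?_
      filter_upwards [hz.coeFn_toLp] with t h2
      simp [h2, he, mul_comm]
    rw [h2] at h1
    refine h1.congr fun k => hinner _ _ _
  have ha' : Tendsto (fun k => u (j k) 1) atTop (𝓝 a) := ha.comp hj₂.tendsto_atTop
  set w : ℝ → ℝ := fun r => a - ∫ t in r..1, e t with hw
  have hw1 : w 1 = a := by simp [hw]
  have hpt : ∀ r ∈ Ioc (0 : ℝ) 1, Tendsto (fun k => u (j k) r) atTop (𝓝 (w r)) := by
    intro r hr
    obtain ⟨k, hk, hk'⟩ := exists_kernel n hr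
    simp only [hw]
    rw [hk']
    refine (ha'.sub (hlimI k hk)).congr fun i => ?_
    rw [(hfeas (j i)).rad.eq r hr, hk']
  have hwB : ∀ r ∈ Ioc (0 : ℝ) 1, |w r| ≤ B := fun r hr =>
    le_of_tendsto (hpt r hr).abs (Eventually.of_forall fun k => hB' _ r hr)
  have hwr : Rad n w e := ⟨heL, fun r _ => by rw [hw1], B, hwB⟩
  have hmass : Tendsto (fun k => ∫ r, |u (j k) r| ^ (p + 1) ∂(wt n)) atTop
      (𝓝 (∫ r, |w r| ^ (p + 1) ∂(wt n))) := by
    refine tendsto_integral_of_dominated_convergence (fun _ => B ^ (p + 1))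
      (fun k => (integrable_rpow (hfeas (j k)).rad (by linarith)).aestronglyMeasurable)
      (integrable_const _) (fun k => ae_wt_of_forall fun r hr => ?_)
      (ae_wt_of_forall fun r hr => ?_)
    · rw [Real.norm_of_nonneg (by positivity)]
      exact Real.rpow_le_rpow (abs_nonneg _) (hB' _ r hr) (by linarith)
    · exact (hpt r hr).abs.rpow_const (Or.inr (by linarith))
  have hfw : Feas n R b c p w e := by
    refine ⟨hwr, ?_, fun r hr => ?_⟩
    · exact ge_of_tendsto (hmass.const_mul (n : ℝ)) (Eventually.of_forall fun k =>
        (hfeas (j k)).mass)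
    · exact le_of_tendsto (hpt r hr.1).abs (Eventually.of_forall fun k => (hfeas (j k)).bound r hr)
  obtain ⟨A, hA'⟩ := (isCompact_Icc (a := (0 : ℝ)) (b := 1)).exists_bound_of_continuousOn
    hV.continuousOn
  have hA0 : 0 ≤ A := (norm_nonneg _).trans (hA' 0 ⟨le_rfl, zero_le_one⟩)
  have hform : Tendsto (fun k => form n V (u (j k)) (d (j k)) w e) atTop
      (𝓝 (form n V w e w e)) := by
    have h1 : Tendsto (fun k => ∫ r, V r * (u (j k) r * w r) ∂(wt n)) atTop
        (𝓝 (∫ r, V r * (w r * w r) ∂(wt n))) := by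
      refine tendsto_integral_of_dominated_convergence (fun _ => A * (B * B))
        (fun k => (Rad.integrable_coef_mul hV (hfeas (j k)).rad hwr).aestronglyMeasurable)
        (integrable_const _) (fun k => ae_wt_of_forall fun r hr => ?_)
        (ae_wt_of_forall fun r hr => ?_)
      · rw [norm_mul, norm_mul]
        have h1 := hA' r ⟨hr.1.le, hr.2⟩
        have h2 := hB' (j k) r hr
        have h3 := hwB r hr
        rw [← Real.norm_eq_abs] at h2 h3
        gcongr
      · exact ((hpt r hr).mul_const _).const_mul _
    rw [form_eq_add hV hwr hwr]
    refine ((hlimI e heL).add h1).congr fun k => ?_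
    rw [form_eq_add hV (hfeas (j k)).rad hwr]
  -- Lower semicontinuity from nonnegativity of the energy of the difference: `2 form (u, w) - form
  -- (w, w) ≤ form (u, u)`.
  have hle : form n V w e w e ≤ m := by
    have h1 : Tendsto (fun k => m + 1 / ((j k : ℝ) + 1)) atTop (𝓝 (m + 0)) :=
      (tendsto_one_div_add_atTop_nhds_zero_nat.comp hjt).const_add m
    rw [add_zero] at h1
    have h2 := (hform.const_mul 2).sub_const (form n V w e w e)
    have h3 := le_of_tendsto_of_tendsto h2 h1 (Eventually.of_forall fun k => by
      have h4 := form_sub_self hV (hfeas (j k)).rad hwr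
      have h5 := form_self_nonneg (n := n) (u := fun r => u (j k) r - w r)
        (d := fun r => d (j k) r - e r) hV0
      rw [h4] at h5
      have h6 := hlt (j k)
      simp only
      linarith)
    linarith
  exact ⟨w, e, hfw, fun v f hv => hle.trans (csInf_le hbdd ⟨v, f, hv, rfl⟩)⟩

end FundPair

/-! ### First variation and comparison -/

/-- The odd power `|a| ^ (p - 1) a`. -/
def sgnPow (p a : ℝ) : ℝ := |a| ^ (p - 1) * a

lemma continuous_sgnPow {p : ℝ} (hp : 1 ≤ p) : Continuous (sgnPow p) :=
  (continuous_abs.rpow_const fun _ => Or.inr (by linarith)).mul continuous_id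

lemma abs_sgnPow {p : ℝ} (hp : 1 ≤ p) (a : ℝ) : |sgnPow p a| = |a| ^ p := by
  rw [sgnPow, abs_mul, abs_of_nonneg (by positivity)]
  nth_rewrite 2 [← Real.rpow_one |a|]
  rw [← Real.rpow_add_of_nonneg (abs_nonneg a) (by linarith) zero_le_one, sub_add_cancel]

lemma sgnPow_of_nonneg {p a : ℝ} (hp : 1 ≤ p) (ha : 0 ≤ a) : sgnPow p a = a ^ p := by
  have := abs_sgnPow hp a
  rwa [abs_of_nonneg ha, abs_of_nonneg (by unfold sgnPow; positivity)] at this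

lemma sgnPow_mul_self {p : ℝ} (hp : 1 ≤ p) (a : ℝ) : sgnPow p a * a = |a| ^ (p + 1) := by
  rw [sgnPow, mul_assoc, ← abs_mul_abs_self a, ← sq, ← Real.rpow_natCast,
    ← Real.rpow_add_of_nonneg (abs_nonneg a) (by linarith) (by positivity)]
  congr 1
  push_cast
  ring

lemma abs_sgnPow_le {p a c : ℝ} (hp : 1 ≤ p) (h : |a| ≤ c) : |sgnPow p a| ≤ c ^ p := by
  rw [abs_sgnPow hp]
  exact Real.rpow_le_rpow (abs_nonneg _) h (by linarith)

/-- The graph of the convex function `|·| ^ (p + 1)` lies above its tangent. After division by `a`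
this is Bernoulli's inequality. -/
lemma rpow_tangent {p : ℝ} (hp : 1 ≤ p) (a x : ℝ) :
    |a| ^ (p + 1) + (p + 1) * (sgnPow p a * x) ≤ |a + x| ^ (p + 1) := by
  by_cases ha : a = 0
  · subst ha
    simp only [sgnPow, mul_zero, zero_mul, add_zero, zero_add, abs_zero]
    rw [Real.zero_rpow (by linarith)]
    positivity
  have h1 : a + x = a * (1 + x / a) := by field_simp
  rw [h1, abs_mul, Real.mul_rpow (abs_nonneg _) (abs_nonneg _)]
  have h2 : sgnPow p a * x = |a| ^ (p + 1) * (x / a) := by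
    rw [← sgnPow_mul_self hp]; field_simp
  rw [h2]
  have h3 : 1 + (p + 1) * (x / a) ≤ |1 + x / a| ^ (p + 1) := by
    by_cases h : -1 ≤ x / a
    · rw [abs_of_nonneg (by linarith)]
      exact one_add_mul_self_le_rpow_one_add h (by linarith)
    -- Here `x / a < -1`, so the left side is negative and there is nothing to prove.
    · push Not at h
      have : 0 ≤ |1 + x / a| ^ (p + 1) := by positivity
      nlinarith
  calc |a| ^ (p + 1) + (p + 1) * (|a| ^ (p + 1) * (x / a))
      = |a| ^ (p + 1) * (1 + (p + 1) * (x / a)) := by ring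
    _ ≤ _ := by gcongr

lemma integrable_sgnPow_mul {n : ℕ} {p : ℝ} (hp : 1 ≤ p) {u d v e : ℝ → ℝ} (hu : Rad n u d)
    (hv : Rad n v e) : Integrable (fun r => sgnPow p (u r) * v r) (wt n) := by
  obtain ⟨M, hM⟩ := hu.bdd
  obtain ⟨N, hN⟩ := hv.bdd
  refine integrable_wt (M := M ^ p * N)
    (((continuous_sgnPow hp).comp_continuousOn hu.continuousOn).mul hv.continuousOn) fun r hr => ?_
  rw [abs_mul]
  have h1 := abs_sgnPow_le hp (hM r hr)
  have h2 := hN r hr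
  have : 0 ≤ M ^ p := (abs_nonneg _).trans h1
  gcongr

/-- The first variation inequality at a minimizer. -/
lemma IsFeasMin.first_variation {n : ℕ} {V : ℝ → ℝ} {R b c p : ℝ} {w d ζ ξ : ℝ → ℝ}
    (hV : Continuous V) (hp : 1 ≤ p) (h : IsFeasMin n V R b c p w d) (hζ : Rad n ζ ξ)
    (hpos : 0 ≤ ∫ r, sgnPow p (w r) * ζ r ∂(wt n))
    (hadm : ∃ t₀ > 0, ∀ t, 0 < t → t ≤ t₀ → ∀ r ∈ conSet R b, |w r + t * ζ r| ≤ c) :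
    0 ≤ form n V w d ζ ξ := by
  obtain ⟨t₀, ht₀, hadm⟩ := hadm
  have key : ∀ t, 0 < t → t ≤ t₀ → 0 ≤ 2 * form n V w d ζ ξ + t * form n V ζ ξ ζ ξ := by
    intro t ht ht'
    have hr := h.rad.add_mul hζ t
    -- Because the mass is only required to be at least 1, the tangent inequality makes the
    -- perturbed function admissible without renormalization.
    have hf : Feas n R b c p (fun r => w r + t * ζ r) (fun r => d r + t * ξ r) := by
      refine ⟨hr, h.mass.trans ?_, hadm t ht ht'⟩
      have i1 := integrable_rpow h.rad (q := p + 1) (by linarith)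
      have i2 := (integrable_sgnPow_mul hp h.rad hζ).const_mul ((p + 1) * t)
      have h1 : ∫ r, (|w r| ^ (p + 1) + (p + 1) * t * (sgnPow p (w r) * ζ r)) ∂(wt n) ≤
          ∫ r, |w r + t * ζ r| ^ (p + 1) ∂(wt n) := by
        refine integral_mono (i1.add i2) (integrable_rpow hr (by linarith)) fun r => ?_
        have := rpow_tangent hp (w r) (t * ζ r)
        simp only
        linarith
      rw [integral_add i1 i2, integral_const_mul] at h1
      have h2 : 0 ≤ (p + 1) * t * ∫ r, sgnPow p (w r) * ζ r ∂(wt n) := by positivity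
      exact mul_le_mul_of_nonneg_left (by linarith) n.cast_nonneg
    have h1 := h.le _ _ hf
    rw [form_add_mul_self hV h.rad hζ] at h1
    have h2 : 0 ≤ t * (2 * form n V w d ζ ξ + t * form n V ζ ξ ζ ξ) := by linarith
    exact nonneg_of_mul_nonneg_right h2 ht
  -- After division by `t` the quadratic term of the energy disappears as `t` decreases to 0.
  have hlim : Tendsto (fun t => 2 * form n V w d ζ ξ + t * form n V ζ ξ ζ ξ) (𝓝[>] 0)
      (𝓝 (2 * form n V w d ζ ξ + 0 * form n V ζ ξ ζ ξ)) :=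
    ((by fun_prop : Continuous fun t => 2 * form n V w d ζ ξ + t * form n V ζ ξ ζ ξ).tendsto
      0).mono_left nhdsWithin_le_nhds
  have := ge_of_tendsto hlim (by
    filter_upwards [Ioc_mem_nhdsGT ht₀] with t ht using key t ht.1 ht.2)
  linarith

/-- The normalized mass of a minimizer of positive energy is exactly one. -/
lemma IsFeasMin.mass_eq {n : ℕ} {V : ℝ → ℝ} {R b c p : ℝ} {w d : ℝ → ℝ}
    (hp : 0 ≤ p) (h : IsFeasMin n V R b c p w d) (hpos : 0 < form n V w d w d) :
    n * ∫ r, |w r| ^ (p + 1) ∂(wt n) = 1 := by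
  by_contra hne
  set m := n * ∫ r, |w r| ^ (p + 1) ∂(wt n) with hm
  have hm1 : 1 < m := lt_of_le_of_ne h.mass (Ne.symm hne)
  -- The factor that brings the mass down to 1. It is less than 1, so it preserves the constraint
  -- and would strictly lower a positive energy.
  set t := m ^ (-(1 / (p + 1))) with ht
  have hm0 : 0 < m := by linarith
  have ht0 : 0 < t := Real.rpow_pos_of_pos hm0 _
  have ht1 : t < 1 := Real.rpow_lt_one_of_one_lt_of_neg hm1 (by
    have : 0 < 1 / (p + 1) := by positivity
    linarith)
  have htm : t ^ (p + 1) * m = 1 := by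
    rw [ht, ← Real.rpow_mul hm0.le]
    have : -(1 / (p + 1)) * (p + 1) = -1 := by field_simp
    rw [this, Real.rpow_neg_one, inv_mul_cancel₀ hm0.ne']
  have hf : Feas n R b c p (fun r => t * w r) (fun r => t * d r) := by
    refine ⟨h.rad.const_mul t, ?_, fun r hr => ?_⟩
    · simp only [abs_mul, abs_of_pos ht0, Real.mul_rpow ht0.le (abs_nonneg _)]
      rw [integral_const_mul, mul_left_comm, ← hm, htm]
    · rw [abs_mul, abs_of_pos ht0]
      exact (mul_le_of_le_one_left (abs_nonneg _) ht1.le).trans (h.bound r hr)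
  have h1 := h.le _ _ hf
  rw [form_smul_self] at h1
  have : t ^ 2 < 1 := by nlinarith
  nlinarith

/-- Comparison with a paraboloid on `(0, R]`. -/
lemma comparison {n : ℕ} (hn : 1 ≤ n) {R δ : ℝ} (hR : R ∈ Ioc (0 : ℝ) 1) {v d : ℝ → ℝ}
    (hv : Rad n v d) (hvR : v R ≤ 0)
    (H : ∀ ζ ξ, Rad n ζ ξ → (∀ r ∈ Ioc (0 : ℝ) 1,
      ζ r = 0 ∨ (r < R ∧ 0 < ζ r ∧ ζ r = v r - δ * (R ^ 2 - r ^ 2) / (2 * n))) →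
      ∫ r, d r * ξ r ∂(wt n) ≤ δ * ∫ r, ζ r ∂(wt n)) :
    ∀ r ∈ Ioc (0 : ℝ) R, v r ≤ δ * (R ^ 2 - r ^ 2) / (2 * n) := by
  have hn0 : (n : ℝ) ≠ 0 := by positivity
  -- The paraboloid has Laplacian `-δ` and vanishes at `R`; its derivative is `-δ r / n`.
  have hrad : Rad n (fun r => δ * (R ^ 2 - r ^ 2) / (2 * n)) (fun r => - (δ * r / n)) := by
    obtain ⟨M, hM⟩ := (isCompact_Icc (a := (0 : ℝ)) (b := 1)).exists_bound_of_continuousOn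
      (f := fun r => δ * (R ^ 2 - r ^ 2) / (2 * n)) (by fun_prop)
    obtain ⟨N, hN⟩ := (isCompact_Icc (a := (0 : ℝ)) (b := 1)).exists_bound_of_continuousOn
      (f := fun r => - (δ * r / n)) (by fun_prop)
    refine Rad.of_hasDerivAt (s := ∅) countable_empty (by fun_prop)
      ⟨M, fun r hr => hM r ⟨hr.1.le, hr.2⟩⟩ (fun r _ _ => ?_) (by fun_prop)
      (fun r hr _ => hN r ⟨hr.1.le, hr.2.le⟩)
    refine ((((hasDerivAt_pow 2 r).const_sub (R ^ 2)).const_mul δ).div_const _).congr_deriv ?_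
    field_simp
    simp
  set z : ℝ → ℝ := fun r => v r - δ * (R ^ 2 - r ^ 2) / (2 * n) with hz
  have hzr : Rad n z (fun r => d r - - (δ * r / n)) := hv.sub hrad
  have hzc := hzr.continuousOn
  have hzR : z R ≤ 0 := by simpa [hz] using hvR
  intro r₀ hr₀
  by_contra hlt
  push Not at hlt
  have hz0 : 0 < z r₀ := by simp only [hz]; linarith
  -- the component of `{z > 0}` containing `r₀`
  obtain ⟨β, hβ, hzβ, hβpos⟩ : ∃ β ∈ Ioc r₀ R, z β = 0 ∧ ∀ r ∈ Ico r₀ β, 0 < z r := by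
    set T := Icc r₀ R ∩ z ⁻¹' Iic 0 with hT
    have hcl : IsCompact T := by
      refine (isCompact_Icc (a := r₀) (b := R)).of_isClosed_subset ?_ inter_subset_left
      exact (hzc.mono fun r hr =>
        ⟨hr₀.1.trans_le hr.1, hr.2.trans hR.2⟩).preimage_isClosed_of_isClosed
        isClosed_Icc isClosed_Iic
    have hTne : T.Nonempty := ⟨R, ⟨hr₀.2, le_rfl⟩, hzR⟩
    have hmem := hcl.sInf_mem hTne
    set β := sInf T
    have hpos : ∀ r ∈ Ico r₀ β, 0 < z r := by
      intro r hr
      by_contra hle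
      exact absurd (csInf_le hcl.bddBelow ⟨⟨hr.1, hr.2.le.trans hmem.1.2⟩, not_lt.1 hle⟩)
        (not_le.2 hr.2)
    have hlt' : r₀ < β := lt_of_le_of_ne hmem.1.1 fun he => by
      have := hmem.2
      rw [← he] at this
      exact absurd hz0 (not_lt.2 this)
    refine ⟨β, ⟨hlt', hmem.1.2⟩, le_antisymm hmem.2 ?_, hpos⟩
    have hcw : ContinuousWithinAt z (Ico r₀ β) β :=
      (hzc β ⟨hr₀.1.trans hlt', hmem.1.2.trans hR.2⟩).mono fun r hr =>
        ⟨hr₀.1.trans_le hr.1, hr.2.le.trans (hmem.1.2.trans hR.2)⟩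
    have : (𝓝[Ico r₀ β] β).NeBot := by
      rw [nhdsWithin_Ico_eq_nhdsLT hlt']
      infer_instance
    exact ge_of_tendsto hcw.tendsto (by
      filter_upwards [self_mem_nhdsWithin] with r hr using (hpos r hr).le)
  obtain ⟨α, hα0, hαr, hzα, hαpos⟩ : ∃ α, 0 ≤ α ∧ α < r₀ ∧ (α = 0 ∨ z α = 0) ∧
      ∀ r ∈ Ioc α r₀, 0 < z r := by
    by_cases hall : ∀ r ∈ Ioc 0 r₀, 0 < z r
    · exact ⟨0, le_rfl, hr₀.1, Or.inl rfl, hall⟩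
    push Not at hall
    obtain ⟨r₁, hr₁, hz₁⟩ := hall
    set T := Icc r₁ r₀ ∩ z ⁻¹' Iic 0 with hT
    have hcl : IsCompact T := by
      refine (isCompact_Icc (a := r₁) (b := r₀)).of_isClosed_subset ?_ inter_subset_left
      exact (hzc.mono fun r hr => ⟨hr₁.1.trans_le hr.1,
        hr.2.trans (hr₀.2.trans hR.2)⟩).preimage_isClosed_of_isClosed isClosed_Icc isClosed_Iic
    have hTne : T.Nonempty := ⟨r₁, ⟨le_rfl, hr₁.2⟩, hz₁⟩
    have hmem := hcl.sSup_mem hTne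
    set α := sSup T
    have hα : 0 < α := hr₁.1.trans_le hmem.1.1
    have hpos : ∀ r ∈ Ioc α r₀, 0 < z r := by
      intro r hr
      by_contra hle
      exact absurd (le_csSup hcl.bddAbove ⟨⟨hmem.1.1.trans hr.1.le, hr.2⟩, not_lt.1 hle⟩)
        (not_le.2 hr.1)
    have hlt' : α < r₀ := lt_of_le_of_ne hmem.1.2 fun he => by
      have := hmem.2
      rw [he] at this
      exact absurd hz0 (not_lt.2 this)
    refine ⟨α, hα.le, hlt', Or.inr (le_antisymm hmem.2 ?_), hpos⟩
    have hcw : ContinuousWithinAt z (Ioc α r₀) α :=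
      (hzc α ⟨hα, hlt'.le.trans (hr₀.2.trans hR.2)⟩).mono fun r hr =>
        ⟨hα.trans hr.1, hr.2.trans (hr₀.2.trans hR.2)⟩
    have : (𝓝[Ioc α r₀] α).NeBot := by
      rw [nhdsWithin_Ioc_eq_nhdsGT hlt']
      infer_instance
    exact ge_of_tendsto hcw.tendsto (by
      filter_upwards [self_mem_nhdsWithin] with r hr using (hpos r hr).le)
  have hβ1 : β ≤ 1 := hβ.2.trans hR.2
  have hαβ : α < β := hαr.trans hβ.1
  -- The test function is `z` on a single component of its positivity set, extended by zero. No
  -- boundary value is needed on the left when the component reaches 0.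
  have hζ := hzr.cut hα0 hαβ hβ1 hzβ hzα
  set ζ := (Ioo α β).indicator z with hζd
  set ξ := (Ioo α β).indicator (fun r => d r - - (δ * r / n)) with hξd
  have hposI : ∀ r ∈ Ioo α β, 0 < z r := fun r hr => by
    rcases le_total r r₀ with h | h
    · exact hαpos r ⟨hr.1, h⟩
    · exact hβpos r ⟨h, hr.2⟩
  have h1 := H ζ ξ hζ fun r hr => by
    by_cases h : r ∈ Ioo α β
    · right
      rw [hζd, indicator_of_mem h]
      exact ⟨h.2.trans_le hβ.2, hposI r h, rfl⟩
    · left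
      rw [hζd, indicator_of_notMem h]
  have hζ1 : ζ 1 = 0 := indicator_of_notMem (fun h => absurd h.2 (not_lt.2 hβ1)) _
  obtain ⟨i1, i2, ibp⟩ := weighted_integration_by_parts (n := n) (h := fun _ => δ)
    (M := |δ|) continuousOn_const (fun _ _ => le_rfl) hζ.memLp hζ.eq
  rw [hζ1, zero_mul, zero_sub, integral_const_mul] at ibp
  have hker : ∀ t ∈ Ioc (0 : ℝ) 1,
      (∫ s in (0 : ℝ)..t, s ^ (n - 1) * δ) / t ^ (n - 1) = δ * t / n := by
    intro t ht
    have ht0 : t ≠ 0 := ht.1.ne'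
    rw [intervalIntegral.integral_mul_const, integral_pow, Nat.sub_add_cancel hn]
    have h1 : ((n - 1 : ℕ) : ℝ) + 1 = n := by rw [Nat.cast_sub hn]; simp
    rw [h1, zero_pow (by omega)]
    obtain ⟨m, rfl⟩ := Nat.exists_eq_add_of_le' hn
    simp only [Nat.add_sub_cancel]
    field_simp
    ring
  -- The last integral equals `-δ ∫ ζ` by `ibp`, so the hypothesis makes `∫ ξ²` nonpositive. Then `ξ
  -- = 0` almost everywhere and `ζ` vanishes identically, contradicting `z r₀ > 0`.
  have e1 : ∫ r, ξ r * ξ r ∂(wt n) = ∫ r, d r * ξ r ∂(wt n) + ∫ t, ξ t *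
      ((∫ s in (0 : ℝ)..t, s ^ (n - 1) * δ) / t ^ (n - 1)) ∂(wt n) := by
    have i0 : Integrable (fun r => d r * ξ r) (wt n) := hv.memLp.integrable_mul hζ.memLp
    rw [← integral_add i0 i1]
    refine integral_congr_ae (ae_wt_of_forall fun r hr => ?_)
    simp only
    rw [hker r hr]
    by_cases h : r ∈ Ioo α β
    · rw [hξd, indicator_of_mem h]; ring
    · rw [hξd, indicator_of_notMem h]; ring
  have e2 : ∫ r, ξ r * ξ r ∂(wt n) = 0 := by
    refine le_antisymm ?_ (integral_nonneg fun r => mul_self_nonneg _)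
    rw [e1]
    linarith
  rw [integral_eq_zero_iff_of_nonneg (fun r => mul_self_nonneg _)
    (hζ.memLp.integrable_mul hζ.memLp)] at e2
  have e3 : ∀ᵐ r ∂(volume.restrict (Ioc (0 : ℝ) 1)), ξ r = 0 := by
    refine (ae_wt_iff (n := n)).1 ?_
    filter_upwards [e2] with r hr
    exact mul_self_eq_zero.1 hr
  have hr₀1 : r₀ ∈ Ioc (0 : ℝ) 1 := ⟨hr₀.1, hr₀.2.trans hR.2⟩
  have e4 : ζ r₀ = 0 := by
    rw [hζ.eq r₀ hr₀1, hζ1, zero_sub, neg_eq_zero, intervalIntegral.integral_of_le hr₀1.2]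
    refine integral_eq_zero_of_ae ?_
    exact ae_mono (Measure.restrict_mono (Ioc_subset_Ioc_left hr₀.1.le) le_rfl) e3
  rw [hζd, indicator_of_mem (show r₀ ∈ Ioo α β from ⟨hαr, hβ.1⟩)] at e4
  exact hz0.ne' e4

/-! ### Asymptotics of minimizers -/

/-- The standing assumptions on the pole `s`, the constraint set and the constraint level. -/
structure Setup (n : ℕ) (V φ ψ P S : ℝ → ℝ) (C s R b c : ℝ) : Prop where
  one_le : 1 ≤ n
  cont : Continuous V
  nonneg : ∀ r, 0 ≤ V r
  pair : FundPair n V φ ψ P S C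
  mem : s ∈ Ioc (0 : ℝ) 1
  R_pos : 0 < R
  R_lt : R < s
  lt_b : s < b
  energy : ∀ r ∈ Ioc (0 : ℝ) 1, R ≤ r → r ≤ b → r ≠ s → peakEnergy φ ψ C s < peakEnergy φ ψ C r
  strict : ∀ r ∈ Icc (0 : ℝ) 1, r ≠ s → peak φ ψ s r < 1
  inner : peak φ ψ s R < c
  outer : b ≤ 1 → peak φ ψ s b < c
  c_lt : c < 1

namespace Setup

variable {n : ℕ} {V φ ψ P S : ℝ → ℝ} {C s R b c : ℝ}

lemma R_mem (h : Setup n V φ ψ P S C s R b c) : R ∈ Ioc (0 : ℝ) 1 :=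
  ⟨h.R_pos, h.R_lt.le.trans h.mem.2⟩

lemma c_pos (h : Setup n V φ ψ P S C s R b c) : 0 < c :=
  (h.pair.peak_pos h.mem ⟨h.R_pos.le, h.R_mem.2⟩).trans h.inner

lemma rad_peak (h : Setup n V φ ψ P S C s R b c) : Rad n (peak φ ψ s) (deriv (peak φ ψ s)) :=
  h.pair.rad_peak h.cont h.mem

/-- The peak is monotone on each side of the pole, so its largest values on the constraint set are
controlled at `R` and `b`. The strict gap below `c` leaves room for rescaling and later makes the
constraint inactive. -/
lemma exists_peak_bound (h : Setup n V φ ψ P S C s R b c) :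
    ∃ c₀, 0 < c₀ ∧ c₀ < c ∧ ∀ r ∈ conSet R b, peak φ ψ s r ≤ c₀ := by
  have hR : ∀ r ∈ Ioc (0 : ℝ) 1, r < R → peak φ ψ s r ≤ peak φ ψ s R := fun r hr hrR => by
    rw [h.pair.peak_of_le h.mem (hrR.trans h.R_lt).le, h.pair.peak_of_le h.mem h.R_lt.le]
    have h1 := h.pair.φ_mono ⟨hr.1.le, hr.2⟩ ⟨h.R_pos.le, h.R_mem.2⟩ hrR.le
    have := h.pair.φ_pos' h.mem
    gcongr
  have hR0 := h.pair.peak_pos h.mem (r := R) ⟨h.R_pos.le, h.R_mem.2⟩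
  by_cases hb : b ≤ 1
  · refine ⟨max (peak φ ψ s R) (peak φ ψ s b), lt_max_of_lt_left hR0,
      max_lt h.inner (h.outer hb), ?_⟩
    rintro r ⟨hr, hr' | hr'⟩
    · exact (hR r hr hr').trans (le_max_left _ _)
    · refine le_trans ?_ (le_max_right _ _)
      rw [h.pair.peak_of_ge h.mem (h.lt_b.le.trans hr'), h.pair.peak_of_ge h.mem h.lt_b.le]
      have h1 := h.pair.ψ_anti ⟨h.mem.1.trans h.lt_b, hb⟩ hr hr'
      have := h.pair.ψ_pos s h.mem
      gcongr
  · refine ⟨peak φ ψ s R, hR0, h.inner, ?_⟩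
    rintro r ⟨hr, hr' | hr'⟩
    · exact hR r hr hr'
    · exact absurd (hr'.trans hr.2) hb

/-- Scaled normalized Green functions are admissible for large exponents. -/
lemma eventually_feas (h : Setup n V φ ψ P S C s R b c) {κ : ℝ} (hκ1 : κ < 1)
    (hκc : ∀ r ∈ conSet R b, peak φ ψ s r ≤ κ * c) (hκ0 : 0 < κ) :
    ∀ᶠ p in atTop, Feas n R b c p (fun r => κ⁻¹ * peak φ ψ s r)
      (fun r => κ⁻¹ * deriv (peak φ ψ s) r) := by
  -- On a set of positive measure near the pole the peak exceeds `κ₁ > κ`, so the mass of the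
  -- rescaled peak grows like `(κ₁ / κ) ^ (p + 1)`.
  obtain ⟨κ₁, hκκ₁, hκ₁1⟩ := exists_between hκ1
  have hκ₁0 := hκ0.trans hκκ₁
  have hcont := (h.pair.continuousOn_peak h.mem).mono Ioc_subset_Icc_self
  have hev : ∀ᶠ r in 𝓝[Ioc 0 1] s, κ₁ < peak φ ψ s r :=
    (hcont s h.mem).eventually (lt_mem_nhds (by rwa [h.pair.peak_self h.mem]))
  obtain ⟨ε, hε, hεs⟩ := Metric.mem_nhdsWithin_iff.1 hev
  -- Only the left side of the pole is used, so that the pole 1 is covered as well.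
  set E := Ioc (max (s - ε) 0) s with hE
  have hEpeak : ∀ r ∈ E, κ₁ < peak φ ψ s r := fun r hr => by
    have h1 := max_lt_iff.1 hr.1
    refine hεs ⟨?_, h1.2, hr.2.trans h.mem.2⟩
    rw [Metric.mem_ball, Real.dist_eq, abs_lt]
    exact ⟨by linarith, by linarith [hr.2]⟩
  have hE1 : E ⊆ Ioc 0 1 := Ioc_subset_Ioc (le_max_right _ _) h.mem.2
  have hmpos : 0 < (wt n).real E := by
    rw [measureReal_def, ENNReal.toReal_pos_iff]
    refine ⟨pos_iff_ne_zero.2 fun h0 => ?_, measure_lt_top _ _⟩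
    have h1 := restrict_ac_wt n h0
    rw [Measure.restrict_apply measurableSet_Ioc, inter_eq_left.2 hE1, Real.volume_Ioc,
      ENNReal.ofReal_eq_zero] at h1
    have : max (s - ε) 0 < s := max_lt (by linarith) h.mem.1
    linarith
  have hn0 : (0 : ℝ) < n := by have := h.one_le; positivity
  have hq : 1 < κ₁ / κ := (one_lt_div hκ0).2 hκκ₁
  have hlarge : ∀ᶠ p : ℝ in atTop, 1 ≤ n * ((κ₁ / κ) ^ (p + 1) * (wt n).real E) := by
    have h1 : Tendsto (fun p : ℝ => (κ₁ / κ) ^ (p + 1)) atTop atTop :=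
      (tendsto_rpow_atTop_of_base_gt_one _ hq).comp (tendsto_atTop_add_const_right _ 1 tendsto_id)
    have h2 : Tendsto (fun p : ℝ => n * ((κ₁ / κ) ^ (p + 1) * (wt n).real E)) atTop atTop :=
      (h1.atTop_mul_const hmpos).const_mul_atTop hn0
    exact h2.eventually_ge_atTop 1
  filter_upwards [hlarge, eventually_ge_atTop 0] with p hp hp0
  have hrad := h.rad_peak.const_mul κ⁻¹
  refine ⟨hrad, hp.trans ?_, fun r hr => ?_⟩
  · have hi := integrable_rpow hrad (q := p + 1) (by linarith)
    refine mul_le_mul_of_nonneg_left ?_ hn0.le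
    calc (κ₁ / κ) ^ (p + 1) * (wt n).real E = ∫ _ in E, (κ₁ / κ) ^ (p + 1) ∂(wt n) := by
          rw [setIntegral_const, smul_eq_mul, mul_comm]
      _ ≤ ∫ r in E, |κ⁻¹ * peak φ ψ s r| ^ (p + 1) ∂(wt n) := by
          refine setIntegral_mono_on (integrable_const _) hi.integrableOn measurableSet_Ioc
            fun r hr => ?_
          have h1 := hEpeak r hr
          have h2 := hκ₁0.trans h1
          refine Real.rpow_le_rpow (by positivity) ?_ (by linarith)
          rw [abs_of_pos (by positivity), div_eq_inv_mul]
          gcongr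
      _ ≤ _ := setIntegral_le_integral hi (Eventually.of_forall fun r => by positivity)
  · have h1 := h.pair.peak_pos h.mem (r := r) ⟨hr.1.1.le, hr.1.2⟩
    rw [abs_of_pos (by positivity), ← div_eq_inv_mul, div_le_iff₀ hκ0, mul_comm]
    exact hκc r hr

/-- The competitor `κ⁻¹ peak` has energy `κ⁻² Γ(s)`, and `κ` may be taken arbitrarily close to 1
from below as long as it exceeds `c₀ / c`. -/
lemma eventually_energy_le (h : Setup n V φ ψ P S C s R b c) {ε : ℝ} (hε : 0 < ε) :
    ∀ᶠ p in atTop, (∃ u d, Feas n R b c p u d) ∧ ∀ w d, IsFeasMin n V R b c p w d →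
      form n V w d w d ≤ peakEnergy φ ψ C s + ε := by
  obtain ⟨c₀, hc₀, hc₀c, hcon⟩ := h.exists_peak_bound
  have hc := h.c_pos
  have hΓ := h.pair.peakEnergy_pos h.mem
  have hlim : Tendsto (fun κ : ℝ => κ⁻¹ ^ 2 * peakEnergy φ ψ C s) (𝓝[<] 1)
      (𝓝 ((1 : ℝ)⁻¹ ^ 2 * peakEnergy φ ψ C s)) :=
    ((((continuousAt_inv₀ one_ne_zero).pow 2).mul_const _).tendsto).mono_left nhdsWithin_le_nhds
  have h1 : ∀ᶠ κ : ℝ in 𝓝[<] 1, κ⁻¹ ^ 2 * peakEnergy φ ψ C s < peakEnergy φ ψ C s + ε :=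
    hlim.eventually (gt_mem_nhds (by simp; linarith))
  obtain ⟨κ, ⟨hκε, hκ⟩⟩ := (h1.and (Ioo_mem_nhdsLT (show c₀ / c < 1 by
    rw [div_lt_one hc]; exact hc₀c))).exists
  have hκ0 : 0 < κ := (by positivity : 0 < c₀ / c).trans hκ.1
  have h2 : c₀ < κ * c := (div_lt_iff₀ hc).1 hκ.1
  filter_upwards [h.eventually_feas hκ.2 (fun r hr => (hcon r hr).trans h2.le) hκ0] with p hp
  refine ⟨⟨_, _, hp⟩, fun w d hw => (hw.le _ _ hp).trans ?_⟩
  rw [form_smul_self, h.pair.form_peak_self h.cont h.mem]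
  exact hκε.le

/-- The measure `wt n` has total mass `1 / n`, so `|w| < 1` everywhere would make the normalized
mass less than 1. The point found is off the constraint set because `c < 1`. -/
lemma exists_one_le_abs (h : Setup n V φ ψ P S C s R b c) {p : ℝ} (hp : 0 ≤ p) {w d : ℝ → ℝ}
    (hw : Feas n R b c p w d) :
    ∃ r ∈ Ioc (0 : ℝ) 1, R ≤ r ∧ r < b ∧ 1 ≤ |w r| := by
  by_contra hcon
  push Not at hcon
  have hlt : ∀ r ∈ Ioc (0 : ℝ) 1, |w r| < 1 := fun r hr => by
    by_cases hrc : r ∈ conSet R b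
    · exact (hw.bound r hrc).trans_lt h.c_lt
    · have h1 : ¬ (r < R ∨ b ≤ r) := fun h' => hrc ⟨hr, h'⟩
      push Not at h1
      exact hcon r hr h1.1 h1.2
  have hn0 : (0 : ℝ) < n := by have := h.one_le; positivity
  have hi := integrable_rpow hw.rad (q := p + 1) (by linarith)
  have hpos : ∀ r ∈ Ioc (0 : ℝ) 1, 0 < 1 - |w r| ^ (p + 1) := fun r hr =>
    sub_pos.2 (Real.rpow_lt_one (abs_nonneg _) (hlt r hr) (by linarith))
  have hint : ∫ r, (1 - |w r| ^ (p + 1)) ∂(wt n) = 0 := by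
    refine le_antisymm ?_ (integral_nonneg_of_ae (ae_wt_of_forall fun r hr => (hpos r hr).le))
    rw [integral_sub (integrable_const _) hi, integral_wt_const h.one_le]
    have := hw.mass
    rw [sub_nonpos, div_le_iff₀ hn0]
    linarith
  rw [integral_eq_zero_iff_of_nonneg_ae (ae_wt_of_forall fun r hr => (hpos r hr).le)
    ((integrable_const _).sub hi)] at hint
  have h2 : ∀ᵐ r ∂(volume.restrict (Ioc (0 : ℝ) 1)), False := by
    filter_upwards [ae_wt_iff.1 hint, ae_restrict_mem measurableSet_Ioc] with r h3 h4
    exact (hpos r h4).ne' h3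
  have h3 : volume.restrict (Ioc (0 : ℝ) 1) = 0 := by
    rw [← ae_eq_bot]
    exact Filter.eventually_false_iff_eq_bot.1 h2
  rw [Measure.restrict_eq_zero, Real.volume_Ioc] at h3
  norm_num at h3

/-- Minimizers converge to the normalized Green function in energy. -/
lemma eventually_energy_close (h : Setup n V φ ψ P S C s R b c) {ε : ℝ} (hε : 0 < ε) :
    ∀ᶠ p in atTop, ∀ w d, IsFeasMin n V R b c p w d → 0 ≤ w s →
      form n V (fun r => w r - peak φ ψ s r) (fun r => d r - deriv (peak φ ψ s) r)
        (fun r => w r - peak φ ψ s r) (fun r => d r - deriv (peak φ ψ s) r) ≤ ε := by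
  set Γ := peakEnergy φ ψ C s with hΓd
  have hΓ : 0 < Γ := h.pair.peakEnergy_pos h.mem
  set η := ε / (4 * Γ) with hη
  have hη0 : 0 < η := by positivity
  -- The modulus of continuity at the pole from `sq_sub_le`; it vanishes at `s`.
  set κ : ℝ → ℝ := fun r => (peakEnergy φ ψ C r)⁻¹ + Γ⁻¹ - 2 * (Γ⁻¹ * peak φ ψ s r) with hκ
  have hκc : ContinuousOn (fun r => (Γ + 1) * κ r) (Ioc 0 1) := by
    refine continuousOn_const.mul (ContinuousOn.sub (ContinuousOn.add ?_ continuousOn_const) ?_)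
    · exact h.pair.continuousOn_peakEnergy.inv₀ fun r hr => (h.pair.peakEnergy_pos hr).ne'
    · exact continuousOn_const.mul (continuousOn_const.mul
        ((h.pair.continuousOn_peak h.mem).mono Ioc_subset_Icc_self))
  have hκs : (Γ + 1) * κ s = 0 := by
    simp only [hκ, h.pair.peak_self h.mem, ← hΓd]
    ring
  have hev : ∀ᶠ r in 𝓝[Ioc 0 1] s, (Γ + 1) * κ r < η ^ 2 :=
    (hκc s h.mem).eventually (gt_mem_nhds (hκs.trans_lt (by positivity)))
  obtain ⟨δ, hδ, hδs⟩ := Metric.mem_nhdsWithin_iff.1 hev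
  -- By compactness, strictness of the minimum becomes a uniform gap at distance at least `δ` from
  -- the pole.
  obtain ⟨γ, hγ, hγ'⟩ : ∃ γ > 0, ∀ r ∈ Ioc (0 : ℝ) 1, R ≤ r → r ≤ b → δ ≤ |r - s| →
      Γ + γ ≤ peakEnergy φ ψ C r := by
    set T := Icc R (min b 1) ∩ {r | δ ≤ |r - s|} with hT
    have hTc : IsCompact T := isCompact_Icc.inter_right
      (isClosed_le continuous_const (by fun_prop))
    have hT1 : T ⊆ Ioc 0 1 := fun r hr =>
      ⟨h.R_pos.trans_le hr.1.1, hr.1.2.trans (min_le_right _ _)⟩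
    rcases T.eq_empty_or_nonempty with he | hne
    · refine ⟨1, one_pos, fun r hr h1 h2 h3 => ?_⟩
      have : r ∈ T := ⟨⟨h1, le_min h2 hr.2⟩, h3⟩
      rw [he] at this
      exact absurd this (notMem_empty _)
    · obtain ⟨r₁, hr₁, hmin⟩ := hTc.exists_isMinOn hne (h.pair.continuousOn_peakEnergy.mono hT1)
      have hne' : r₁ ≠ s := by
        rintro rfl
        have := hr₁.2
        simp only [mem_ofPred_eq, sub_self, abs_zero] at this
        linarith
      have h4 := h.energy r₁ (hT1 hr₁) hr₁.1.1 (hr₁.1.2.trans (min_le_left _ _)) hne'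
      refine ⟨peakEnergy φ ψ C r₁ - Γ, by linarith, fun r hr h1 h2 h3 => ?_⟩
      have h5 : peakEnergy φ ψ C r₁ ≤ peakEnergy φ ψ C r := hmin ⟨⟨h1, le_min h2 hr.2⟩, h3⟩
      linarith
  set ε' := min (min (γ / 2) 1) (ε / 2) with hε'
  have hε'0 : 0 < ε' := by positivity
  have e1 : ε' ≤ γ / 2 := (min_le_left _ _).trans (min_le_left _ _)
  have e2 : ε' ≤ 1 := (min_le_left _ _).trans (min_le_right _ _)
  have e3 : ε' ≤ ε / 2 := min_le_right _ _
  filter_upwards [h.eventually_energy_le hε'0, eventually_ge_atTop 0] with p hp hp0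
  intro w d hw hws
  have hEn := hp.2 w d hw
  obtain ⟨r, hr, hRr, hrb, hwr⟩ := h.exists_one_le_abs hp0 hw.toFeas
  have h1 := h.pair.peakEnergy_mul_sq_le h.cont h.nonneg hr hw.rad
  have hΓr := h.pair.peakEnergy_pos hr
  have h2 : 1 ≤ w r ^ 2 := by
    rw [← sq_abs]; nlinarith
  -- `Γ(r) ≤ Γ(r) w(r)² ≤ form (w, w)`, and the gap then places `r` within `δ` of `s`.
  have h3 : peakEnergy φ ψ C r ≤ Γ + ε' := by nlinarith
  have hrs : |r - s| < δ := by
    by_contra hle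
    have := hγ' r hr hRr hrb.le (not_lt.1 hle)
    linarith
  have h4 : (Γ + 1) * κ r < η ^ 2 := hδs ⟨by rwa [Metric.mem_ball, Real.dist_eq], hr⟩
  have h5 := h.pair.sq_sub_le h.cont h.nonneg h.mem hr hw.rad
  have hκn : 0 ≤ κ r := by
    by_contra hneg
    push Not at hneg
    have h6 := form_self_nonneg (n := n) (u := w) (d := d) h.nonneg
    have h7 : 0 < form n V w d w d := lt_of_lt_of_le (by nlinarith) h1
    have h8 : form n V w d w d * κ r < 0 := mul_neg_of_pos_of_neg h7 hneg
    nlinarith [sq_nonneg (w r - w s)]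
  have h6 : |w r - w s| ≤ η := by
    refine abs_le_of_sq_le_sq ?_ hη0.le
    refine h5.trans (le_trans ?_ h4.le)
    exact mul_le_mul_of_nonneg_right (by linarith) hκn
  have h7 : 1 - η ≤ w s := by
    have h8 : |w r| ≤ |w s| + η := by
      have := abs_sub_abs_le_abs_sub (w r) (w s)
      linarith
    rw [abs_of_nonneg hws] at h8
    linarith
  -- The energy of the difference is `form (w, w) - 2 Γ w(s) + Γ`, at most `ε' + 2 Γ η`. The choice
  -- of `η` makes the second term `ε / 2`.
  rw [form_sub_self h.cont hw.rad h.rad_peak, form_comm n V w d (peak φ ψ s),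
    h.pair.form_peak h.cont h.mem
    hw.rad, h.pair.form_peak_self h.cont h.mem, ← hΓd]
  have h8 : Γ * η = ε / 4 := by rw [hη]; field_simp
  nlinarith

/-- Uniform convergence on `[R, 1]`. -/
lemma eventually_close_outer (h : Setup n V φ ψ P S C s R b c) {ε : ℝ} (hε : 0 < ε) :
    ∀ᶠ p in atTop, ∀ w d, IsFeasMin n V R b c p w d → 0 ≤ w s →
      ∀ r ∈ Icc R 1, |w r - peak φ ψ s r| ≤ ε := by
  obtain ⟨γ, hγ, hγ'⟩ := h.pair.exists_lower_bound_peakEnergy h.R_mem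
  filter_upwards [h.eventually_energy_close (ε := γ * ε ^ 2) (by positivity)] with p hp
  intro w d hw hws r hr
  have hr' : r ∈ Ioc (0 : ℝ) 1 := ⟨h.R_pos.trans_le hr.1, hr.2⟩
  have h1 := (h.pair.peakEnergy_mul_sq_le h.cont h.nonneg hr' (hw.rad.sub h.rad_peak)).trans
    (hp w d hw hws)
  refine abs_le_of_sq_le_sq ?_ hε.le
  have h2 := hγ' r hr
  refine le_of_mul_le_mul_left (le_trans ?_ h1) hγ
  gcongr

end Setup

/-! ### The constraint is natural -/

lemma form_const_mul_left (n : ℕ) (V u d v e : ℝ → ℝ) (t : ℝ) :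
    form n V (fun r => t * u r) (fun r => t * d r) v e = t * form n V u d v e := by
  unfold form
  rw [← integral_const_mul]
  congr 1; ext r; ring

lemma form_const_mul_right (n : ℕ) (V u d v e : ℝ → ℝ) (t : ℝ) :
    form n V v e (fun r => t * u r) (fun r => t * d r) = t * form n V v e u d := by
  rw [form_comm, form_const_mul_left, form_comm]

lemma Rad.of_contDiff {n : ℕ} {f : ℝ → ℝ} (hf : ContDiff ℝ 1 f) : Rad n f (deriv f) := by
  have hd : Continuous (deriv f) := hf.continuous_deriv le_rfl
  obtain ⟨M, hM⟩ := (isCompact_Icc (a := (0 : ℝ)) (b := 1)).exists_bound_of_continuousOn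
    hf.continuous.continuousOn
  obtain ⟨N, hN⟩ := (isCompact_Icc (a := (0 : ℝ)) (b := 1)).exists_bound_of_continuousOn
    hd.continuousOn
  exact Rad.of_hasDerivAt (s := ∅) countable_empty hf.continuous.continuousOn
    ⟨M, fun r hr => hM r ⟨hr.1.le, hr.2⟩⟩
    (fun r _ _ => (hf.differentiable one_ne_zero r).hasDerivAt)
    hd.aestronglyMeasurable (fun r hr _ => hN r ⟨hr.1.le, hr.2.le⟩)

namespace Setup

variable {n : ℕ} {V φ ψ P S : ℝ → ℝ} {C s R b c : ℝ}

/-- A cutoff living where no pointwise constraint is imposed. Adding multiples of it corrects the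
mass of any variation without affecting the constraint. -/
lemma exists_bump (h : Setup n V φ ψ P S C s R b c) :
    ∃ η η' : ℝ → ℝ, Rad n η η' ∧ (∀ r, 0 ≤ η r) ∧ (∀ r ∈ conSet R b, η r = 0) ∧
      ∃ ρ > 0, ∀ r, |r - s| < ρ → η r = 1 := by
  set ρ := min (s - R) (b - s) with hρ
  have hρ0 : 0 < ρ := lt_min (sub_pos.2 h.R_lt) (sub_pos.2 h.lt_b)
  let f : ContDiffBump s := ⟨ρ / 2, ρ, by positivity, by linarith⟩
  refine ⟨f, deriv f, Rad.of_contDiff f.contDiff, fun r => f.nonneg, fun r hr => ?_, ρ / 2,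
    by positivity, fun r hr => ?_⟩
  · refine f.zero_of_le_dist ?_
    change ρ ≤ dist r s
    rw [Real.dist_eq]
    rcases hr.2 with hr | hr
    · rw [abs_sub_comm]
      exact le_trans (min_le_left _ _) (le_trans (by linarith) (le_abs_self _))
    · exact le_trans (min_le_right _ _) (le_trans (by linarith) (le_abs_self _))
  · refine f.one_of_mem_closedBall ?_
    rw [Metric.mem_closedBall, Real.dist_eq]
    exact hr.le

/-- The multiplier rule, with a multiplier bounded uniformly in the exponent. -/
lemma eventually_multiplier (h : Setup n V φ ψ P S C s R b c) :
    ∃ Λ, 0 ≤ Λ ∧ ∀ᶠ p in atTop, ∀ w d, IsFeasMin n V R b c p w d → 0 ≤ w s →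
      ∃ l, |l| ≤ Λ ∧ ∀ ζ ξ, Rad n ζ ξ →
        (∃ t₀ > 0, ∀ t, 0 < t → t ≤ t₀ → ∀ r ∈ conSet R b, |w r + t * ζ r| ≤ c) →
        l * ∫ r, sgnPow p (w r) * ζ r ∂(wt n) ≤ form n V w d ζ ξ := by
  obtain ⟨η, η', hη, hη0, hηc, ρ, hρ, hη1⟩ := h.exists_bump
  have hn0 : (0 : ℝ) < n := by have := h.one_le; positivity
  obtain ⟨κ₀, hκ₀0, hκ₀1, hκ₀⟩ : ∃ κ₀, 0 < κ₀ ∧ κ₀ < 1 ∧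
      ∀ r ∈ Icc R 1, ρ ≤ |r - s| → peak φ ψ s r ≤ κ₀ := by
    set T := Icc R 1 ∩ {r | ρ ≤ |r - s|} with hT
    have hTc : IsCompact T := isCompact_Icc.inter_right
      (isClosed_le continuous_const (by fun_prop))
    have hT1 : T ⊆ Icc 0 1 := fun r hr => ⟨h.R_pos.le.trans hr.1.1, hr.1.2⟩
    rcases T.eq_empty_or_nonempty with he | hne
    · refine ⟨1 / 2, by norm_num, by norm_num, fun r hr hr' => ?_⟩
      have : r ∈ T := ⟨hr, hr'⟩
      rw [he] at this
      exact absurd this (notMem_empty _)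
    · obtain ⟨r₁, hr₁, hmax⟩ := hTc.exists_isMaxOn hne
        ((h.pair.continuousOn_peak h.mem).mono hT1)
      refine ⟨peak φ ψ s r₁, h.pair.peak_pos h.mem (hT1 hr₁), h.strict r₁ (hT1 hr₁) ?_,
        fun r hr hr' => hmax ⟨hr, hr'⟩⟩
      rintro rfl
      have := hr₁.2
      simp only [mem_ofPred_eq, sub_self, abs_zero] at this
      linarith
  obtain ⟨m, hm0, hm⟩ : ∃ m > 0, ∀ r ∈ Icc R 1, m ≤ peak φ ψ s r := by
    have hsub : Icc R 1 ⊆ Icc 0 1 := Icc_subset_Icc_left h.R_pos.le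
    obtain ⟨r₁, hr₁, hmin⟩ := isCompact_Icc.exists_isMinOn (nonempty_Icc.2 h.R_mem.2)
      ((h.pair.continuousOn_peak h.mem).mono hsub)
    exact ⟨_, h.pair.peak_pos h.mem (hsub hr₁), fun r hr => hmin hr⟩
  -- A level below 1 that bounds `|w|` wherever `η` is not known to be 1: by `c` on the constraint
  -- set, by closeness to the peak elsewhere.
  set κ := max c ((1 + κ₀) / 2) with hκ
  have hκ1 : κ < 1 := max_lt h.c_lt (by linarith)
  have hκ0 : 0 < κ := lt_max_of_lt_left h.c_pos
  -- The three bounds on `ε` give, on `[R, 1]`, that `w ≥ 0`, that `w ≤ κ` away from the pole, and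
  -- that `w ≤ 2`.
  set ε := min (min m ((1 - κ₀) / 2)) 1 with hε
  have hε0 : 0 < ε := lt_min (lt_min hm0 (by linarith)) one_pos
  have hεm : ε ≤ m := (min_le_left _ _).trans (min_le_left _ _)
  have hεκ : ε ≤ (1 - κ₀) / 2 := (min_le_left _ _).trans (min_le_right _ _)
  have hε1 : ε ≤ 1 := min_le_right _ _
  set A₀ := (1 - κ) / (2 * n) with hA₀
  have hA₀0 : 0 < A₀ := div_pos (by linarith) (by positivity)
  set Q₀ := Real.sqrt ((peakEnergy φ ψ C s + 1) * form n V η η' η η') with hQ₀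
  refine ⟨Q₀ / A₀, by positivity, ?_⟩
  filter_upwards [h.eventually_close_outer hε0, h.eventually_energy_le one_pos,
    eventually_ge_atTop 1] with p hclose hen hp
  intro w d hw hws
  have hcl := hclose w d hw hws
  -- Near the pole `η = 1` and `w ^ p ≥ w ^ (p + 1) / 2` because `w ≤ 2`. Elsewhere `|w| ≤ κ` makes
  -- the left side nonpositive.
  have hpt : ∀ r ∈ Ioc (0 : ℝ) 1,
      (|w r| ^ (p + 1) - κ ^ (p + 1)) / 2 ≤ sgnPow p (w r) * η r := by
    intro r hr
    have hsmall : |w r| ≤ κ → 0 ≤ sgnPow p (w r) * η r →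
        (|w r| ^ (p + 1) - κ ^ (p + 1)) / 2 ≤ sgnPow p (w r) * η r := fun h1 h2 => by
      have := Real.rpow_le_rpow (abs_nonneg _) h1 (by linarith : 0 ≤ p + 1)
      linarith
    by_cases hrc : r ∈ conSet R b
    · exact hsmall ((hw.bound r hrc).trans (le_max_left _ _)) (by rw [hηc r hrc, mul_zero])
    have hr' : r ∈ Icc R 1 := by
      have h1 : ¬ (r < R ∨ b ≤ r) := fun h' => hrc ⟨hr, h'⟩
      push Not at h1
      exact ⟨h1.1, hr.2⟩
    have h1 := abs_le.1 (hcl r hr')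
    have h2 := hm r hr'
    have hw0 : 0 ≤ w r := by linarith
    have h3 : sgnPow p (w r) = w r ^ p := sgnPow_of_nonneg hp hw0
    have h4 := h.pair.peak_le_one h.mem (r := r) ⟨hr.1.le, hr.2⟩
    by_cases hrs : |r - s| < ρ
    · rw [hη1 r hrs, mul_one, h3, abs_of_nonneg hw0,
        Real.rpow_add_of_nonneg hw0 (by linarith) zero_le_one, Real.rpow_one]
      have h5 : 0 ≤ w r ^ p := by positivity
      have h6 : 0 ≤ κ ^ (p + 1) := by positivity
      have h7 : w r ≤ 2 := by linarith
      nlinarith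
    · refine hsmall ?_ (mul_nonneg (by rw [h3]; positivity) (hη0 r))
      rw [abs_of_nonneg hw0]
      refine le_trans ?_ (le_max_right _ _)
      have := hκ₀ r hr' (not_lt.1 hrs)
      linarith
  set A := ∫ r, sgnPow p (w r) * η r ∂(wt n) with hA
  have hiA := integrable_sgnPow_mul hp hw.rad hη
  have hip := integrable_rpow hw.rad (q := p + 1) (by linarith)
  -- Integrate the pointwise bound, using mass at least 1 and `κ ^ (p + 1) ≤ κ`. The lower bound
  -- does not depend on `p`, so neither does the bound on the multiplier.
  have hAA : A₀ ≤ A := by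
    have h1 : ∫ r, (|w r| ^ (p + 1) - κ ^ (p + 1)) / 2 ∂(wt n) ≤ A :=
      integral_mono_ae ((hip.sub (integrable_const _)).div_const 2) hiA (ae_wt_of_forall hpt)
    rw [integral_div, integral_sub hip (integrable_const _), integral_wt_const h.one_le] at h1
    refine le_trans ?_ h1
    have h2 : κ ^ (p + 1) ≤ κ := by
      have := Real.rpow_le_rpow_of_exponent_ge hκ0 hκ1.le (by linarith : (1 : ℝ) ≤ p + 1)
      rwa [Real.rpow_one] at this
    have h3 := hw.mass
    have h4 : 1 / n ≤ ∫ r, |w r| ^ (p + 1) ∂(wt n) := by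
      rw [div_le_iff₀ hn0]; linarith
    have h5 : κ ^ (p + 1) / n ≤ κ / n := by gcongr
    have h6 : A₀ = (1 / n - κ / n) / 2 := by rw [hA₀]; field_simp
    rw [h6]
    linarith
  have hA0 : 0 < A := hA₀0.trans_le hAA
  refine ⟨form n V w d η η' / A, ?_, fun ζ ξ hζ hadm => ?_⟩
  · rw [abs_div, abs_of_pos hA0]
    have h1 : |form n V w d η η'| ≤ Q₀ := by
      refine Real.abs_le_sqrt ((form_cauchy_schwarz h.cont h.nonneg hw.rad hη).trans ?_)
      exact mul_le_mul_of_nonneg_right (hen.2 w d hw) (form_self_nonneg h.nonneg)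
    gcongr
  · set B := ∫ r, sgnPow p (w r) * ζ r ∂(wt n) with hB
    -- The corrected variation `ζ - (B / A) η` leaves the mass unchanged to first order and equals
    -- `ζ` on the constraint set.
    have hrad := hζ.add_mul hη (-(B / A))
    have hiB := integrable_sgnPow_mul hp hw.rad hζ
    have h1 := hw.first_variation h.cont hp hrad (by
      refine le_of_eq ?_
      have : ∀ r, sgnPow p (w r) * (ζ r + -(B / A) * η r) =
        sgnPow p (w r) * ζ r + -(B / A) * (sgnPow p (w r) * η r) := fun r => by ring
      simp only [this]
      rw [integral_add hiB (hiA.const_mul _), integral_const_mul, ← hA, ← hB]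
      field_simp
      ring) (by
      obtain ⟨t₀, ht₀, hadm⟩ := hadm
      refine ⟨t₀, ht₀, fun t ht ht' r hr => ?_⟩
      simp only [hηc r hr, mul_zero, add_zero]
      exact hadm t ht ht' r hr)
    rw [form_add_mul_right h.cont hζ hη hw.rad] at h1
    have h2 : form n V w d η η' / A * B = B / A * form n V w d η η' := by ring
    rw [h2]
    linarith

/-- On `(0, R]` minimizers are close to multiples of the regular solution. -/
lemma eventually_close_inner (h : Setup n V φ ψ P S C s R b c) {ε : ℝ} (hε : 0 < ε) :
    ∀ᶠ p in atTop, ∀ w d, IsFeasMin n V R b c p w d → 0 ≤ w s →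
      ∀ r ∈ Ioc (0 : ℝ) R, |w r - w R * peak φ ψ R r| ≤ ε := by
  obtain ⟨Λ, hΛ, hmul⟩ := h.eventually_multiplier
  have hpR := h.pair.peak_pos h.mem (r := R) ⟨h.R_pos.le, h.R_mem.2⟩
  -- Closeness within `ε₁` at `R` gives `0 ≤ w R ≤ c`.
  set ε₁ := min (peak φ ψ s R) (c - peak φ ψ s R) with hε₁
  have hε₁0 : 0 < ε₁ := lt_min hpR (sub_pos.2 h.inner)
  have hsmall : ∀ᶠ p : ℝ in atTop, Λ * c ^ p < ε := by
    have h1 : Tendsto (fun p : ℝ => Λ * c ^ p) atTop (𝓝 (Λ * 0)) :=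
      (tendsto_rpow_atTop_of_base_lt_one c (by linarith [h.c_pos]) h.c_lt).const_mul Λ
    rw [mul_zero] at h1
    exact h1.eventually (gt_mem_nhds hε)
  filter_upwards [hmul, h.eventually_close_outer hε₁0, hsmall, eventually_ge_atTop 1] with
    p hp hclose hδε hp1
  intro w d hw hws
  obtain ⟨l, hl, hvar⟩ := hp w d hw hws
  have hcR := abs_le.1 (hclose w d hw hws R ⟨le_rfl, h.R_mem.2⟩)
  have hwR0 : 0 ≤ w R := by linarith [min_le_left (peak φ ψ s R) (c - peak φ ψ s R)]
  have hwRc : w R ≤ c := by linarith [min_le_right (peak φ ψ s R) (c - peak φ ψ s R)]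
  -- A bound for the right-hand side of the Euler inequality on `(0, R)`, where `|w| ≤ c`. It tends
  -- to 0 because the multiplier stays bounded.
  set δ := Λ * c ^ p with hδ
  have hδ0 : 0 ≤ δ := mul_nonneg hΛ (Real.rpow_nonneg h.c_pos.le _)
  have hn1 : (1 : ℝ) ≤ n := by exact_mod_cast h.one_le
  have hpk := h.pair.rad_peak h.cont h.R_mem
  have hpk1 : ∀ r ∈ Ioc (0 : ℝ) 1, 0 < peak φ ψ R r ∧ peak φ ψ R r ≤ 1 := fun r hr =>
    ⟨h.pair.peak_pos h.R_mem ⟨hr.1.le, hr.2⟩, h.pair.peak_le_one h.R_mem ⟨hr.1.le, hr.2⟩⟩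
  have hquad : ∀ r ∈ Ioc (0 : ℝ) R, 0 ≤ δ * (R ^ 2 - r ^ 2) / (2 * n) ∧
      δ * (R ^ 2 - r ^ 2) / (2 * n) ≤ ε := fun r hr => by
    have h1 : r ^ 2 ≤ R ^ 2 := pow_le_pow_left₀ hr.1.le hr.2 2
    have h2 : R ^ 2 ≤ 1 := pow_le_one₀ h.R_pos.le h.R_mem.2
    have h3 : 0 ≤ R ^ 2 - r ^ 2 := by linarith
    refine ⟨by positivity, ?_⟩
    rw [div_le_iff₀ (by positivity)]
    nlinarith [sq_nonneg r]
  -- The two signs give the upper and the lower estimate.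
  have key : ∀ σ : ℝ, (σ = 1 ∨ σ = -1) → ∀ r ∈ Ioc (0 : ℝ) R,
      σ * (w r + -(w R) * peak φ ψ R r) ≤ δ * (R ^ 2 - r ^ 2) / (2 * n) := by
    intro σ hσ
    have hrad := hw.rad.add_mul hpk (-(w R))
    have hradσ := hrad.const_mul σ
    refine comparison h.one_le h.R_mem hradσ ?_ ?_
    · rw [h.pair.peak_self h.R_mem]; simp
    · intro ζ ξ hζ hcase
      have hζR : ζ R = 0 := by
        rcases hcase R h.R_mem with h1 | h1
        · exact h1
        · exact absurd h1.1 (lt_irrefl _)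
      have hζ0 : ∀ r ∈ Ioc (0 : ℝ) 1, 0 ≤ ζ r := fun r hr => by
        rcases hcase r hr with h1 | h1
        · exact h1.ge
        · exact h1.2.1.le
      -- Where `ζ > 0` one has `ζ ≤ σ (w - w R * peak R)`. A step of length at most 1 along `-σ ζ`
      -- moves `w` towards `w R * peak R`, which lies between 0 and `c`, so the constraint persists.
      have h1 := hvar _ _ (hζ.const_mul (-σ)) (by
        refine ⟨1, one_pos, fun t ht ht1 r hr => ?_⟩
        have hwb := abs_le.1 (hw.bound r hr)
        rcases hcase r hr.1 with h1 | ⟨hrR, hpos, heq⟩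
        · rw [h1]; simpa using hw.bound r hr
        · have hq := (hquad r ⟨hr.1.1, hrR.le⟩).1
          have hk := hpk1 r hr.1
          have ht2 : t * ζ r ≤ ζ r := mul_le_of_le_one_left hpos.le ht1
          have ht3 : 0 ≤ t * ζ r := mul_nonneg ht.le hpos.le
          have hk2 : w R * peak φ ψ R r ≤ w R := mul_le_of_le_one_right hwR0 hk.2
          have hk3 : 0 ≤ w R * peak φ ψ R r := mul_nonneg hwR0 hk.1.le
          rw [abs_le]
          rcases hσ with rfl | rfl
          · exact ⟨by nlinarith [h.c_pos], by nlinarith⟩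
          · exact ⟨by nlinarith, by nlinarith⟩)
      rw [form_const_mul_right] at h1
      have e1 : ∫ r, sgnPow p (w r) * (-σ * ζ r) ∂(wt n) =
          -σ * ∫ r, sgnPow p (w r) * ζ r ∂(wt n) := by
        rw [← integral_const_mul]
        congr 1; ext r; ring
      rw [e1] at h1
      have hiζ : Integrable ζ (wt n) := by
        obtain ⟨N, hN⟩ := hζ.bdd
        exact integrable_wt hζ.continuousOn hN
      have e2 : |∫ r, sgnPow p (w r) * ζ r ∂(wt n)| ≤ c ^ p * ∫ r, ζ r ∂(wt n) := by
        rw [← integral_const_mul, ← Real.norm_eq_abs]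
        refine norm_integral_le_of_norm_le (hiζ.const_mul _) (ae_wt_of_forall fun r hr => ?_)
        rcases hcase r hr with h2 | ⟨hrR, hpos, -⟩
        · rw [h2]; simp
        · rw [norm_mul, Real.norm_of_nonneg hpos.le]
          exact mul_le_mul_of_nonneg_right
            (abs_sgnPow_le hp1 (hw.bound r ⟨hr, Or.inl hrR⟩)) hpos.le
      have e3 : σ * form n V w d ζ ξ ≤ δ * ∫ r, ζ r ∂(wt n) := by
        have h2 : σ * form n V w d ζ ξ ≤ σ * (l * ∫ r, sgnPow p (w r) * ζ r ∂(wt n)) := by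
          linarith
        refine h2.trans ((le_abs_self _).trans ?_)
        have hσ1 : |σ| = 1 := by rcases hσ with rfl | rfl <;> simp
        rw [abs_mul, hσ1, one_mul, abs_mul, hδ, mul_assoc]
        exact mul_le_mul hl e2 (abs_nonneg _) hΛ
      -- The peak at `R` drops out because it represents evaluation at `R`, where `ζ` vanishes.
      have e4 : form n V (fun r => σ * (w r + -(w R) * peak φ ψ R r))
          (fun r => σ * (d r + -(w R) * deriv (peak φ ψ R) r)) ζ ξ = σ * form n V w d ζ ξ := by
        rw [form_const_mul_left, form_add_mul_left h.cont hw.rad hpk hζ,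
          h.pair.form_peak h.cont h.R_mem hζ, hζR]
        ring
      rw [form_eq_add h.cont hradσ hζ] at e4
      -- The zeroth-order term has a favourable sign, so it can be discarded and the comparison
      -- involves derivatives only.
      have e5 : 0 ≤ ∫ r, V r * (σ * (w r + -(w R) * peak φ ψ R r) * ζ r) ∂(wt n) := by
        refine integral_nonneg_of_ae (ae_wt_of_forall fun r hr => ?_)
        refine mul_nonneg (h.nonneg r) ?_
        rcases hcase r hr with h2 | ⟨hrR, hpos, heq⟩
        · rw [h2, mul_zero]
        · have hq := (hquad r ⟨hr.1, hrR.le⟩).1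
          exact mul_nonneg (by linarith) hpos.le
      linarith
  intro r hr
  have k1 := key 1 (Or.inl rfl) r hr
  have k2 := key (-1) (Or.inr rfl) r hr
  have k3 := (hquad r hr).2
  rw [abs_le]
  constructor <;> linarith

/-- Uniform convergence of minimizers. -/
theorem eventually_close (h : Setup n V φ ψ P S C s R b c) {ε : ℝ} (hε : 0 < ε) :
    ∀ᶠ p in atTop, ∀ w d, IsFeasMin n V R b c p w d → 0 ≤ w s →
      ∀ r ∈ Ioc (0 : ℝ) 1, |w r - peak φ ψ s r| ≤ ε := by
  filter_upwards [h.eventually_close_inner (half_pos hε), h.eventually_close_outer (half_pos hε)]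
    with p h1 h2
  intro w d hw hws r hr
  rcases le_total r R with hrR | hrR
  · have e1 := h1 w d hw hws r ⟨hr.1, hrR⟩
    have e2 := h2 w d hw hws R ⟨le_rfl, h.R_mem.2⟩
    -- Below `R` both peaks are multiples of `φ`, so the inner estimate combines with closeness at
    -- the single point `R`.
    have e3 : peak φ ψ s r = peak φ ψ s R * peak φ ψ R r := by
      rw [h.pair.peak_of_le h.mem (hrR.trans h.R_lt.le), h.pair.peak_of_le h.mem h.R_lt.le,
        h.pair.peak_of_le h.R_mem hrR]
      have := (h.pair.φ_pos' h.R_mem).ne'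
      field_simp
    have e4 := h.pair.peak_le_one h.R_mem (r := r) ⟨hr.1.le, hr.2⟩
    have e5 := h.pair.peak_pos h.R_mem (r := r) ⟨hr.1.le, hr.2⟩
    have e6 : w r - peak φ ψ s r = (w r - w R * peak φ ψ R r) +
        (w R - peak φ ψ s R) * peak φ ψ R r := by rw [e3]; ring
    rw [e6]
    refine (abs_add_le _ _).trans ?_
    rw [abs_mul, abs_of_pos e5]
    have : |w R - peak φ ψ s R| * peak φ ψ R r ≤ ε / 2 * 1 := by gcongr
    linarith
  · exact (h2 w d hw hws r ⟨hrR, hr.2⟩).trans (by linarith)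

/-- For large exponents the constraint is inactive and minimizers satisfy the Euler–Lagrange
equation. -/
theorem eventually_natural (h : Setup n V φ ψ P S C s R b c) :
    ∀ᶠ p in atTop, ∀ w d, IsFeasMin n V R b c p w d → 0 ≤ w s →
      (∀ r ∈ conSet R b, |w r| < c) ∧ 0 < form n V w d w d ∧
      n * ∫ r, |w r| ^ (p + 1) ∂(wt n) = 1 ∧
      ∀ ζ ξ, Rad n ζ ξ → form n V w d ζ ξ =
        n * form n V w d w d * ∫ r, sgnPow p (w r) * ζ r ∂(wt n) := by
  obtain ⟨Λ, hΛ, hmul⟩ := h.eventually_multiplier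
  obtain ⟨c₀, hc₀, hc₀c, hcon⟩ := h.exists_peak_bound
  filter_upwards [hmul, h.eventually_close (ε := (c - c₀) / 2) (by linarith),
    eventually_ge_atTop 1] with p hp hclose hp1
  intro w d hw hws
  obtain ⟨l, hl, hvar⟩ := hp w d hw hws
  set c' := (c + c₀) / 2 with hc'
  have hb : ∀ r ∈ conSet R b, |w r| ≤ c' := fun r hr => by
    have h1 := hclose w d hw hws r hr.1
    have h2 := hcon r hr
    have h3 := h.pair.peak_pos h.mem (r := r) ⟨hr.1.1.le, hr.1.2⟩
    have h4 : |w r| ≤ |w r - peak φ ψ s r| + |peak φ ψ s r| := by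
      have := abs_add_le (w r - peak φ ψ s r) (peak φ ψ s r)
      rwa [sub_add_cancel] at this
    rw [abs_of_pos h3] at h4
    linarith
  -- The strict gap `c' < c` makes every direction admissible, together with its opposite, and the
  -- variational inequality becomes an equation.
  have hadm : ∀ ζ ξ, Rad n ζ ξ →
      ∃ t₀ > 0, ∀ t, 0 < t → t ≤ t₀ → ∀ r ∈ conSet R b, |w r + t * ζ r| ≤ c := by
    intro ζ ξ hζ
    obtain ⟨N, hN⟩ := hζ.bdd
    have hN0 : 0 ≤ N := (abs_nonneg _).trans (hN 1 one_mem)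
    refine ⟨(c - c') / (N + 1), div_pos (by linarith) (by linarith), fun t ht ht' r hr => ?_⟩
    have h1 := hb r hr
    have h2 := hN r hr.1
    have h3 : t * (N + 1) ≤ c - c' := by rwa [le_div_iff₀ (by linarith)] at ht'
    refine (abs_add_le _ _).trans ?_
    rw [abs_mul, abs_of_pos ht]
    nlinarith
  have heq : ∀ ζ ξ, Rad n ζ ξ → form n V w d ζ ξ = l * ∫ r, sgnPow p (w r) * ζ r ∂(wt n) := by
    intro ζ ξ hζ
    refine le_antisymm ?_ (hvar ζ ξ hζ (hadm ζ ξ hζ))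
    have h1 := hvar _ _ (hζ.const_mul (-1)) (hadm _ _ (hζ.const_mul (-1)))
    rw [form_const_mul_right] at h1
    have e1 : ∫ r, sgnPow p (w r) * (-1 * ζ r) ∂(wt n) =
        -1 * ∫ r, sgnPow p (w r) * ζ r ∂(wt n) := by
      rw [← integral_const_mul]
      congr 1; ext r; ring
    rw [e1] at h1
    linarith
  have hpos : 0 < form n V w d w d := by
    obtain ⟨r, hr, -, -, hwr⟩ := h.exists_one_le_abs (by linarith) hw.toFeas
    have h1 := h.pair.peakEnergy_mul_sq_le h.cont h.nonneg hr hw.rad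
    have h2 : 1 ≤ w r ^ 2 := by
      rw [← sq_abs]; nlinarith
    have h3 := h.pair.peakEnergy_pos hr
    refine lt_of_lt_of_le ?_ h1
    positivity
  have hmass := hw.mass_eq (by linarith) hpos
  refine ⟨fun r hr => (hb r hr).trans_lt (by linarith), hpos, hmass, fun ζ ξ hζ => ?_⟩
  -- Testing with the minimizer itself identifies the multiplier, because the mass is exactly 1.
  have hself := heq w d hw.rad
  simp only [sgnPow_mul_self hp1] at hself
  have hl' : n * form n V w d w d = l := by
    rw [hself, mul_left_comm, hmass, mul_one]
  rw [hl']
  exact heq ζ ξ hζ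

end Setup

/-! ### Regularity of weak solutions -/

/-- The radial solution of the Poisson equation with right-hand side `h` and central value `a`. -/
def radialSol (n : ℕ) (h : ℝ → ℝ) (a r : ℝ) : ℝ := a + ∫ s in (0 : ℝ)..r, s * ballAvg n h s

lemma hasDerivAt_radialSol (n : ℕ) {h : ℝ → ℝ} (hh : Continuous h) (a r : ℝ) :
    HasDerivAt (radialSol n h a) (r * ballAvg n h r) r := by
  have hc : Continuous fun s => s * ballAvg n h s := continuous_id.mul (continuous_ballAvg n hh)
  exact (intervalIntegral.integral_hasDerivAt_right (hc.intervalIntegrable _ _)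
      (hc.stronglyMeasurableAtFilter _ _) hc.continuousAt).const_add a

lemma continuous_radialSol (n : ℕ) {h : ℝ → ℝ} (hh : Continuous h) (a : ℝ) :
    Continuous (radialSol n h a) :=
  continuous_iff_continuousAt.2 fun r => (hasDerivAt_radialSol n hh a r).continuousAt

/-- A weak solution of the linear equation with bounded data is a primitive of its flux and
satisfies the Neumann condition. -/
lemma flux_eq {n : ℕ} {w d h : ℝ → ℝ} {M : ℝ} (hw : Rad n w d)
    (hc : ContinuousOn h (Ioc 0 1)) (hb : ∀ r ∈ Ioc (0 : ℝ) 1, |h r| ≤ M)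
    (hweak : ∀ ζ ξ, Rad n ζ ξ → ∫ r, d r * ξ r ∂(wt n) + ∫ r, h r * ζ r ∂(wt n) = 0) :
    (∫ s in (0 : ℝ)..1, s ^ (n - 1) * h s) = 0 ∧
    ∀ᵐ t ∂(wt n), d t = (∫ s in (0 : ℝ)..t, s ^ (n - 1) * h s) / t ^ (n - 1) := by
  set H : ℝ → ℝ := fun t => ∫ s in (0 : ℝ)..t, s ^ (n - 1) * h s with hH
  have hM : 0 ≤ M := (abs_nonneg _).trans (hb 1 one_mem)
  have hIBP := fun (ζ ξ : ℝ → ℝ) (hζ : Rad n ζ ξ) =>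
    weighted_integration_by_parts hc hb hζ.memLp hζ.eq
  -- The constant test function yields the natural boundary condition.
  have hH1 : H 1 = 0 := by
    have h1 := hweak _ _ (Rad.const n 1)
    rw [(hIBP _ _ (Rad.const n 1)).2.2] at h1
    simpa using h1
  have hai : IntegrableOn (fun s => s ^ (n - 1) * h s) (Ioc 0 1) :=
    integrable_wt_iff.1 (integrable_wt hc hb)
  have hHc : ContinuousOn H (Ioc 0 1) := by
    have := intervalIntegral.continuousOn_primitive_interval' (a := 0) (b₁ := 0) (b₂ := 1)
      ((intervalIntegrable_iff_integrableOn_Ioc_of_le zero_le_one).2 hai) left_mem_uIcc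
    rw [uIcc_of_le zero_le_one] at this
    exact this.mono Ioc_subset_Icc_self
  have hKc : ContinuousOn (fun t => H t / t ^ (n - 1)) (Ioc 0 1) :=
    hHc.div (continuous_pow (n - 1)).continuousOn fun t ht => (pow_pos ht.1 _).ne'
  have hKb : ∀ t ∈ Ioc (0 : ℝ) 1, |H t / t ^ (n - 1)| ≤ M := by
    intro t ht
    have htn : 0 < t ^ (n - 1) := pow_pos ht.1 _
    rw [abs_div, abs_of_pos htn, div_le_iff₀ htn]
    have := intervalIntegral.norm_integral_le_of_norm_le_const (a := 0) (b := t)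
      (C := M * t ^ (n - 1)) (f := fun s => s ^ (n - 1) * h s) (by
        intro x hx
        rw [uIoc_of_le ht.1.le] at hx
        rw [norm_mul, norm_pow, Real.norm_of_nonneg hx.1.le, mul_comm]
        have h1 := hb x ⟨hx.1, hx.2.trans ht.2⟩
        have h2 := hx.1.le
        have h3 := hx.2
        rw [← Real.norm_eq_abs] at h1
        gcongr)
    rw [sub_zero, abs_of_pos ht.1, Real.norm_eq_abs] at this
    exact this.trans (mul_le_of_le_one_right (by positivity) ht.2)
  have hKL : MemLp (fun t => H t / t ^ (n - 1)) 2 (wt n) := memLp_wt 2 hKc hKb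
  set D : ℝ → ℝ := fun t => d t - H t / t ^ (n - 1) with hD
  have hDL : MemLp D 2 (wt n) := hw.memLp.sub hKL
  -- The test function is a primitive of the defect `D` cut off below `δ`. The cutoff keeps this
  -- primitive bounded, as `Rad` demands.
  have hz : ∀ δ ∈ Ioc (0 : ℝ) 1, ∀ᵐ t ∂(wt n), t ∈ Ioc δ 1 → D t = 0 := by
    intro δ hδ
    set ξ := (Ioc δ 1).indicator D with hξ
    have hξL : MemLp ξ 2 (wt n) := hDL.indicator measurableSet_Ioc
    have hDi : IntegrableOn D (Ioc δ 1) :=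
      (memLp_restrict_of_wt hδ.1 hDL).integrable one_le_two
    have hζ : Rad n (fun r => - ∫ t in r..1, ξ t) ξ := by
      refine ⟨hξL, fun r hr => by simp, ∫ t in Ioc δ 1, ‖D t‖, fun r hr => ?_⟩
      rw [abs_neg, intervalIntegral.integral_of_le hr.2, hξ,
        setIntegral_indicator measurableSet_Ioc, ← Real.norm_eq_abs]
      refine (norm_integral_le_integral_norm _).trans ?_
      exact setIntegral_mono_set hDi.norm (Eventually.of_forall fun _ => norm_nonneg _)
        (Eventually.of_forall inter_subset_right)
    obtain ⟨i1, i2, ibp⟩ := hIBP _ _ hζ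
    have h1 := hweak _ _ hζ
    rw [ibp, show (∫ s in (0 : ℝ)..1, s ^ (n - 1) * h s) = _ from hH1, mul_zero, zero_sub,
      ← sub_eq_add_neg] at h1
    have i0 : Integrable (fun r => d r * ξ r) (wt n) := hw.memLp.integrable_mul hξL
    rw [← integral_sub i0 i1] at h1
    have e1 : (fun r => d r * ξ r - ξ r * (H r / r ^ (n - 1))) = fun r => ξ r * ξ r := by
      ext r
      by_cases hr : r ∈ Ioc δ 1
      · rw [hξ, indicator_of_mem hr]; simp only [hD]; ring
      · rw [hξ, indicator_of_notMem hr]; ring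
    rw [e1, integral_eq_zero_iff_of_nonneg (fun r => mul_self_nonneg _)
      (hξL.integrable_mul hξL)] at h1
    filter_upwards [h1] with t ht htm
    have := mul_self_eq_zero.1 ht
    rwa [hξ, indicator_of_mem htm] at this
  refine ⟨hH1, ?_⟩
  have hall : ∀ᵐ t ∂(wt n), ∀ k : ℕ, t ∈ Ioc (1 / ((k : ℝ) + 1)) 1 → D t = 0 := by
    rw [ae_all_iff]
    intro k
    refine hz _ ⟨by positivity, ?_⟩
    rw [div_le_one (by positivity)]
    have : (0 : ℝ) ≤ k := k.cast_nonneg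
    linarith
  filter_upwards [hall, ae_wt_of_forall (p := fun t => t ∈ Ioc (0 : ℝ) 1) fun r hr => hr] with
    t ht htm
  obtain ⟨k, hk⟩ := exists_nat_one_div_lt htm.1
  exact sub_eq_zero.1 (ht k ⟨hk, htm.2⟩)

lemma Rad.lipschitzOnWith {n : ℕ} {u d : ℝ → ℝ} {M : NNReal} (hu : Rad n u d)
    (hb : ∀ᵐ t ∂(wt n), |d t| ≤ M) : LipschitzOnWith M u (Ioc 0 1) := by
  refine LipschitzOnWith.of_dist_le_mul fun r hr s hs => ?_
  rw [dist_comm, Real.dist_eq, hu.sub_eq hr hs, Real.dist_eq, abs_sub_comm, ← Real.norm_eq_abs]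
  refine intervalIntegral.norm_integral_le_of_norm_le_const_ae ?_
  have h1 := (ae_restrict_iff' measurableSet_Ioc).1 (ae_wt_iff.1 hb)
  filter_upwards [h1] with t ht htm
  refine ht ⟨(lt_min hr.1 hs.1).trans htm.1, htm.2.trans (max_le hr.2 hs.2)⟩

/-- Weak solutions of the semilinear equation are given by `radialSol`. -/
theorem exists_radialSol {n : ℕ} (hn : 1 ≤ n) {V : ℝ → ℝ} (hV : Continuous V) {p l : ℝ}
    (hp : 1 ≤ p) {w d : ℝ → ℝ} (hw : Rad n w d)
    (hEL : ∀ ζ ξ, Rad n ζ ξ → form n V w d ζ ξ = l * ∫ r, sgnPow p (w r) * ζ r ∂(wt n)) :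
    ∃ (h : ℝ → ℝ) (a : ℝ), Continuous h ∧ (∀ r ∈ Ioc (0 : ℝ) 1, radialSol n h a r = w r) ∧
      (∀ r ∈ Icc (0 : ℝ) 1, h r = V r * radialSol n h a r - l * sgnPow p (radialSol n h a r)) ∧
      ballAvg n h 1 = 0 ∧ ∀ᵐ t ∂(wt n), d t = t * ballAvg n h t := by
  set k : ℝ → ℝ := fun r => V r * w r - l * sgnPow p (w r) with hk
  have hkc : ContinuousOn k (Ioc 0 1) := (hV.continuousOn.mul hw.continuousOn).sub
    (continuousOn_const.mul ((continuous_sgnPow hp).comp_continuousOn hw.continuousOn))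
  obtain ⟨B, hB⟩ := hw.bdd
  obtain ⟨A, hA⟩ := (isCompact_Icc (a := (0 : ℝ)) (b := 1)).exists_bound_of_continuousOn
    hV.continuousOn
  have hkb : ∀ r ∈ Ioc (0 : ℝ) 1, |k r| ≤ A * B + |l| * B ^ p := fun r hr => by
    refine (abs_sub _ _).trans ?_
    rw [abs_mul, abs_mul]
    have h1 := hA r ⟨hr.1.le, hr.2⟩
    have h2 := hB r hr
    have h3 := abs_sgnPow_le hp h2
    rw [Real.norm_eq_abs] at h1
    have h4 : 0 ≤ A := (abs_nonneg _).trans h1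
    gcongr
  obtain ⟨hH1, hd⟩ := flux_eq hw hkc hkb fun ζ ξ hζ => by
    have h1 := hEL ζ ξ hζ
    rw [form_eq_add hV hw hζ] at h1
    have e1 : ∫ r, k r * ζ r ∂(wt n) = ∫ r, V r * (w r * ζ r) ∂(wt n) -
        l * ∫ r, sgnPow p (w r) * ζ r ∂(wt n) := by
      rw [← integral_const_mul, ← integral_sub (Rad.integrable_coef_mul hV hw hζ)
        ((integrable_sgnPow_mul hp hw hζ).const_mul l)]
      congr 1; ext r; simp only [hk]; ring
    rw [e1]
    linarith
  set M := A * B + |l| * B ^ p with hM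
  have hM0 : 0 ≤ M := (abs_nonneg _).trans (hkb 1 one_mem)
  -- The flux formula bounds the derivative, so `w` is Lipschitz and extends continuously through
  -- the origin. This makes the right-hand side continuous on the line.
  have hlip : LipschitzOnWith (Real.toNNReal M) w (Ioc 0 1) := by
    refine hw.lipschitzOnWith ?_
    filter_upwards [hd, ae_wt_of_forall (p := fun t => t ∈ Ioc (0 : ℝ) 1) fun r hr => hr] with
      t ht htm
    rw [ht, Real.coe_toNNReal _ hM0]
    have htn : 0 < t ^ (n - 1) := pow_pos htm.1 _
    rw [abs_div, abs_of_pos htn, div_le_iff₀ htn]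
    have := intervalIntegral.norm_integral_le_of_norm_le_const (a := 0) (b := t)
      (C := M * t ^ (n - 1)) (f := fun s => s ^ (n - 1) * k s) (by
        intro x hx
        rw [uIoc_of_le htm.1.le] at hx
        rw [norm_mul, norm_pow, Real.norm_of_nonneg hx.1.le, mul_comm]
        have h1 := hkb x ⟨hx.1, hx.2.trans htm.2⟩
        have h2 := hx.1.le
        have h3 := hx.2
        rw [← Real.norm_eq_abs] at h1
        gcongr)
    rw [sub_zero, abs_of_pos htm.1, Real.norm_eq_abs] at this
    exact this.trans (mul_le_of_le_one_right (by positivity) htm.2)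
  obtain ⟨w', hw'l, hw'⟩ := hlip.extend_real
  have hw'c : Continuous w' := hw'l.continuous
  set h : ℝ → ℝ := fun r => V r * w' r - l * sgnPow p (w' r) with hh
  have hhc : Continuous h :=
    (hV.mul hw'c).sub (continuous_const.mul ((continuous_sgnPow hp).comp hw'c))
  have hhk : ∀ r ∈ Ioc (0 : ℝ) 1, h r = k r := fun r hr => by
    simp only [hh, hk, hw' hr]
  have hHeq : ∀ t ∈ Ioc (0 : ℝ) 1, (∫ s in (0 : ℝ)..t, s ^ (n - 1) * k s) =
      t ^ n * ballAvg n h t := fun t ht => by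
    rw [pow_mul_ballAvg hn]
    refine intervalIntegral.integral_congr_ae (Eventually.of_forall fun x hx => ?_)
    rw [uIoc_of_le ht.1.le] at hx
    rw [hhk x ⟨hx.1, hx.2.trans ht.2⟩]
  have hd' : ∀ᵐ t ∂(wt n), d t = t * ballAvg n h t := by
    filter_upwards [hd, ae_wt_of_forall (p := fun t => t ∈ Ioc (0 : ℝ) 1) fun r hr => hr] with
      t ht htm
    rw [ht, hHeq t htm]
    have := htm.1.ne'
    obtain ⟨m, rfl⟩ := Nat.exists_eq_add_of_le' hn
    simp only [Nat.add_sub_cancel]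
    field_simp
    ring
  have hder := hasDerivAt_radialSol n hhc (w' 0)
  have hWc := continuous_radialSol n hhc (w' 0)
  have hc : Continuous fun s => s * ballAvg n h s := continuous_id.mul (continuous_ballAvg n hhc)
  have hdiff : ∀ r ∈ Ioc (0 : ℝ) 1, radialSol n h (w' 0) r - w' r =
      radialSol n h (w' 0) 1 - w' 1 := fun r hr => by
    have h1 : ∫ t in r..1, t * ballAvg n h t = radialSol n h (w' 0) 1 - radialSol n h (w' 0) r :=
      intervalIntegral.integral_eq_sub_of_hasDerivAt (fun t _ => hder t)
        (hc.intervalIntegrable _ _)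
    have h2 : ∫ t in r..1, d t = ∫ t in r..1, t * ballAvg n h t := by
      refine intervalIntegral.integral_congr_ae ?_
      have := (ae_restrict_iff' measurableSet_Ioc).1 (ae_wt_iff.1 hd')
      filter_upwards [this] with t ht htm
      rw [uIoc_of_le hr.2] at htm
      exact ht ⟨hr.1.trans htm.1, htm.2⟩
    have h3 := hw.eq r hr
    rw [h2, h1, hw' hr, hw' one_mem] at h3
    linarith
  -- The two functions have the same derivative almost everywhere, and the constant is read off at
  -- the origin, where both equal `w' 0`.
  have hconst : radialSol n h (w' 0) 1 - w' 1 = 0 := by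
    have h1 : Tendsto (fun r => radialSol n h (w' 0) r - w' r) (𝓝[>] 0)
        (𝓝 (radialSol n h (w' 0) 0 - w' 0)) :=
      ((hWc.sub hw'c).tendsto 0).mono_left nhdsWithin_le_nhds
    have h2 : Tendsto (fun r => radialSol n h (w' 0) r - w' r) (𝓝[>] 0)
        (𝓝 (radialSol n h (w' 0) 1 - w' 1)) := by
      refine tendsto_const_nhds.congr' ?_
      filter_upwards [Ioc_mem_nhdsGT zero_lt_one] with r hr using (hdiff r hr).symm
    rw [tendsto_nhds_unique h2 h1]
    simp [radialSol]
  have hWw : ∀ r ∈ Icc (0 : ℝ) 1, radialSol n h (w' 0) r = w' r := fun r hr => by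
    rcases hr.1.eq_or_lt with rfl | h0
    · simp [radialSol]
    · have := hdiff r ⟨h0, hr.2⟩
      rw [hconst] at this
      linarith
  refine ⟨h, w' 0, hhc, fun r hr => ?_, fun r hr => ?_, ?_, hd'⟩
  · rw [hWw r ⟨hr.1.le, hr.2⟩, hw' hr]
  · rw [hWw r hr]
  · have := hHeq 1 one_mem
    rw [hH1] at this
    simpa using this.symm

/-! ### Radial functions of class `C²` -/

section Radial

set_option maxSynthPendingDepth 3

variable {X : Type*} [NormedAddCommGroup X] [InnerProductSpace ℝ X] {n : ℕ} {h : ℝ → ℝ}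

/-- The inner product of a real inner product space as a bilinear map. -/
def dotL (X : Type*) [NormedAddCommGroup X] [InnerProductSpace ℝ X] : X →L[ℝ] X →L[ℝ] ℝ :=
  innerSL ℝ

/-- The bilinear map `(y, z) ↦ ⟪x, y⟫ ⟪x, z⟫`. -/
def dotSqL {X : Type*} [NormedAddCommGroup X] [InnerProductSpace ℝ X] (x : X) :
    X →L[ℝ] X →L[ℝ] ℝ :=
  (dotL X x).smulRight (dotL X x)

lemma norm_dotSqL (x : X) : ‖dotSqL x‖ = ‖x‖ ^ 2 := by
  rw [dotSqL, ContinuousLinearMap.norm_smulRight_apply, dotL, innerSL_apply_norm, sq]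

lemma continuous_dotSqL : Continuous (dotSqL : X → X →L[ℝ] X →L[ℝ] ℝ) := by
  have h : Continuous (dotL X) := (dotL X).continuous
  exact (ContinuousLinearMap.smulRightL ℝ X (X →L[ℝ] ℝ)).continuous₂.comp (h.prodMk h)

/-- The second derivative of a radial solution of the Poisson equation. -/
def radialHess (X : Type*) [NormedAddCommGroup X] [InnerProductSpace ℝ X] (n : ℕ) (h : ℝ → ℝ)
    (x : X) : X →L[ℝ] X →L[ℝ] ℝ :=
  ballAvg n h ‖x‖ • dotL X +
    ((h ‖x‖ - n * ballAvg n h ‖x‖) / ‖x‖ ^ 2) • dotSqL x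

lemma radialHess_apply (x y z : X) : radialHess X n h x y z = ballAvg n h ‖x‖ * inner ℝ y z +
    (h ‖x‖ - n * ballAvg n h ‖x‖) / ‖x‖ ^ 2 * (inner ℝ x y * inner ℝ x z) := rfl

lemma hasFDerivAt_norm_of_ne {x : X} (hx : x ≠ 0) :
    HasFDerivAt (fun x : X => ‖x‖) (‖x‖⁻¹ • innerSL ℝ x) x := by
  have h1 := (hasStrictFDerivAt_norm_sq x).hasFDerivAt.sqrt (by simpa using hx)
  simp only [Real.sqrt_sq (norm_nonneg _)] at h1
  refine h1.congr_fderiv ?_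
  ext y
  have : ‖x‖ ≠ 0 := norm_ne_zero_iff.2 hx
  simp
  field_simp

/-- The radial derivative `r * ballAvg n h r` carries a factor `r`, so the gradient is `ballAvg n h
‖x‖` times `x`, with no singularity at 0. -/
lemma hasFDerivAt_radialSol (hh : Continuous h) (a : ℝ) (x : X) :
    HasFDerivAt (fun x : X => radialSol n h a ‖x‖) (ballAvg n h ‖x‖ • innerSL ℝ x) x := by
  by_cases hx : x = 0
  · subst hx
    have h1 := hasDerivAt_radialSol n hh a 0
    rw [zero_mul, hasDerivAt_iff_isLittleO_nhds_zero] at h1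
    rw [hasFDerivAt_iff_isLittleO_nhds_zero]
    have h2 : Tendsto (fun x : X => ‖x‖) (𝓝 0) (𝓝 0) := by
      simpa using (continuous_norm.tendsto (0 : X))
    have h3 := h1.comp_tendsto h2
    refine Asymptotics.IsLittleO.of_norm_right ?_
    simpa [Function.comp_def] using h3
  · have h1 := (hasDerivAt_radialSol n hh a ‖x‖).comp_hasFDerivAt x (hasFDerivAt_norm_of_ne hx)
    refine h1.congr_fderiv ?_
    have : ‖x‖ ≠ 0 := norm_ne_zero_iff.2 hx
    rw [smul_smul]
    congr 1
    field_simp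

/-- At the origin only continuity of the average is needed: its increment is `o(1)` and multiplies a
linear term. -/
lemma hasFDerivAt_radialGrad (hn : 1 ≤ n) (hh : Continuous h) (x : X) :
    HasFDerivAt (fun x : X => ballAvg n h ‖x‖ • innerSL ℝ x) (radialHess X n h x) x := by
  have hKc := continuous_ballAvg n hh
  by_cases hx : x = 0
  · subst hx
    rw [hasFDerivAt_iff_isLittleO_nhds_zero]
    have h1 : (fun y : X => ballAvg n h ‖0 + y‖ • innerSL ℝ (0 + y) -
        ballAvg n h ‖(0 : X)‖ • innerSL ℝ (0 : X) - radialHess X n h 0 y) =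
        fun y => (ballAvg n h ‖y‖ - ballAvg n h 0) • innerSL ℝ y := by
      ext y z
      simp [radialHess_apply]
      ring
    rw [h1]
    have h2 : (fun y : X => ballAvg n h ‖y‖ - ballAvg n h 0) =o[𝓝 0] (fun _ => (1 : ℝ)) := by
      rw [Asymptotics.isLittleO_one_iff]
      have := ((hKc.comp continuous_norm).tendsto (0 : X)).sub_const (ballAvg n h 0)
      simpa using this
    have h3 : (fun y : X => innerSL ℝ y) =O[𝓝 0] (fun y => y) :=
      (dotL X).isBigO_id _
    have := h2.smul_isBigO h3
    refine this.trans_isBigO ?_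
    simp only [one_smul]
    exact Asymptotics.isBigO_refl _ _
  · have hx0 : ‖x‖ ≠ 0 := norm_ne_zero_iff.2 hx
    have h1 := (hasDerivAt_ballAvg hn hh hx0).comp_hasFDerivAt x (hasFDerivAt_norm_of_ne hx)
    have h2 := h1.smul (dotL X).hasFDerivAt
    refine h2.congr_fderiv ?_
    ext y z
    change ballAvg n h ‖x‖ * inner ℝ y z +
      (h ‖x‖ - n * ballAvg n h ‖x‖) / ‖x‖ * (‖x‖⁻¹ * inner ℝ x y) * inner ℝ x z = _
    rw [radialHess_apply]
    field_simp

/-- At the origin `‖x‖ ^ 2` in the denominator is cancelled by the norm of `dotSqL x`, and the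
remaining factor `h - n * ballAvg` tends to 0. -/
lemma continuous_radialHess (hn : 1 ≤ n) (hh : Continuous h) :
    Continuous (radialHess X n h) := by
  have hKc := continuous_ballAvg n hh
  rw [continuous_iff_continuousAt]
  intro x
  have hA : Continuous fun x : X => ballAvg n h ‖x‖ • dotL X :=
    (hKc.comp continuous_norm).smul continuous_const
  have hB : ContinuousAt (fun x : X =>
      ((h ‖x‖ - n * ballAvg n h ‖x‖) / ‖x‖ ^ 2) • dotSqL x) x := by
    have hq : Continuous fun y : X => h ‖y‖ - n * ballAvg n h ‖y‖ := by
      have := hKc.comp (continuous_norm (E := X))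
      simp only [Function.comp_def] at this
      fun_prop
    by_cases hx : x = 0
    · subst hx
      have hlim : Tendsto (fun y : X => |h ‖y‖ - n * ballAvg n h ‖y‖|) (𝓝 0) (𝓝 0) := by
        have := hq.abs.tendsto 0
        simpa [ballAvg_zero_arg hn] using this
      have h0 : ((h ‖(0 : X)‖ - n * ballAvg n h ‖(0 : X)‖) / ‖(0 : X)‖ ^ 2) •
          dotSqL (0 : X) = 0 := by
        rw [norm_zero]; simp [dotSqL]
      rw [ContinuousAt, h0]
      refine squeeze_zero_norm (fun y => ?_) hlim
      rw [norm_smul, norm_dotSqL, norm_div, norm_pow, norm_norm, Real.norm_eq_abs]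
      rw [div_mul_eq_mul_div]
      exact div_le_of_le_mul₀ (sq_nonneg _) (abs_nonneg _) le_rfl
    · have hx0 : ‖x‖ ^ 2 ≠ 0 := pow_ne_zero 2 (norm_ne_zero_iff.2 hx)
      have h1 : ContinuousAt (fun y : X => (h ‖y‖ - n * ballAvg n h ‖y‖) / ‖y‖ ^ 2) x :=
        hq.continuousAt.div (by fun_prop) hx0
      exact h1.smul continuous_dotSqL.continuousAt
  exact hA.continuousAt.add hB

theorem contDiff_radialSol (hn : 1 ≤ n) (hh : Continuous h) (a : ℝ) :
    ContDiff ℝ 2 (fun x : X => radialSol n h a ‖x‖) := by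
  have h1 : fderiv ℝ (fun x : X => radialSol n h a ‖x‖) =
      fun x => ballAvg n h ‖x‖ • innerSL ℝ x :=
    funext fun x => (hasFDerivAt_radialSol hh a x).fderiv
  have h2 : fderiv ℝ (fun x : X => ballAvg n h ‖x‖ • innerSL ℝ x) = radialHess X n h :=
    funext fun x => (hasFDerivAt_radialGrad hn hh x).fderiv
  rw [show (2 : WithTop ℕ∞) = 1 + 1 by norm_num, contDiff_succ_iff_fderiv]
  refine ⟨fun x => (hasFDerivAt_radialSol hh a x).differentiableAt, by simp, ?_⟩
  rw [h1, contDiff_one_iff_fderiv]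
  refine ⟨fun x => (hasFDerivAt_radialGrad hn hh x).differentiableAt, ?_⟩
  rw [h2]
  exact continuous_radialHess hn hh

/-- The trace of the Hessian is `n * ballAvg + (h - n * ballAvg)`. At 0 the second term is absent,
but it is zero by `ballAvg_zero_arg`. -/
theorem laplacian_radialSol (hn : 1 ≤ n) (hh : Continuous h) (a : ℝ) (x : E n) :
    Laplacian.laplacian (fun x : E n => radialSol n h a ‖x‖) x = h ‖x‖ := by
  have h1 : fderiv ℝ (fun x : E n => radialSol n h a ‖x‖) =
      fun x => ballAvg n h ‖x‖ • innerSL ℝ x :=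
    funext fun x => (hasFDerivAt_radialSol hh a x).fderiv
  have h2 : fderiv ℝ (fun x : E n => ballAvg n h ‖x‖ • innerSL ℝ x) x = radialHess (E n) n h x :=
    (hasFDerivAt_radialGrad hn hh x).fderiv
  rw [InnerProductSpace.laplacian_eq_iteratedFDeriv_orthonormalBasis _
    (EuclideanSpace.basisFun (Fin n) ℝ)]
  simp only [iteratedFDeriv_two_apply, h1, h2, Matrix.cons_val_zero, Matrix.cons_val_one,
    radialHess_apply]
  have e1 : ∀ i : Fin n, inner ℝ (EuclideanSpace.basisFun (Fin n) ℝ i)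
      (EuclideanSpace.basisFun (Fin n) ℝ i) = (1 : ℝ) := fun i => by simp
  have e2 : ∀ i : Fin n, inner ℝ x (EuclideanSpace.basisFun (Fin n) ℝ i) = x i := fun i => by
    rw [EuclideanSpace.basisFun_apply, EuclideanSpace.inner_single_right]; simp
  simp only [e1, e2]
  rw [Finset.sum_add_distrib, ← Finset.mul_sum]
  have e3 : ∑ i, x i * x i = ‖x‖ ^ 2 := by
    rw [EuclideanSpace.real_norm_sq_eq]
    exact Finset.sum_congr rfl fun i _ => (sq _).symm
  rw [← Finset.mul_sum, e3]
  simp only [Finset.sum_const, Finset.card_univ, Fintype.card_fin, nsmul_eq_mul]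
  by_cases hx : ‖x‖ = 0
  · rw [hx]
    have := ballAvg_zero_arg hn h
    simp
    linarith
  · field_simp
    ring

end Radial

/-! ### Polar coordinates -/

instance (n : ℕ) : IsFiniteMeasure (volB n) :=
  ⟨by rw [volB, Measure.restrict_apply_univ]; exact measure_ball_lt_top⟩

lemma integral_volB_of_eq_zero {n : ℕ} {f : E n → ℝ} (hf : ∀ x ∉ B n, f x = 0) :
    ∫ x, f x ∂(volB n) = ∫ x, f x :=
  setIntegral_eq_integral_of_forall_compl_eq_zero hf

lemma sphereArea_eq (n : ℕ) : sphereArea n = n * (volume (B n)).toReal := by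
  rw [sphereArea, Measure.toSphere_apply_univ]
  simp [B]

lemma volume_B_pos (n : ℕ) : 0 < (volume (B n)).toReal :=
  ENNReal.toReal_pos (Metric.measure_ball_pos _ _ one_pos).ne' measure_ball_lt_top.ne

lemma sphereArea_pos {n : ℕ} (hn : 1 ≤ n) : 0 < sphereArea n := by
  rw [sphereArea_eq]
  have : (0 : ℝ) < n := by exact_mod_cast hn
  exact mul_pos this (volume_B_pos n)

lemma integral_volB_norm {n : ℕ} (hn : 1 ≤ n) (f : ℝ → ℝ) :
    ∫ x, f ‖x‖ ∂(volB n) = sphereArea n * ∫ r, f r ∂(wt n) := by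
  have : Nonempty (Fin n) := ⟨⟨0, hn⟩⟩
  have h := integral_fun_norm_addHaar (volume : Measure (E n)) ((Iio (1 : ℝ)).indicator f)
  have h1 : ∫ x, f ‖x‖ ∂(volB n) = ∫ x : E n, (Iio (1 : ℝ)).indicator f ‖x‖ := by
    rw [volB, B, ← integral_indicator measurableSet_ball]
    refine integral_congr_ae (Eventually.of_forall fun x => ?_)
    simp [indicator]
  rw [h1, h, sphereArea_eq, integral_wt', finrank_euclideanSpace, Fintype.card_fin, nsmul_eq_mul,
    smul_eq_mul, ← mul_assoc, integral_Ioc_eq_integral_Ioo]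
  congr 1
  have h2 : (fun y : ℝ => y ^ (n - 1) • (Iio (1 : ℝ)).indicator f y) =
      (Iio (1 : ℝ)).indicator fun y => y ^ (n - 1) * f y := by
    ext y
    by_cases hy : y ∈ Iio (1 : ℝ) <;> simp [hy]
  rw [h2, setIntegral_indicator measurableSet_Iio, Ioi_inter_Iio]

/-- Polar coordinates as a measure-preserving map, through which almost-everywhere statements and
`L^p` membership pass between the ball and the interval. -/
lemma measurePreserving_norm {n : ℕ} (hn : 1 ≤ n) :
    MeasurePreserving (fun x : E n => ‖x‖) (volB n)
      (ENNReal.ofReal (sphereArea n) • wt n) := by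
  refine ⟨measurable_norm, Measure.ext fun s hs => ?_⟩
  rw [Measure.map_apply measurable_norm hs, Measure.smul_apply, smul_eq_mul]
  have h := integral_volB_norm hn (s.indicator 1)
  have h1 : (fun x : E n => s.indicator (1 : ℝ → ℝ) ‖x‖) =
      ((fun x : E n => ‖x‖) ⁻¹' s).indicator 1 := by
    rfl
  rw [h1, integral_indicator_one (measurable_norm hs), integral_indicator_one hs] at h
  rw [← ENNReal.ofReal_toReal (measure_ne_top (volB n) _),
    ← ENNReal.ofReal_toReal (measure_ne_top (wt n) s),
    ← ENNReal.ofReal_mul (sphereArea_pos hn).le]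
  exact congrArg ENNReal.ofReal h

lemma ae_volB_norm {n : ℕ} (hn : 1 ≤ n) {p : ℝ → Prop} (h : ∀ᵐ r ∂(wt n), p r) :
    ∀ᵐ x ∂(volB n), p ‖x‖ :=
  (measurePreserving_norm hn).quasiMeasurePreserving.ae
    (Measure.ae_smul_measure h _)

lemma memLp_volB_norm {n : ℕ} (hn : 1 ≤ n) {f : ℝ → ℝ} {p : ℝ≥0∞} (h : MemLp f p (wt n)) :
    MemLp (fun x : E n => f ‖x‖) p (volB n) :=
  (h.smul_measure ENNReal.ofReal_ne_top).comp_measurePreserving (measurePreserving_norm hn)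

/-! ### Weak gradients of radial functions -/

lemma norm_mul_inv_smul_le {n : ℕ} (a : ℝ) (x : E n) : ‖(a * ‖x‖⁻¹) • x‖ ≤ |a| := by
  rw [norm_smul, norm_mul, Real.norm_eq_abs, norm_inv, norm_norm, mul_assoc]
  by_cases hx : ‖x‖ = 0
  · simp [hx]
  · rw [inv_mul_cancel₀ hx, mul_one]

lemma norm_mul_inv_smul {n : ℕ} (a : ℝ) {x : E n} (hx : x ≠ 0) : ‖(a * ‖x‖⁻¹) • x‖ = |a| := by
  rw [norm_smul, norm_mul, Real.norm_eq_abs, norm_inv, norm_norm, mul_assoc,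
    inv_mul_cancel₀ (norm_ne_zero_iff.2 hx), mul_one]

lemma ae_volB_pos {n : ℕ} (hn : 1 ≤ n) :
    ∀ᵐ x ∂(volB n), ‖x‖ ∈ Ioo (0 : ℝ) 1 := by
  refine ae_volB_norm hn ?_
  rw [ae_wt_iff, ← Measure.restrict_congr_set Ioo_ae_eq_Ioc]
  exact ae_restrict_mem measurableSet_Ioo

/-- Extend `u` to a Lipschitz function of the line. Its composition with the norm is Lipschitz on
the whole space, so integration by parts for Lipschitz functions applies and the origin needs no
excision. -/
theorem hasH1Grad_radial {n : ℕ} (hn : 1 ≤ n) {u d : ℝ → ℝ} {K : NNReal}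
    (hL : LipschitzOnWith K u (Ioc 0 1)) (hd : ∀ᵐ r ∂(wt n), HasDerivAt u (d r) r) :
    HasH1Grad n (fun x => u ‖x‖) (fun x => (d ‖x‖ * ‖x‖⁻¹) • x) := by
  obtain ⟨v, hv, huv⟩ := hL.extend_real
  have hdm : AEStronglyMeasurable d (wt n) :=
    (measurable_deriv u).aestronglyMeasurable.congr (hd.mono fun r hr => hr.deriv)
  have hIoo : ∀ᵐ r ∂(wt n), r ∈ Ioo (0 : ℝ) 1 := by
    rw [ae_wt_iff, ← Measure.restrict_congr_set Ioo_ae_eq_Ioc]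
    exact ae_restrict_mem measurableSet_Ioo
  have hev : ∀ r ∈ Ioo (0 : ℝ) 1, u =ᶠ[𝓝 r] v := fun r hr => by
    filter_upwards [Ioo_mem_nhds hr.1 hr.2] with t ht using huv ⟨ht.1, ht.2.le⟩
  have hdv : ∀ᵐ r ∂(wt n), HasDerivAt v (d r) r := by
    filter_upwards [hd, hIoo] with r hr hr' using hr.congr_of_eventuallyEq (hev r hr').symm
  have hdb : ∀ᵐ r ∂(wt n), ‖d r‖ ≤ K := by
    filter_upwards [hdv] with r hr using hr.le_of_lipschitz hv
  have hU : LipschitzWith (K * 1) (fun x : E n => v ‖x‖) := hv.comp lipschitzWith_one_norm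
  have hdx := ae_volB_norm hn hdv
  have hgrad : ∀ᵐ x ∂(volB n), HasFDerivAt (fun x : E n => v ‖x‖)
      (d ‖x‖ • ‖x‖⁻¹ • innerSL ℝ x) x := by
    filter_upwards [hdx, ae_volB_pos hn] with x hx hx'
    exact hx.comp_hasFDerivAt x (hasFDerivAt_norm_of_ne (norm_pos_iff.1 hx'.1))
  have huvx : ∀ᵐ x ∂(volB n), u ‖x‖ = v ‖x‖ := by
    filter_upwards [ae_volB_pos hn] with x hx using huv ⟨hx.1, hx.2.le⟩
  refine ⟨memLp_volB_norm hn ?_, ?_, fun φ hφ hφc hφs i => ?_⟩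
  · have hub : ∀ r ∈ Ioc (0 : ℝ) 1, |u r| ≤ |u 1| + K := fun r hr => by
      have h1 := hL.dist_le_mul r hr 1 one_mem
      rw [Real.dist_eq, Real.dist_eq] at h1
      have h2 : |r - 1| ≤ 1 := by rw [abs_le]; constructor <;> linarith [hr.1, hr.2]
      have h3 : (K : ℝ) * |r - 1| ≤ K := by nlinarith [K.2, K.coe_nonneg]
      have h4 := abs_sub_abs_le_abs_sub (u r) (u 1)
      linarith
    exact memLp_wt 2 hL.continuousOn hub
  · refine MemLp.of_bound (C := K) ?_ ?_
    · have h1 : AEStronglyMeasurable (fun x : E n => d ‖x‖) (volB n) :=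
        ((memLp_volB_norm hn (MemLp.of_bound (p := 2) hdm K hdb))).1
      exact (h1.mul (by fun_prop)).smul (by fun_prop)
    · filter_upwards [ae_volB_norm hn hdb] with x hx
      exact (norm_mul_inv_smul_le _ _).trans hx
  · obtain ⟨D, hD⟩ : ∃ D, LipschitzWith D φ := by
      obtain ⟨D, hD⟩ := (hφ.of_le (n := ∞) (m := 1) (by simp)).lipschitzWith_of_hasCompactSupport
        hφc one_ne_zero
      exact ⟨D, hD⟩
    have key := LipschitzWith.integral_lineDeriv_mul_eq (μ := (volume : Measure (E n))) hU hD hφc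
      (EuclideanSpace.single i 1)
    have hz : ∀ x ∉ B n, φ x = 0 := fun x hx => image_eq_zero_of_notMem_tsupport fun h => hx (hφs h)
    have hz' : ∀ x ∉ B n, fderiv ℝ φ x = 0 := fun x hx =>
      image_eq_zero_of_notMem_tsupport fun h => hx (hφs (tsupport_fderiv_subset ℝ h))
    have hld : ∀ x w, lineDeriv ℝ φ x w = fderiv ℝ φ x w := fun x w =>
      ((hφ.differentiable (by simp)) x).lineDeriv_eq_fderiv
    have e1 : ∫ x, u ‖x‖ * fderiv ℝ φ x (EuclideanSpace.single i 1) ∂(volB n) =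
        ∫ x, v ‖x‖ * fderiv ℝ φ x (EuclideanSpace.single i 1) := by
      rw [← integral_volB_of_eq_zero fun x hx => by rw [hz' x hx]; simp]
      exact integral_congr_ae (huvx.mono fun x hx => by simp only [hx])
    have e2 : ∫ x, ((d ‖x‖ * ‖x‖⁻¹) • x) i * φ x ∂(volB n) =
        ∫ x, lineDeriv ℝ (fun x : E n => v ‖x‖) x (EuclideanSpace.single i 1) * φ x := by
      rw [← integral_volB_of_eq_zero fun x hx => by rw [hz x hx]; simp]
      refine integral_congr_ae (hgrad.mono fun x hx => ?_)
      simp only [hx.differentiableAt.lineDeriv_eq_fderiv, hx.fderiv]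
      simp [EuclideanSpace.inner_single_right]
      ring_nf
      simp
    rw [e1, e2, key, ← integral_neg]
    congr 1
    ext x
    rw [hld, map_neg]
    ring

/-- Weak gradients are unique almost everywhere, by the fundamental lemma applied to each component,
so the choice in `weakGrad` is harmless. -/
lemma weakGrad_ae_eq {n : ℕ} {u : E n → ℝ} {g : E n → E n} (h : HasH1Grad n u g) :
    weakGrad n u =ᵐ[volB n] g := by
  have hm : MemH1 n u := ⟨g, h⟩
  have hw : HasH1Grad n u (weakGrad n u) := by
    rw [weakGrad, dif_pos hm]
    exact hm.choose_spec
  have hi : ∀ i : Fin n, ∀ᵐ x ∂(volB n), weakGrad n u x i - g x i = 0 := fun i => by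
    have hint : ∀ k : E n → E n, MemLp k 2 (volB n) → MemLp (fun x => k x i) 2 (volB n) :=
      fun k hk => hk.continuousLinearMap_comp (EuclideanSpace.proj i : E n →L[ℝ] ℝ)
    have h1 := (hint _ hw.2.1).integrable one_le_two
    have h2 := (hint _ h.2.1).integrable one_le_two
    rw [volB, B, ae_restrict_iff' measurableSet_ball]
    refine IsOpen.ae_eq_zero_of_integral_contDiff_smul_eq_zero Metric.isOpen_ball
      (IntegrableOn.locallyIntegrableOn (h1.sub h2)) fun φ hφ hφc hφs => ?_
    have hz : ∀ x ∉ B n, φ x = 0 := fun x hx =>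
      image_eq_zero_of_notMem_tsupport fun h => hx (hφs h)
    rw [← integral_volB_of_eq_zero fun x hx => by rw [hz x hx]; simp]
    obtain ⟨M, hM⟩ := hφ.continuous.bounded_above_of_compact_support hφc
    have h3 := h1.bdd_mul (c := M) hφ.continuous.aestronglyMeasurable (Eventually.of_forall hM)
    have h4 := h2.bdd_mul (c := M) hφ.continuous.aestronglyMeasurable (Eventually.of_forall hM)
    have e1 := hw.2.2 φ hφ hφc hφs i
    have e2 := h.2.2 φ hφ hφc hφs i
    have e3 := integral_sub h3 h4
    rw [e1] at e2
    simp only [mul_comm _ (φ _)] at e2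
    simp only [smul_eq_mul, mul_sub]
    change ∫ x, (φ x * weakGrad n u x i - φ x * g x i) ∂(volB n) = 0
    rw [e3]
    linarith
  filter_upwards [ae_all_iff.2 hi] with x hx
  ext i
  exact sub_eq_zero.1 (hx i)

lemma Q_radial {n : ℕ} (hn : 1 ≤ n) (V : ℝ → ℝ) {u d : ℝ → ℝ}
    (h : HasH1Grad n (fun x => u ‖x‖) (fun x => (d ‖x‖ * ‖x‖⁻¹) • x)) :
    Q n V (fun x => u ‖x‖) = sphereArea n * form n V u d u d := by
  rw [Q, form, ← integral_volB_norm hn]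
  refine integral_congr_ae ?_
  filter_upwards [weakGrad_ae_eq h, ae_volB_pos hn] with x hx hx'
  rw [hx, norm_mul_inv_smul _ (norm_pos_iff.1 hx'.1), sq_abs]
  ring

/-! ### Radial functions of class `H¹` -/

/-- The given profile `f` may fail to be measurable. By Fubini in polar coordinates, a measurable
representative of `v` agrees with `f` at almost every radius along some ray, and its restriction to
that ray serves. -/
lemma exists_measurable_profile {n : ℕ} (hn : 1 ≤ n) {v : E n → ℝ} {f : ℝ → ℝ}
    (hv : AEStronglyMeasurable v (volB n)) (hf : ∀ᵐ x ∂(volB n), v x = f ‖x‖) :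
    ∃ k : ℝ → ℝ, Measurable k ∧ ∀ᵐ x ∂(volB n), v x = k ‖x‖ := by
  have : Nonempty (Fin n) := ⟨⟨0, hn⟩⟩
  have hMP := (volume : Measure (E n)).measurePreserving_homeomorphUnitSphereProd
  have hB : MeasurableSet (B n) := measurableSet_ball
  have hm : Measurable (hv.mk v) := hv.stronglyMeasurable_mk.measurable
  have h1 : ∀ᵐ x ∂(volume : Measure (E n)), x ∈ B n → hv.mk v x = f ‖x‖ := by
    rw [← ae_restrict_iff' hB]
    filter_upwards [hf, hv.ae_eq_mk] with x hx hx'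
    rw [← hx', hx]
  have h0 : MeasurableSet ({0}ᶜ : Set (E n)) := (measurableSet_singleton _).compl
  have h2 := (ae_restrict_iff_subtype h0).1 (ae_restrict_of_ae (s := {0}ᶜ) h1)
  have h3 : ∀ᵐ z ∂((volume : Measure (E n)).toSphere.prod
      (Measure.volumeIoiPow (Module.finrank ℝ (E n) - 1))),
      (z.2 : ℝ) < 1 → hv.mk v ((z.2 : ℝ) • (z.1 : E n)) = f z.2 := by
    rw [← hMP.map_eq, (Homeomorph.measurableEmbedding _).ae_map_iff]
    filter_upwards [h2] with x hx hx1
    have e1 : ((homeomorphUnitSphereProd (E n) x).2 : ℝ) •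
        ((homeomorphUnitSphereProd (E n) x).1 : E n) = x := by
      rw [← homeomorphUnitSphereProd_symm_apply_coe, Homeomorph.symm_apply_apply]
    have e2 : ((homeomorphUnitSphereProd (E n) x).2 : ℝ) = ‖(x : E n)‖ := by simp
    rw [e1, e2]
    rw [e2] at hx1
    exact hx (by simpa [B] using hx1)
  have hne : (ae (volume : Measure (E n)).toSphere).NeBot := ae_neBot.2 (Measure.toSphere_ne_zero _)
  obtain ⟨ξ, hξ⟩ := (Measure.ae_ae_of_ae_prod h3).exists
  refine ⟨fun r => hv.mk v (r • (ξ : E n)), hm.comp (by fun_prop), ?_⟩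
  have h5 := hMP.quasiMeasurePreserving.ae (Measure.quasiMeasurePreserving_snd.ae hξ)
  have h6 : ∀ᵐ x ∂((volume : Measure (E n)).restrict {0}ᶜ),
      ‖x‖ < 1 → hv.mk v (‖x‖ • (ξ : E n)) = f ‖x‖ := by
    rw [ae_restrict_iff_subtype h0]
    filter_upwards [h5] with x hx
    simpa using hx
  rw [restrict_compl_singleton] at h6
  filter_upwards [hf, ae_restrict_of_ae h6, ae_restrict_mem hB] with x hx hx6 hxB
  rw [hx, hx6 (by simpa [B] using hxB)]

lemma memLp_of_volB_norm {n : ℕ} (hn : 1 ≤ n) {f : ℝ → ℝ} {p : ℝ≥0∞}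
    (hf : AEStronglyMeasurable f (wt n)) (h : MemLp (fun x : E n => f ‖x‖) p (volB n)) :
    MemLp f p (wt n) := by
  have hMP := measurePreserving_norm hn
  have h1 : MemLp f p (ENNReal.ofReal (sphereArea n) • wt n) := by
    rw [← hMP.map_eq]
    refine (memLp_map_measure_iff ?_ hMP.measurable.aemeasurable).2 h
    rw [hMP.map_eq]
    exact hf.smul_measure _
  refine h1.of_measure_le_smul (c := ENNReal.ofReal (sphereArea n)⁻¹) ENNReal.ofReal_ne_top ?_
  rw [smul_smul, ← ENNReal.ofReal_mul (inv_nonneg.2 (sphereArea_pos hn).le),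
    inv_mul_cancel₀ (sphereArea_pos hn).ne']
  simp

/-- The adjoint of composition with the norm. -/
lemma exists_radial_projection {n : ℕ} (hn : 1 ≤ n) {γ : E n → ℝ} (hγ : MemLp γ 2 (volB n)) :
    ∃ d : ℝ → ℝ, MemLp d 2 (wt n) ∧
      sphereArea n * ∫ r, d r * d r ∂(wt n) ≤ ∫ x, γ x ^ 2 ∂(volB n) ∧
      ∀ χ : ℝ → ℝ, MemLp χ 2 (wt n) →
        sphereArea n * ∫ r, d r * χ r ∂(wt n) = ∫ x, γ x * χ ‖x‖ ∂(volB n) := by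
  have hσ := sphereArea_pos hn
  have hMP := measurePreserving_norm hn
  set m := ENNReal.ofReal (sphereArea n) • wt n with hm
  set T : Lp ℝ 2 m →L[ℝ] Lp ℝ 2 (volB n) :=
    (Lp.compMeasurePreservingₗᵢ ℝ (fun x : E n => ‖x‖) hMP).toContinuousLinearMap with hT
  set D : Lp ℝ 2 m := ContinuousLinearMap.adjoint T (hγ.toLp γ) with hD
  have hDwt : MemLp (D : ℝ → ℝ) 2 (wt n) := by
    refine (Lp.memLp D).of_measure_le_smul (c := ENNReal.ofReal (sphereArea n)⁻¹)
      ENNReal.ofReal_ne_top ?_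
    rw [hm, smul_smul, ← ENNReal.ofReal_mul (inv_nonneg.2 hσ.le), inv_mul_cancel₀ hσ.ne']
    simp
  have hint : ∀ f : ℝ → ℝ, ∫ r, f r ∂m = sphereArea n * ∫ r, f r ∂(wt n) := fun f => by
    rw [hm, integral_smul_measure, ENNReal.toReal_ofReal hσ.le, smul_eq_mul]
  have key : ∀ χ : ℝ → ℝ, MemLp χ 2 (wt n) →
      sphereArea n * ∫ r, D r * χ r ∂(wt n) = ∫ x, γ x * χ ‖x‖ ∂(volB n) := fun χ hχ => by
    have hχm : MemLp χ 2 m := hχ.smul_measure ENNReal.ofReal_ne_top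
    have h1 := ContinuousLinearMap.adjoint_inner_left T (hχm.toLp χ) (hγ.toLp γ)
    rw [← hD, L2.inner_def, L2.inner_def] at h1
    rw [← hint]
    have e1 : ∫ r, D r * χ r ∂m = ∫ r, inner ℝ (D r) (hχm.toLp χ r) ∂m := by
      refine integral_congr_ae ?_
      filter_upwards [hχm.coeFn_toLp] with r hr
      rw [hr]
      simp [mul_comm]
    have hTχ : T (hχm.toLp χ) = (hχm.comp_measurePreserving hMP).toLp _ := rfl
    have e2 : ∫ x, γ x * χ ‖x‖ ∂(volB n) =
        ∫ x, inner ℝ (hγ.toLp γ x) (T (hχm.toLp χ) x) ∂(volB n) := by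
      refine integral_congr_ae ?_
      filter_upwards [hγ.coeFn_toLp, (hχm.comp_measurePreserving hMP).coeFn_toLp] with x hx hx'
      rw [hTχ, hx, hx']
      simp [mul_comm]
    rw [e1, e2, h1]
  refine ⟨D, hDwt, ?_, key⟩
  have h2 := key D hDwt
  have hγ2 : Integrable (fun x => γ x ^ 2) (volB n) := hγ.integrable_sq
  have hDx := memLp_volB_norm hn hDwt
  have hDx2 : Integrable (fun x : E n => D ‖x‖ ^ 2) (volB n) := hDx.integrable_sq
  have h3 : ∫ x, D ‖x‖ ^ 2 ∂(volB n) = sphereArea n * ∫ r, D r * D r ∂(wt n) := by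
    rw [integral_volB_norm hn (fun r => D r ^ 2)]
    simp only [sq]
  -- Testing with `D` itself gives its squared norm as a pairing with `γ`; half of it is absorbed by
  -- Young's inequality.
  have h4 : ∫ x, γ x * D ‖x‖ ∂(volB n) ≤
      ∫ x, (1 / 2 * γ x ^ 2 + 1 / 2 * D ‖x‖ ^ 2) ∂(volB n) := by
    refine integral_mono (hγ.integrable_mul hDx) ((hγ2.const_mul _).add (hDx2.const_mul _))
      fun x => ?_
    have := sq_nonneg (γ x - D ‖x‖)
    simp only
    linarith
  rw [integral_add (hγ2.const_mul _) (hDx2.const_mul _), integral_const_mul, integral_const_mul,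
    h3, ← h2] at h4
  linarith

/-- du Bois-Reymond: a function with vanishing weak derivative is constant. -/
theorem exists_ae_eq_const_of_integral_deriv_mul_eq_zero {k : ℝ → ℝ}
    (hk : LocallyIntegrableOn k (Ioo 0 1))
    (h : ∀ θ : ℝ → ℝ, ContDiff ℝ ∞ θ → HasCompactSupport θ → tsupport θ ⊆ Ioo 0 1 →
      ∫ r, deriv θ r * k r = 0) :
    ∃ c, ∀ᵐ r, r ∈ Ioo (0 : ℝ) 1 → k r = c := by
  have hint : ∀ ρ : ℝ → ℝ, ContDiff ℝ ∞ ρ → HasCompactSupport ρ → tsupport ρ ⊆ Ioo 0 1 →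
      Integrable (fun r => ρ r * k r) := fun ρ hρ hc hs => by
    have h1 : IntegrableOn k (tsupport ρ) := hk.integrableOn_compact_subset hs hc
    obtain ⟨M, hM⟩ := hρ.continuous.bounded_above_of_compact_support hc
    have h2 : IntegrableOn (fun r => ρ r * k r) (tsupport ρ) :=
      Integrable.bdd_mul (c := M) h1 hρ.continuous.aestronglyMeasurable (Eventually.of_forall hM)
    refine (integrableOn_iff_integrable_of_support_subset fun r hr => ?_).1 h2
    refine subset_tsupport ρ ?_
    rw [Function.mem_support] at hr ⊢
    exact left_ne_zero_of_mul hr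
  let η₀ : ContDiffBump (1 / 2 : ℝ) := ⟨1 / 8, 1 / 4, by norm_num, by norm_num⟩
  set η : ℝ → ℝ := η₀.normed volume with hη
  have hη1 : ContDiff ℝ ∞ η := η₀.contDiff_normed
  have hη2 : HasCompactSupport η := η₀.hasCompactSupport_normed
  have hη3 : tsupport η ⊆ Ioo 0 1 := by
    rw [hη, η₀.tsupport_normed_eq, Real.closedBall_eq_Icc]
    intro r hr
    constructor <;> norm_num [η₀] at hr ⊢ <;> linarith [hr.1, hr.2]
  have hη4 : ∫ r, η r = 1 := η₀.integral_normed
  set c := ∫ r, η r * k r with hc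
  have key : ∀ ρ : ℝ → ℝ, ContDiff ℝ ∞ ρ → HasCompactSupport ρ → tsupport ρ ⊆ Ioo 0 1 →
      ∫ r, ρ r * (k r - c) = 0 := fun ρ hρ hρc hρs => by
    set I := ∫ r, ρ r with hI
    -- Subtracting a multiple of the fixed bump `η` makes the integral zero, so `g` is the
    -- derivative of a compactly supported function. The constant is therefore `∫ η k`.
    set g : ℝ → ℝ := fun r => ρ r - I * η r with hg
    have hg1 : ContDiff ℝ ∞ g := hρ.sub (contDiff_const.mul hη1)
    have hgs : tsupport g ⊆ tsupport ρ ∪ tsupport η := by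
      refine closure_minimal (fun r hr => ?_) ((isClosed_tsupport _).union (isClosed_tsupport _))
      by_contra hcon
      rw [mem_union, not_or] at hcon
      rw [Function.mem_support, hg] at hr
      simp [image_eq_zero_of_notMem_tsupport hcon.1, image_eq_zero_of_notMem_tsupport hcon.2] at hr
    have hcomp : IsCompact (tsupport ρ ∪ tsupport η) := hρc.isCompact.union hη2.isCompact
    have hsub : tsupport ρ ∪ tsupport η ⊆ Ioo 0 1 := union_subset hρs hη3
    obtain ⟨r₀, hr₀⟩ : (tsupport ρ ∪ tsupport η).Nonempty := by
      by_contra hcon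
      rw [not_nonempty_iff_eq_empty, union_empty_iff] at hcon
      have : η = 0 := tsupport_eq_empty_iff.1 hcon.2
      rw [this] at hη4
      simp at hη4
    set a := sInf (tsupport ρ ∪ tsupport η) with ha
    set b := sSup (tsupport ρ ∪ tsupport η) with hb
    have ham := hcomp.sInf_mem ⟨r₀, hr₀⟩
    have hbm := hcomp.sSup_mem ⟨r₀, hr₀⟩
    have hab : ∀ r, r ∉ Icc a b → g r = 0 := fun r hr => by
      refine image_eq_zero_of_notMem_tsupport fun h' => hr ?_
      exact ⟨csInf_le hcomp.bddBelow (hgs h'), le_csSup hcomp.bddAbove (hgs h')⟩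
    have hgI : ∫ r, g r = 0 := by
      rw [hg, integral_sub (hρ.continuous.integrable_of_hasCompactSupport hρc)
        ((hη1.continuous.integrable_of_hasCompactSupport hη2).const_mul _), integral_const_mul,
        hη4]
      simp [hI]
    set θ : ℝ → ℝ := fun r => ∫ s in a..r, g s with hθ
    have hθd : ∀ r, HasDerivAt θ (g r) r := fun r =>
      intervalIntegral.integral_hasDerivAt_right (hg1.continuous.intervalIntegrable _ _)
        hg1.continuous.stronglyMeasurable.stronglyMeasurableAtFilter hg1.continuous.continuousAt
    have hθ' : deriv θ = g := funext fun r => (hθd r).deriv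
    have hθ1 : ContDiff ℝ ∞ θ := by
      rw [contDiff_infty_iff_deriv, hθ']
      exact ⟨fun r => (hθd r).differentiableAt, hg1⟩
    have hθ0 : ∀ r, r ∉ Icc a b → θ r = 0 := fun r hr => by
      rw [mem_Icc, not_and_or, not_le, not_le] at hr
      rcases hr with hr | hr
      · rw [hθ]
        simp only
        rw [intervalIntegral.integral_symm, intervalIntegral.integral_of_le hr.le,
          integral_Ioc_eq_integral_Ioo, setIntegral_eq_zero_of_forall_eq_zero, neg_zero]
        exact fun s hs => hab s fun hs' => absurd hs.2 (not_lt.2 hs'.1)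
      · rw [hθ]
        simp only
        have har : a ≤ r := (csInf_le hcomp.bddBelow hbm).trans hr.le
        rw [intervalIntegral.integral_of_le har, ← integral_Icc_eq_integral_Ioc,
          setIntegral_eq_integral_of_forall_compl_eq_zero, hgI]
        exact fun s hs => hab s fun hs' => hs ⟨hs'.1, hs'.2.trans hr.le⟩
    have hθs : tsupport θ ⊆ Icc a b := by
      refine closure_minimal (fun r hr => ?_) isClosed_Icc
      by_contra hcon
      exact hr (hθ0 r hcon)
    have hab' : Icc a b ⊆ Ioo 0 1 := fun r hr =>
      ⟨(hsub ham).1.trans_le hr.1, hr.2.trans_lt (hsub hbm).2⟩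
    have h1 := h θ hθ1 (isCompact_Icc.of_isClosed_subset (isClosed_tsupport _) hθs)
      (hθs.trans hab')
    rw [hθ'] at h1
    have hik := hint ρ hρ hρc hρs
    have hiη := hint η hη1 hη2 hη3
    have e1 : ∫ r, g r * k r = (∫ r, ρ r * k r) - I * c := by
      rw [hc, ← integral_const_mul, ← integral_sub hik (hiη.const_mul _)]
      congr 1; ext r; rw [hg]; ring
    have e2 : ∫ r, ρ r * (k r - c) = (∫ r, ρ r * k r) - I * c := by
      rw [hI, ← integral_mul_const, ← integral_sub hik
        ((hρ.continuous.integrable_of_hasCompactSupport hρc).mul_const _)]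
      congr 1; ext r; ring
    rw [e2, ← e1, h1]
  refine ⟨c, ?_⟩
  have := isOpen_Ioo.ae_eq_zero_of_integral_contDiff_smul_eq_zero
    (hk.sub (locallyIntegrableOn_const c)) key
  filter_upwards [this] with r hr hr'
  exact sub_eq_zero.1 (hr hr')

section WeakDerivative

variable {n : ℕ}

lemma contDiff_div_pow {θ : ℝ → ℝ} (hθ : ContDiff ℝ ∞ θ) (h0 : (0 : ℝ) ∉ tsupport θ) (k : ℕ) :
    ContDiff ℝ ∞ fun r => θ r / r ^ k := by
  rw [contDiff_iff_contDiffAt]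
  intro r
  by_cases hr : r = 0
  · subst hr
    refine contDiffAt_const (c := (0 : ℝ)) |>.congr_of_eventuallyEq ?_
    filter_upwards [notMem_tsupport_iff_eventuallyEq.1 h0] with s hs
    simp [hs]
  · exact hθ.contDiffAt.div (contDiffAt_id.pow k) (pow_ne_zero k hr)

lemma contDiff_comp_norm {κ : ℝ → ℝ} (hκ : ContDiff ℝ ∞ κ) (h0 : (0 : ℝ) ∉ tsupport κ) :
    ContDiff ℝ ∞ fun x : E n => κ ‖x‖ := by
  rw [contDiff_iff_contDiffAt]
  intro x
  by_cases hx : x = 0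
  · subst hx
    refine contDiffAt_const (c := (0 : ℝ)) |>.congr_of_eventuallyEq ?_
    have h1 : Tendsto (fun x : E n => ‖x‖) (𝓝 0) (𝓝 0) := tendsto_norm_zero
    exact h1.eventually (notMem_tsupport_iff_eventuallyEq.1 h0)
  · exact hκ.contDiffAt.comp x (contDiffAt_norm ℝ hx)

lemma tsupport_div_pow_subset (θ : ℝ → ℝ) (k : ℕ) :
    tsupport (fun r => θ r / r ^ k) ⊆ tsupport θ :=
  closure_mono fun r hr => by
    rw [Function.mem_support] at hr ⊢
    exact fun h => hr (by simp [h])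

/-- Testing a weak gradient with the radial field `κ(|x|) x`. -/
lemma integral_radial_field (hn : 1 ≤ n) {v : E n → ℝ} {g : E n → E n} (h : HasH1Grad n v g)
    {κ : ℝ → ℝ} (hκ : ContDiff ℝ ∞ κ) (hs : tsupport κ ⊆ Ioo 0 1) :
    ∫ x, v x * (‖x‖ * deriv κ ‖x‖ + n * κ ‖x‖) ∂(volB n) =
      - ∫ x, κ ‖x‖ * inner ℝ (g x) x ∂(volB n) := by
  have h0 : (0 : ℝ) ∉ tsupport κ := fun h => lt_irrefl _ (hs h).1
  have hκn := contDiff_comp_norm (n := n) hκ h0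
  set φ : Fin n → E n → ℝ := fun i x => κ ‖x‖ * x i with hφ
  have hcoord : ∀ i : Fin n, ContDiff ℝ ∞ fun x : E n => x i := fun i =>
    (EuclideanSpace.proj i : E n →L[ℝ] ℝ).contDiff
  have hφ1 : ∀ i, ContDiff ℝ ∞ (φ i) := fun i => hκn.mul (hcoord i)
  have hφs : ∀ i, tsupport (φ i) ⊆ (fun x : E n => ‖x‖) ⁻¹' tsupport κ := fun i => by
    refine closure_minimal (fun x hx => ?_) ((isClosed_tsupport κ).preimage continuous_norm)
    refine subset_tsupport κ ?_
    rw [Function.mem_support] at hx ⊢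
    exact left_ne_zero_of_mul hx
  have hφB : ∀ i, tsupport (φ i) ⊆ B n := fun i x hx => by
    have := (hs (hφs i hx)).2
    simpa [B] using this
  have hφc : ∀ i, HasCompactSupport (φ i) := fun i =>
    (isCompact_closedBall (0 : E n) 1).of_isClosed_subset (isClosed_tsupport _)
      ((hφB i).trans Metric.ball_subset_closedBall)
  have hv : Integrable v (volB n) := h.1.integrable one_le_two
  have hg : ∀ i, Integrable (fun x => g x i) (volB n) := fun i =>
    (h.2.1.continuousLinearMap_comp (EuclideanSpace.proj i : E n →L[ℝ] ℝ)).integrable one_le_two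
  have hi1 : ∀ i, Integrable (fun x => v x * fderiv ℝ (φ i) x (EuclideanSpace.single i 1))
      (volB n) := fun i => by
    have hcf : Continuous fun x => fderiv ℝ (φ i) x (EuclideanSpace.single i 1) :=
      ((hφ1 i).continuous_fderiv (by simp)).clm_apply continuous_const
    have hcs : HasCompactSupport fun x => fderiv ℝ (φ i) x (EuclideanSpace.single i 1) :=
      (hφc i).fderiv_apply ℝ _
    obtain ⟨M, hM⟩ := hcf.bounded_above_of_compact_support hcs
    exact hv.mul_bdd (c := M) hcf.aestronglyMeasurable (Eventually.of_forall hM)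
  have hi2 : ∀ i, Integrable (fun x => g x i * φ i x) (volB n) := fun i => by
    obtain ⟨M, hM⟩ := (hφ1 i).continuous.bounded_above_of_compact_support (hφc i)
    exact (hg i).mul_bdd (c := M) (hφ1 i).continuous.aestronglyMeasurable (Eventually.of_forall hM)
  have hsum : ∑ i, ∫ x, v x * fderiv ℝ (φ i) x (EuclideanSpace.single i 1) ∂(volB n) =
      ∑ i, - ∫ x, g x i * φ i x ∂(volB n) :=
    Finset.sum_congr rfl fun i _ => h.2.2 (φ i) (hφ1 i) (hφc i) (hφB i) i
  rw [← integral_finsetSum _ fun i _ => hi1 i, Finset.sum_neg_distrib,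
    ← integral_finsetSum _ fun i _ => hi2 i] at hsum
  refine Eq.trans ?_ (hsum.trans (congrArg Neg.neg ?_))
  · refine integral_congr_ae ?_
    filter_upwards [ae_volB_pos hn] with x hx
    have hx0 : x ≠ 0 := norm_pos_iff.1 hx.1
    have hx1 : ‖x‖ ≠ 0 := hx.1.ne'
    have hd : ∀ i, fderiv ℝ (φ i) x (EuclideanSpace.single i 1) =
        κ ‖x‖ + deriv κ ‖x‖ * (‖x‖⁻¹ * x i) * x i := fun i => by
      have e1 : HasDerivAt κ (deriv κ ‖x‖) ‖x‖ :=
        (hκ.differentiable (by simp) ‖x‖).hasDerivAt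
      have e2 := e1.comp_hasFDerivAt x (hasFDerivAt_norm_of_ne hx0)
      have e3 : HasFDerivAt (fun y : E n => y i) (EuclideanSpace.proj i : E n →L[ℝ] ℝ) x :=
        (EuclideanSpace.proj i : E n →L[ℝ] ℝ).hasFDerivAt
      have e4 : HasFDerivAt (φ i) _ x := e2.mul e3
      rw [e4.fderiv]
      simp [EuclideanSpace.inner_single_right]
      ring
    have hnorm : ∑ i, x i * x i = ‖x‖ ^ 2 := by
      rw [EuclideanSpace.real_norm_sq_eq]
      exact Finset.sum_congr rfl fun i _ => (sq _).symm
    simp only [hd]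
    rw [← Finset.mul_sum, Finset.sum_add_distrib]
    have e5 : ∑ i, deriv κ ‖x‖ * (‖x‖⁻¹ * x i) * x i = ‖x‖ * deriv κ ‖x‖ := by
      have : ∀ i, deriv κ ‖x‖ * (‖x‖⁻¹ * x i) * x i = deriv κ ‖x‖ * ‖x‖⁻¹ * (x i * x i) :=
        fun i => by ring
      simp only [this]
      rw [← Finset.mul_sum, hnorm]
      field_simp
    rw [e5, Finset.sum_const, Finset.card_univ, Fintype.card_fin, nsmul_eq_mul]
    ring
  · refine integral_congr_ae (Eventually.of_forall fun x => ?_)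
    simp only [hφ]
    have : inner ℝ (g x) x = ∑ i, g x i * x i := by
      rw [PiLp.inner_apply]
      exact Finset.sum_congr rfl fun i _ => by simp [mul_comm]
    rw [this, Finset.mul_sum]
    exact Finset.sum_congr rfl fun i _ => by ring

/-- `d` is the radial projection of the component of `g` along `x / ‖x‖`, whence its norm bound. The
field `κ(‖x‖) x` with `κ = θ / r ^ n` is used because `r κ' + n κ = θ' / r ^ (n - 1)`. -/
lemma exists_weak_radial_deriv (hn : 1 ≤ n) {v : E n → ℝ} {g : E n → E n}
    (h : HasH1Grad n v g) {f : ℝ → ℝ} (hf : Measurable f) (hvf : ∀ᵐ x ∂(volB n), v x = f ‖x‖) :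
    MemLp f 2 (wt n) ∧ ∃ d : ℝ → ℝ, MemLp d 2 (wt n) ∧
      sphereArea n * ∫ r, d r * d r ∂(wt n) ≤ ∫ x, ‖g x‖ ^ 2 ∂(volB n) ∧
      ∀ θ : ℝ → ℝ, ContDiff ℝ ∞ θ → HasCompactSupport θ → tsupport θ ⊆ Ioo 0 1 →
        ∫ r, deriv θ r / r ^ (n - 1) * f r ∂(wt n) =
          - ∫ r, d r * (θ r / r ^ (n - 1)) ∂(wt n) := by
  have hσ := sphereArea_pos hn
  have hfL : MemLp f 2 (wt n) :=
    memLp_of_volB_norm hn hf.aestronglyMeasurable (h.1.ae_eq hvf)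
  refine ⟨hfL, ?_⟩
  set γ : E n → ℝ := fun x => inner ℝ (g x) (‖x‖⁻¹ • x) with hγ
  have hγb : ∀ x, ‖γ x‖ ≤ ‖g x‖ := fun x => by
    refine (norm_inner_le_norm _ _).trans ?_
    have h1 := norm_mul_inv_smul_le 1 x
    rw [one_mul, abs_one] at h1
    exact mul_le_of_le_one_right (norm_nonneg _) h1
  have hγm : MemLp γ 2 (volB n) := by
    refine h.2.1.mono ?_ (Eventually.of_forall hγb)
    exact h.2.1.1.inner (Measurable.aestronglyMeasurable (by fun_prop))
  obtain ⟨d, hd, hdle, hdχ⟩ := exists_radial_projection hn hγm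
  refine ⟨d, hd, hdle.trans ?_, fun θ hθ hθc hθs => ?_⟩
  · refine integral_mono hγm.integrable_sq h.2.1.integrable_norm_pow' fun x => ?_
    have := hγb x
    rw [Real.norm_eq_abs] at this
    exact sq_le_sq' (by linarith [neg_abs_le (γ x)]) ((le_abs_self _).trans this)
  · have h0 : (0 : ℝ) ∉ tsupport θ := fun h => lt_irrefl _ (hθs h).1
    have hκ := contDiff_div_pow hθ h0 n
    have hsub := tsupport_div_pow_subset θ n
    have key := integral_radial_field hn h hκ (hsub.trans hθs)
    have hχ := contDiff_div_pow hθ h0 (n - 1)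
    have hχc : HasCompactSupport fun r => θ r / r ^ (n - 1) :=
      hθc.isCompact.of_isClosed_subset (isClosed_tsupport _) (tsupport_div_pow_subset θ (n - 1))
    obtain ⟨M, hM⟩ := hχ.continuous.bounded_above_of_compact_support hχc
    have h1 := hdχ _ (memLp_wt (n := n) 2 hχ.continuous.continuousOn fun r _ => hM r)
    have e1 : ∫ x, v x * (‖x‖ * deriv (fun r => θ r / r ^ n) ‖x‖ + n * (θ ‖x‖ / ‖x‖ ^ n)) ∂(volB n)
        = sphereArea n * ∫ r, deriv θ r / r ^ (n - 1) * f r ∂(wt n) := by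
      rw [← integral_volB_norm hn]
      refine integral_congr_ae ?_
      filter_upwards [hvf, ae_volB_pos hn] with x hx hx'
      have hx0 : ‖x‖ ≠ 0 := hx'.1.ne'
      have hd' : HasDerivAt (fun r => θ r / r ^ n) ((deriv θ ‖x‖ * ‖x‖ ^ n -
          θ ‖x‖ * (n * ‖x‖ ^ (n - 1))) / (‖x‖ ^ n) ^ 2) ‖x‖ :=
        (hθ.differentiable (by simp) ‖x‖).hasDerivAt.div (hasDerivAt_pow n ‖x‖)
          (pow_ne_zero n hx0)
      rw [hd'.deriv, hx]
      have hpow : ‖x‖ ^ n = ‖x‖ ^ (n - 1) * ‖x‖ := by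
        rw [← pow_succ, Nat.sub_add_cancel hn]
      rw [hpow]
      field_simp
      ring
    have e2 : ∫ x, θ ‖x‖ / ‖x‖ ^ n * inner ℝ (g x) x ∂(volB n) =
        ∫ x, γ x * (θ ‖x‖ / ‖x‖ ^ (n - 1)) ∂(volB n) := by
      refine integral_congr_ae ?_
      filter_upwards [ae_volB_pos hn] with x hx'
      have hx0 : ‖x‖ ≠ 0 := hx'.1.ne'
      have hpow : ‖x‖ ^ n = ‖x‖ ^ (n - 1) * ‖x‖ := by
        rw [← pow_succ, Nat.sub_add_cancel hn]
      simp only [hγ, inner_smul_right]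
      rw [hpow]
      field_simp
    rw [e1, e2, ← h1, ← mul_neg] at key
    exact mul_left_cancel₀ hσ.ne' key

/-- A function with a square integrable weak derivative is a.e. equal to a primitive. -/
lemma exists_primitive_of_weak_deriv {f d : ℝ → ℝ} (hf : MemLp f 2 (wt n))
    (hd : MemLp d 2 (wt n))
    (h : ∀ θ : ℝ → ℝ, ContDiff ℝ ∞ θ → HasCompactSupport θ → tsupport θ ⊆ Ioo 0 1 →
      ∫ r, deriv θ r / r ^ (n - 1) * f r ∂(wt n) = - ∫ r, d r * (θ r / r ^ (n - 1)) ∂(wt n)) :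
    ∃ u : ℝ → ℝ, (∀ r ∈ Ioc (0 : ℝ) 1, u r = u 1 - ∫ t in r..1, d t) ∧
      ∀ᵐ r ∂(wt n), f r = u r := by
  -- The candidate primitive, vanishing at 1. Integration by parts gives it the weak derivative of
  -- `f`, so `f - D` is almost everywhere constant.
  set D : ℝ → ℝ := fun r => - ∫ t in r..1, d t with hD
  have hD1 : ∀ r ∈ Ioc (0 : ℝ) 1, D r = D 1 - ∫ t in r..1, d t := fun r _ => by simp [hD]
  have hDc := continuousOn_of_primitive hd hD1
  have hloc : LocallyIntegrableOn (fun r => f r - D r) (Ioo 0 1) := by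
    refine LocallyIntegrableOn.sub (fun r hr => ?_)
      ((hDc.mono Ioo_subset_Ioc_self).locallyIntegrableOn measurableSet_Ioo)
    refine ⟨Ioc (r / 2) 1, ?_, ?_⟩
    · refine mem_nhdsWithin_of_mem_nhds (Ioc_mem_nhds (by linarith [hr.1]) hr.2)
    · exact (memLp_restrict_of_wt (half_pos hr.1) hf).integrable one_le_two
  obtain ⟨c, hc⟩ := exists_ae_eq_const_of_integral_deriv_mul_eq_zero hloc
    fun θ hθ hθc hθs => by
      have h0 : (0 : ℝ) ∉ tsupport θ := fun h => lt_irrefl _ (hθs h).1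
      have hdθ : ContDiff ℝ ∞ (deriv θ) := (contDiff_infty_iff_deriv.1 hθ).2
      have hts : tsupport (deriv θ) ⊆ tsupport θ := tsupport_deriv_subset
      have hχ := contDiff_div_pow hdθ (fun h => h0 (hts h)) (n - 1)
      have hχc : HasCompactSupport fun r => deriv θ r / r ^ (n - 1) :=
        hθc.isCompact.of_isClosed_subset (isClosed_tsupport _)
          ((tsupport_div_pow_subset (deriv θ) (n - 1)).trans hts)
      obtain ⟨M, hM⟩ := hχ.continuous.bounded_above_of_compact_support hχc
      obtain ⟨-, h2, h3⟩ := weighted_integration_by_parts hχ.continuous.continuousOn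
        (fun r _ => hM r) hd hD1
      have hH : ∀ t ∈ Ioc (0 : ℝ) 1,
          ∫ s in (0 : ℝ)..t, s ^ (n - 1) * (deriv θ s / s ^ (n - 1)) = θ t := fun t ht => by
        have e1 : ∫ s in (0 : ℝ)..t, s ^ (n - 1) * (deriv θ s / s ^ (n - 1)) =
            ∫ s in (0 : ℝ)..t, deriv θ s := by
          refine intervalIntegral.integral_congr_ae (Eventually.of_forall fun s hs => ?_)
          rw [uIoc_of_le ht.1.le] at hs
          have := pow_ne_zero (n - 1) hs.1.ne'
          field_simp
        rw [e1, intervalIntegral.integral_deriv_eq_sub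
          (fun s _ => hθ.differentiable (by simp) s) (hdθ.continuous.intervalIntegrable _ _),
          image_eq_zero_of_notMem_tsupport h0, sub_zero]
      have e2 : ∫ t, d t * ((∫ s in (0 : ℝ)..t, s ^ (n - 1) * (deriv θ s / s ^ (n - 1))) /
          t ^ (n - 1)) ∂(wt n) = ∫ r, d r * (θ r / r ^ (n - 1)) ∂(wt n) :=
        integral_congr_ae (ae_wt_of_forall fun t ht => by simp only [hH t ht])
      have hD0 : D 1 = 0 := by simp [hD]
      rw [e2, hD0, zero_mul, zero_sub, ← h θ hθ hθc hθs] at h3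
      have h4 : Integrable (fun r => deriv θ r / r ^ (n - 1) * f r) (wt n) :=
        (hf.integrable one_le_two).bdd_mul (c := M) hχ.continuous.aestronglyMeasurable
          (Eventually.of_forall hM)
      have h5 : ∫ r, deriv θ r / r ^ (n - 1) * (f r - D r) ∂(wt n) = 0 := by
        simp only [mul_sub]
        rw [integral_sub h4 h2, h3, sub_self]
      rw [integral_wt'] at h5
      rw [← h5, ← setIntegral_eq_integral_of_forall_compl_eq_zero (s := Ioc (0 : ℝ) 1)]
      · refine setIntegral_congr_fun measurableSet_Ioc fun r hr => ?_
        have := pow_ne_zero (n - 1) hr.1.ne'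
        field_simp
      · intro r hr
        rw [image_eq_zero_of_notMem_tsupport (f := deriv θ), zero_mul]
        exact fun h => hr (Ioo_subset_Ioc_self (hθs (hts h)))
  refine ⟨fun r => c + D r, fun r hr => by simp only [hD1 r hr]; ring, ?_⟩
  rw [ae_wt_iff, ← Measure.restrict_congr_set Ioo_ae_eq_Ioc, ae_restrict_iff' measurableSet_Ioo]
  filter_upwards [hc] with r hr hr'
  linarith [hr hr']

end WeakDerivative

/-! ### The constraint set in terms of radial profiles -/

section Constraint

variable {n : ℕ}

lemma ae_wt_of_volB (hn : 1 ≤ n) {q : ℝ → Prop} (hq : MeasurableSet {r | q r})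
    (h : ∀ᵐ x ∂(volB n), q ‖x‖) : ∀ᵐ r ∂(wt n), q r := by
  have hMP := measurePreserving_norm hn
  have h1 : ∀ᵐ r ∂(ENNReal.ofReal (sphereArea n) • wt n), q r := by
    rw [← hMP.map_eq, ae_map_iff hMP.measurable.aemeasurable hq]
    exact h
  exact (Measure.ae_ennreal_smul_measure_iff (by simpa using sphereArea_pos hn)).1 h1

/-- A continuous function exceeds `c` on a relatively open set, which cannot be null unless empty;
limits then reach the endpoints. -/
lemma abs_le_of_ae_wt {u : ℝ → ℝ} (hu : ContinuousOn u (Ioc 0 1)) {α β c : ℝ} (hα : 0 ≤ α)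
    (hαβ : α < β) (hβ : β ≤ 1) (h : ∀ᵐ r ∂(wt n), r ∈ Ioo α β → |u r| ≤ c) :
    ∀ r ∈ Ioc (0 : ℝ) 1, r ∈ Icc α β → |u r| ≤ c := by
  have hsub : Ioo α β ⊆ Ioc 0 1 := fun r hr => ⟨hα.trans_lt hr.1, hr.2.le.trans hβ⟩
  have h1 : ∀ r ∈ Ioo α β, |u r| ≤ c := by
    have ho : IsOpen (Ioo α β ∩ (fun r => |u r|) ⁻¹' Ioi c) :=
      (hu.mono hsub).abs.isOpen_inter_preimage isOpen_Ioo isOpen_Ioi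
    have h0 : volume (Ioo α β ∩ (fun r => |u r|) ⁻¹' Ioi c) = 0 := by
      rw [ae_wt_iff, ae_restrict_iff' measurableSet_Ioc] at h
      refine measure_eq_zero_iff_ae_notMem.2 (h.mono fun r hr hr' => ?_)
      exact absurd (hr (hsub hr'.1) hr'.1) (not_le.2 hr'.2)
    have h2 := ho.eq_empty_of_measure_zero h0
    intro r hr
    by_contra hcon
    have : r ∈ Ioo α β ∩ (fun r => |u r|) ⁻¹' Ioi c := ⟨hr, not_le.1 hcon⟩
    rw [h2] at this
    exact this
  intro r hr hr'
  have hcl : r ∈ closure (Ioo α β) := by rwa [closure_Ioo hαβ.ne]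
  have hne : (𝓝[Ioo α β] r).NeBot := mem_closure_iff_nhdsWithin_neBot.1 hcl
  exact le_of_tendsto ((hu r hr).mono hsub).abs
    (eventually_mem_nhdsWithin.mono fun t ht => h1 t ht)

lemma normalized_mass_eq (hn : 1 ≤ n) (u : ℝ → ℝ) (p : ℝ) :
    (volume (B n)).toReal⁻¹ * ∫ x, |u ‖x‖| ^ (p + 1) ∂(volB n) =
      n * ∫ r, |u r| ^ (p + 1) ∂(wt n) := by
  rw [integral_volB_norm hn (fun r => |u r| ^ (p + 1)), sphereArea_eq]
  have := (volume_B_pos n).ne'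
  field_simp

variable {V : ℝ → ℝ} {R₁ R₂ b c p : ℝ}

/-- Every element of the constraint set has a radial profile of no larger energy. -/
lemma exists_feas_of_mem_K (hn : 1 ≤ n) (hV : Continuous V) (hR₁ : R₁ ∈ Ioc (0 : ℝ) 1)
    (hR₂ : 0 < R₂) (hb : (b = R₂ ∧ R₂ < 1) ∨ (R₂ = 1 ∧ 1 < b)) (hp : 0 ≤ p) {v : E n → ℝ}
    (hv : v ∈ K n R₁ R₂ c p) :
    ∃ u d, Feas n R₁ b c p u d ∧ sphereArea n * form n V u d u d ≤ Q n V v := by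
  obtain ⟨hH, ⟨f, hf⟩, hmass, hbd⟩ := hv
  have hσ := sphereArea_pos hn
  have hgrad : HasH1Grad n v (weakGrad n v) := by
    rw [weakGrad, dif_pos hH]
    exact hH.choose_spec
  obtain ⟨k, hk, hvk⟩ := exists_measurable_profile hn hgrad.1.1 hf
  obtain ⟨hkL, d, hd, hdle, hweak⟩ := exists_weak_radial_deriv hn hgrad hk hvk
  obtain ⟨u, hu, hku⟩ := exists_primitive_of_weak_deriv hkL hd hweak
  have huc := continuousOn_of_primitive hd hu
  have hvu : ∀ᵐ x ∂(volB n), v x = u ‖x‖ := by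
    filter_upwards [hvk, ae_volB_norm hn hku] with x h1 h2
    rw [h1, h2]
  have hae : ∀ᵐ r ∂(wt n), r ∈ Ioo 0 1 → (r < R₁ ∨ R₂ ≤ r) → |u r| ≤ c := by
    -- The bound is stated first for the measurable profile `k`, since bringing it down from the
    -- ball requires a measurable set of radii.
    have h1 : ∀ᵐ r ∂(wt n), r ∈ Ioo (0 : ℝ) 1 → (r < R₁ ∨ R₂ ≤ r) → |k r| ≤ c := by
      refine ae_wt_of_volB hn ?_ ?_
      · have e : {r | r ∈ Ioo (0 : ℝ) 1 → (r < R₁ ∨ R₂ ≤ r) → |k r| ≤ c} =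
            (Ioo 0 1)ᶜ ∪ ((Iio R₁ ∪ Ici R₂)ᶜ ∪ {r | |k r| ≤ c}) := by
          ext r
          simp only [mem_ofPred_eq, mem_union, mem_compl_iff, mem_Iio, mem_Ici]
          tauto
        rw [e]
        exact measurableSet_Ioo.compl.union ((measurableSet_Iio.union measurableSet_Ici).compl.union
          (measurableSet_le hk.abs measurable_const))
      · filter_upwards [hbd, hvk] with x hx hx' h1 h2
        rw [← hx']
        refine hx ?_
        rcases h2 with h2 | h2
        · exact Or.inl (by simpa using h2)
        · refine Or.inr ⟨by simpa [B] using h1.2, by simpa using h2⟩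
    filter_upwards [h1, hku] with r h2 h3
    rwa [← h3]
  have hbound : ∀ r ∈ conSet R₁ b, |u r| ≤ c := by
    rintro r ⟨hr, hr' | hr'⟩
    · exact abs_le_of_ae_wt huc le_rfl hR₁.1 hR₁.2 (hae.mono fun t ht ht' =>
        ht ⟨ht'.1, ht'.2.trans_le hR₁.2⟩ (Or.inl ht'.2)) r hr ⟨hr.1.le, hr'.le⟩
    · rcases hb with ⟨rfl, hb⟩ | ⟨-, hb⟩
      · exact abs_le_of_ae_wt huc hR₂.le hb le_rfl (hae.mono fun t ht ht' =>
          ht ⟨hR₂.trans ht'.1, ht'.2⟩ (Or.inr ht'.1.le)) r hr ⟨hr', hr.2⟩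
      · exact absurd (hb.trans_le hr') (not_lt.2 hr.2)
  have hrad : Rad n u d := by
    refine ⟨hd, hu, ?_⟩
    -- Boundedness is not automatic for finite energy: below `R₁` it comes from the constraint,
    -- above from continuity.
    obtain ⟨M, hM⟩ := (isCompact_Icc (a := R₁) (b := 1)).exists_bound_of_continuousOn
      (huc.mono fun r hr => ⟨hR₁.1.trans_le hr.1, hr.2⟩)
    refine ⟨max c M, fun r hr => ?_⟩
    by_cases h : r < R₁
    · exact (hbound r ⟨hr, Or.inl h⟩).trans (le_max_left _ _)
    · exact (hM r ⟨not_lt.1 h, hr.2⟩).trans (le_max_right _ _)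
  refine ⟨u, d, ⟨hrad, ?_, hbound⟩, ?_⟩
  · have e1 : ∫ x, |v x| ^ (p + 1) ∂(volB n) = ∫ x, |u ‖x‖| ^ (p + 1) ∂(volB n) :=
      integral_congr_ae (hvu.mono fun x hx => by simp only [hx])
    rw [e1, normalized_mass_eq hn] at hmass
    have hp1 : p + 1 ≠ 0 := by linarith
    have hnn : 0 ≤ (n : ℝ) * ∫ r, |u r| ^ (p + 1) ∂(wt n) :=
      mul_nonneg n.cast_nonneg (integral_nonneg fun r => by positivity)
    have h2 := Real.rpow_inv_rpow hnn hp1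
    rw [← one_div, hmass, Real.one_rpow] at h2
    exact h2.le
  · rw [form_eq_add hV hrad hrad, mul_add]
    have i1 : Integrable (fun x => ‖weakGrad n v x‖ ^ 2) (volB n) :=
      hgrad.2.1.integrable_norm_pow'
    have i0 : MemLp (fun r => V r * (u r * u r)) 1 (wt n) :=
      memLp_one_iff_integrable.2 (Rad.integrable_coef_mul hV hrad hrad)
    have i2 : Integrable (fun x : E n => V ‖x‖ * v x ^ 2) (volB n) := by
      refine (memLp_one_iff_integrable.1 (memLp_volB_norm hn i0)).congr ?_
      filter_upwards [hvu] with x hx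
      rw [hx]; ring
    rw [Q, integral_add i1 i2]
    refine add_le_add hdle (le_of_eq ?_)
    rw [← integral_volB_norm hn]
    refine integral_congr_ae ?_
    filter_upwards [hvu] with x hx
    rw [hx]; ring

/-- The relaxed minimizer belongs to the original set because its mass is exactly 1, and each
competitor there has a relaxed profile of no larger energy. -/
theorem isNaturalMinimizer_of_isFeasMin (hn : 1 ≤ n) (hV : Continuous V)
    (hR₁ : R₁ ∈ Ioc (0 : ℝ) 1) (hR₂ : 0 < R₂) (hb : (b = R₂ ∧ R₂ < 1) ∨ (R₂ = 1 ∧ 1 < b))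
    (hp : 0 ≤ p) {w d : ℝ → ℝ} (hw : IsFeasMin n V R₁ b c p w d)
    (hmass : n * ∫ r, |w r| ^ (p + 1) ∂(wt n) = 1)
    (hgrad : HasH1Grad n (fun x => w ‖x‖) (fun x => (d ‖x‖ * ‖x‖⁻¹) • x))
    (hlt : ∀ r ∈ Ico (0 : ℝ) 1, r < R₁ ∨ R₂ ≤ r → |w r| < c) :
    IsNaturalMinimizer n V R₁ R₂ c p (fun x => w ‖x‖) := by
  have hreg : ∀ x ∈ region n R₁ R₂, |w ‖x‖| < c := by
    rintro x (hx | ⟨hx, hx'⟩)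
    · have h1 : ‖x‖ < R₁ := by simpa using hx
      exact hlt _ ⟨norm_nonneg _, h1.trans_le hR₁.2⟩ (Or.inl h1)
    · exact hlt _ ⟨norm_nonneg _, by simpa [B] using hx⟩ (Or.inr (by simpa using hx'))
  refine ⟨⟨⟨_, hgrad⟩, ⟨w, Eventually.of_forall fun _ => rfl⟩, ?_,
    Eventually.of_forall fun x hx => (hreg x hx).le⟩, fun v hv => ?_, hreg⟩
  · rw [normalized_mass_eq hn, hmass, Real.one_rpow]
  · obtain ⟨u, e, hu, hle⟩ := exists_feas_of_mem_K hn hV hR₁ hR₂ hb hp hv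
    rw [Q_radial hn V hgrad]
    exact (mul_le_mul_of_nonneg_left (hw.le u e hu) (sphereArea_pos hn).le).trans hle

end Constraint

/-! ### Norms of radial functions -/

lemma eLpNorm_two_sq {α F : Type*} [MeasurableSpace α] [NormedAddCommGroup F] {μ : Measure α}
    {f : α → F} (hf : MemLp f 2 μ) :
    eLpNorm f 2 μ ^ 2 = ENNReal.ofReal (∫ x, ‖f x‖ ^ 2 ∂μ) := by
  have h0 : 0 ≤ ∫ x, ‖f x‖ ^ 2 ∂μ := integral_nonneg fun x => by positivity
  rw [hf.eLpNorm_eq_integral_rpow_norm two_ne_zero ENNReal.ofNat_ne_top,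
    ← ENNReal.ofReal_pow (Real.rpow_nonneg (integral_nonneg fun x => by positivity) _)]
  congr 1
  simp only [ENNReal.toReal_ofNat, Real.rpow_two]
  rw [← one_div, ← Real.sqrt_eq_rpow, Real.sq_sqrt h0]

lemma h1Norm_radial {n : ℕ} (hn : 1 ≤ n) {u d : ℝ → ℝ}
    (h : HasH1Grad n (fun x => u ‖x‖) (fun x => (d ‖x‖ * ‖x‖⁻¹) • x)) :
    h1Norm n (fun x => u ‖x‖) =
      ENNReal.ofReal (sphereArea n * (∫ r, u r ^ 2 ∂(wt n) + ∫ r, d r ^ 2 ∂(wt n))) ^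
        (1 / 2 : ℝ) := by
  have hm : MemH1 n (fun x => u ‖x‖) := ⟨_, h⟩
  rw [h1Norm, if_pos hm, eLpNorm_congr_ae (weakGrad_ae_eq h), eLpNorm_two_sq h.1,
    eLpNorm_two_sq h.2.1, ← ENNReal.ofReal_add (integral_nonneg fun x => by positivity)
      (integral_nonneg fun x => by positivity), mul_add, ← integral_volB_norm hn,
    ← integral_volB_norm hn]
  congr 3
  · simp
  · refine integral_congr_ae ?_
    filter_upwards [ae_volB_pos hn] with x hx
    rw [norm_mul_inv_smul _ (norm_pos_iff.1 hx.1), sq_abs]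

/-! ### Strict local minima of `F` -/

section LocalMin

variable {n : ℕ} {V φ ψ P S : ℝ → ℝ} {C s : ℝ}

/-- This identity turns a local minimum of `F` into a local minimum of the cost of reaching height
1. -/
lemma F_eq (hn : 1 ≤ n) (hV : Continuous V) (hV0 : ∀ r, 0 ≤ V r)
    (hV1 : ∃ r ∈ Icc (0 : ℝ) 1, V r ≠ 0) (hp : FundPair n V φ ψ P S C) {r : ℝ}
    (hr : r ∈ Ioc (0 : ℝ) 1) : F n V r = sphereArea n * peakEnergy φ ψ C r := by
  have h1 := pow_ne_zero (n - 1) hr.1.ne'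
  have h2 := (hp.φ_pos' hr).ne'
  have h3 := (hp.ψ_pos r hr).ne'
  have h4 := hp.C_pos.ne'
  rw [F, green_eq hn hV hV0 hV1 hp ⟨hr.1.le, hr.2⟩ hr, pairGreen, peakEnergy, min_self, max_self]
  field_simp

lemma green_div_green (hn : 1 ≤ n) (hV : Continuous V) (hV0 : ∀ r, 0 ≤ V r)
    (hV1 : ∃ r ∈ Icc (0 : ℝ) 1, V r ≠ 0) (hp : FundPair n V φ ψ P S C) {r : ℝ}
    (hr : r ∈ Icc (0 : ℝ) 1) (hs : s ∈ Ioc (0 : ℝ) 1) :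
    green n V r s / green n V s s = peak φ ψ s r := by
  have h1 := pow_ne_zero (n - 1) hs.1.ne'
  have h2 := (hp.φ_pos' hs).ne'
  have h3 := (hp.ψ_pos s hs).ne'
  have h4 := hp.C_pos.ne'
  rw [green_eq hn hV hV0 hV1 hp hr hs, green_eq hn hV hV0 hV1 hp ⟨hs.1.le, hs.2⟩ hs, pairGreen,
    pairGreen, peak, min_self, max_self]
  field_simp

lemma deriv_eq_zero_of_eq_on_uIcc {f : ℝ → ℝ} {m r t : ℝ} (hf : HasDerivAt f m t)
    (hne : r ≠ t) (h : ∀ x ∈ uIcc r t, f x = f t) : m = 0 := by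
  have h1 : HasDerivWithinAt f 0 (uIcc r t) t :=
    (hasDerivWithinAt_const t _ (f t)).congr h rfl
  exact (uniqueDiffOn_Icc (min_lt_max.2 hne) t right_mem_uIcc).eq_deriv _
    hf.hasDerivWithinAt h1

/-- If a monotone branch took the value 1 away from the pole it would be constant up to the pole,
and its flux there would vanish. -/
lemma FundPair.peak_lt_one (hp : FundPair n V φ ψ P S C) (hs : s ∈ Ioc (0 : ℝ) 1)
    (hP : P s ≠ 0) (hS : s < 1 → S s ≠ 0) :
    ∀ r ∈ Icc (0 : ℝ) 1, r ≠ s → peak φ ψ s r < 1 := by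
  intro r hr hne
  have hpow := pow_ne_zero (n - 1) hs.1.ne'
  refine lt_of_le_of_ne (hp.peak_le_one hs hr) fun heq => ?_
  rcases lt_or_gt_of_ne hne with h | h
  · rw [hp.peak_of_le hs h.le, div_eq_one_iff_eq (hp.φ_pos' hs).ne'] at heq
    refine div_ne_zero hP hpow (deriv_eq_zero_of_eq_on_uIcc (hp.φ_deriv s hs) hne fun x hx => ?_)
    rw [uIcc_of_le h.le] at hx
    have hx1 : x ∈ Icc (0 : ℝ) 1 := ⟨hr.1.trans hx.1, hx.2.trans hs.2⟩
    have h1 := hp.φ_mono hr hx1 hx.1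
    have h2 := hp.φ_mono hx1 ⟨hs.1.le, hs.2⟩ hx.2
    linarith
  · have hr0 : r ∈ Ioc (0 : ℝ) 1 := ⟨hs.1.trans h, hr.2⟩
    rw [hp.peak_of_ge hs h.le, div_eq_one_iff_eq (hp.ψ_pos s hs).ne'] at heq
    refine div_ne_zero (hS (h.trans_le hr.2)) hpow
      (deriv_eq_zero_of_eq_on_uIcc (hp.ψ_deriv s hs) hne fun x hx => ?_)
    rw [uIcc_of_ge h.le] at hx
    have hx1 : x ∈ Ioc (0 : ℝ) 1 := ⟨hs.1.trans_le hx.1, hx.2.trans hr.2⟩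
    have h1 := hp.ψ_anti hs hx1 hx.1
    have h2 := hp.ψ_anti hx1 hr0 hx.2
    linarith

/-- The potential may vanish on intervals, so the fluxes could be zero in general. At an interior
minimum of `peakEnergy`, however, `φ ψ` is critical: `P ψ + S φ = 0`, while `P ψ - S φ = C > 0`. At
the pole 1, where `S = 0`, the Wronskian alone gives `P = C`. -/
lemma FundPair.flux_ne_zero (hp : FundPair n V φ ψ P S C) (hs : s ∈ Ioc (0 : ℝ) 1)
    (hmin : ∀ᶠ r in 𝓝[Ioc (0 : ℝ) 1 \ {s}] s, peakEnergy φ ψ C s < peakEnergy φ ψ C r) :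
    P s ≠ 0 ∧ (s < 1 → S s ≠ 0) := by
  have hw := hp.wronskian s hs
  have hC := hp.C_pos
  rcases hs.2.lt_or_eq with h1 | h1
  · have hpow := pow_pos hs.1 (n - 1)
    have hd := (hp.φ_deriv s hs).mul (hp.ψ_deriv s hs)
    have hloc : IsLocalMax (φ * ψ) s := by
      rw [eventually_nhdsWithin_iff] at hmin
      filter_upwards [hmin, Ioo_mem_nhds hs.1 h1] with r hr hr'
      by_cases hrs : r = s
      · rw [hrs]
      · have hrm : r ∈ Ioc (0 : ℝ) 1 := ⟨hr'.1, hr'.2.le⟩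
        have h2 := hr ⟨hrm, hrs⟩
        rw [peakEnergy, peakEnergy] at h2
        have p1 := mul_pos (hp.φ_pos' hs) (hp.ψ_pos s hs)
        have p2 := mul_pos (hp.φ_pos' hrm) (hp.ψ_pos r hrm)
        exact ((div_lt_div_iff_of_pos_left hC p1 p2).1 h2).le
    have h0 := hloc.hasDerivAt_eq_zero hd
    have h3 : P s * ψ s + S s * φ s = 0 := by
      field_simp at h0
      linarith
    refine ⟨fun h => ?_, fun _ h => ?_⟩
    · rw [h] at hw h3
      linarith
    · rw [h] at hw h3
      linarith
  · subst h1
    rw [hp.S_one, hp.ψ_one] at hw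
    exact ⟨by intro h; rw [h] at hw; linarith, fun h => absurd h (lt_irrefl _)⟩

theorem exists_setup (hn : 1 ≤ n) (hV : Continuous V) (hV0 : ∀ r, 0 ≤ V r)
    (hV1 : ∃ r ∈ Icc (0 : ℝ) 1, V r ≠ 0) (hp : FundPair n V φ ψ P S C)
    (hs : IsStrictLocalMin (F n V) s) :
    ∃ R₁ R₂ b c, Setup n V φ ψ P S C s R₁ b c ∧ Admissible n V s R₁ R₂ c ∧
      ((b = R₂ ∧ R₂ < 1) ∨ (R₂ = 1 ∧ 1 < b)) := by
  obtain ⟨hs, hmin⟩ := hs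
  have hσ := sphereArea_pos hn
  have hFE : ∀ r ∈ Ioc (0 : ℝ) 1,
      (F n V s < F n V r ↔ peakEnergy φ ψ C s < peakEnergy φ ψ C r) := fun r hr => by
    rw [F_eq hn hV hV0 hV1 hp hs, F_eq hn hV hV0 hV1 hp hr, mul_lt_mul_iff_right₀ hσ]
  have hfl := hp.flux_ne_zero hs (by
    filter_upwards [hmin, self_mem_nhdsWithin] with r hr hr' using (hFE r hr'.1).1 hr)
  have hstrict := hp.peak_lt_one hs hfl.1 hfl.2
  obtain ⟨ε, hε, hball⟩ := Metric.mem_nhdsWithin_iff.1 hmin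
  have hF : ∀ r ∈ Ioc (0 : ℝ) 1, |r - s| < ε → r ≠ s → F n V s < F n V r :=
    fun r hr hrs hne => hball ⟨by simpa [Real.dist_eq] using hrs, hr, hne⟩
  -- Halving keeps the interval inside `(0, 1]` and inside the neighbourhood where the minimum is
  -- strict.
  set R₁ := max (s / 2) (s - ε / 2) with hR₁
  have hR0 : 0 < R₁ := lt_max_of_lt_left (half_pos hs.1)
  have hRs : R₁ < s := max_lt (by linarith [hs.1]) (by linarith)
  have hRε : s - ε < R₁ := lt_max_of_lt_right (by linarith)
  have hRm : R₁ ∈ Icc (0 : ℝ) 1 := ⟨hR0.le, hRs.le.trans hs.2⟩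
  have hin := hstrict R₁ hRm hRs.ne
  have hgr := fun r hr => green_div_green hn hV hV0 hV1 hp (r := r) (s := s) hr hs
  rcases hs.2.lt_or_eq with h1 | h1
  · set R₂ := min ((s + 1) / 2) (s + ε / 2) with hR₂
    have hsR : s < R₂ := lt_min (by linarith) (by linarith)
    have hR1 : R₂ < 1 := min_lt_of_left_lt (by linarith)
    have hR2ε : R₂ < s + ε := min_lt_of_right_lt (by linarith)
    have hR2m : R₂ ∈ Icc (0 : ℝ) 1 := ⟨(hs.1.trans hsR).le, hR1.le⟩
    have hout := hstrict R₂ hR2m hsR.ne'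
    have hF' : ∀ r ∈ Icc R₁ R₂, r ≠ s → F n V s < F n V r := fun r hr hne =>
      hF r ⟨hR0.trans_le hr.1, hr.2.trans hR1.le⟩
        (by rw [abs_lt]; constructor <;> linarith [hr.1, hr.2]) hne
    -- A level midway between 1 and the larger of the two boundary values of the peak.
    set c := (1 + max (peak φ ψ s R₁) (peak φ ψ s R₂)) / 2 with hc
    have hm : max (peak φ ψ s R₁) (peak φ ψ s R₂) < 1 := max_lt hin hout
    have hc1 : c < 1 := by rw [hc]; linarith
    have hcm : max (peak φ ψ s R₁) (peak φ ψ s R₂) < c := by rw [hc]; linarith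
    have hinc := (le_max_left _ _).trans_lt hcm
    have houtc := (le_max_right _ _).trans_lt hcm
    refine ⟨R₁, R₂, R₂, c, ⟨hn, hV, hV0, hp, hs, hR0, hRs, hsR, fun r hr h2 h3 hne => ?_, hstrict,
      hinc, fun _ => houtc, hc1⟩, ⟨hR0, hRs, Or.inl ⟨hsR, hR1, ?_⟩, hF', ?_, hc1⟩,
      Or.inl ⟨rfl, hR1⟩⟩
    · exact (hFE r hr).1 (hF' r ⟨h2, h3⟩ hne)
    · rwa [hgr R₂ hR2m]
    · rwa [hgr R₁ hRm]
  · have hF' : ∀ r ∈ Icc R₁ 1, r ≠ s → F n V s < F n V r := fun r hr hne =>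
      hF r ⟨hR0.trans_le hr.1, hr.2⟩
        (by rw [abs_lt]; constructor <;> linarith [hr.1, hr.2]) hne
    have hc1 : (1 + peak φ ψ s R₁) / 2 < 1 := by linarith
    have hinc : peak φ ψ s R₁ < (1 + peak φ ψ s R₁) / 2 := by linarith
    -- With the pole at 1 there is no outer constraint; `b = 2` makes the outer part of `conSet`
    -- empty.
    refine ⟨R₁, 1, 2, (1 + peak φ ψ s R₁) / 2, ⟨hn, hV, hV0, hp, hs, hR0, hRs, by linarith,
      fun r hr h2 _ hne => ?_, hstrict, hinc, fun h => by norm_num at h, hc1⟩,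
      ⟨hR0, hRs, Or.inr ⟨h1, rfl⟩, hF', ?_, hc1⟩, Or.inr ⟨rfl, one_lt_two⟩⟩
    · exact (hFE r hr).1 (hF' r ⟨h2, hr.2⟩ hne)
    · rwa [hgr R₁ hRm]

end LocalMin

/-! ### Regularity and convergence of the minimizers -/

lemma hasH1Grad_of_rad {n : ℕ} (hn : 1 ≤ n) {u d : ℝ → ℝ} (hu : Rad n u d)
    (hb : ∃ M : ℝ, ∀ᵐ r ∂(wt n), |d r| ≤ M) (hd : ∀ᵐ r ∂(wt n), HasDerivAt u (d r) r) :
    HasH1Grad n (fun x => u ‖x‖) (fun x => (d ‖x‖ * ‖x‖⁻¹) • x) := by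
  obtain ⟨M, hM⟩ := hb
  exact hasH1Grad_radial hn (hu.lipschitzOnWith (M := M.toNNReal)
    (hM.mono fun r hr => hr.trans (Real.le_coe_toNNReal M))) hd

lemma Feas.congr {n : ℕ} {R b c p : ℝ} {u v d : ℝ → ℝ} (h : Feas n R b c p u d)
    (huv : ∀ r ∈ Ioc (0 : ℝ) 1, v r = u r) : Feas n R b c p v d := by
  refine ⟨h.rad.congr huv, ?_, fun r hr => by rw [huv r hr.1]; exact h.bound r hr⟩
  rw [integral_congr_ae (g := fun r => |u r| ^ (p + 1))
    (ae_wt_of_forall fun r hr => by simp only [huv r hr])]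
  exact h.mass

lemma form_congr {n : ℕ} {V u v d : ℝ → ℝ} (huv : ∀ r ∈ Ioc (0 : ℝ) 1, v r = u r) :
    form n V v d v d = form n V u d u d :=
  integral_congr_ae (ae_wt_of_forall fun r hr => by simp only [huv r hr])

lemma IsFeasMin.congr {n : ℕ} {V : ℝ → ℝ} {R b c p : ℝ} {u v d : ℝ → ℝ}
    (h : IsFeasMin n V R b c p u d) (huv : ∀ r ∈ Ioc (0 : ℝ) 1, v r = u r) :
    IsFeasMin n V R b c p v d :=
  ⟨h.toFeas.congr huv, fun z e hz => by rw [form_congr huv]; exact h.le z e hz⟩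

lemma IsFeasMin.neg {n : ℕ} {V : ℝ → ℝ} {R b c p : ℝ} {u d : ℝ → ℝ}
    (h : IsFeasMin n V R b c p u d) :
    IsFeasMin n V R b c p (fun r => - u r) (fun r => - d r) := by
  refine ⟨⟨h.rad.neg, by simpa using h.mass, fun r hr => by simpa using h.bound r hr⟩,
    fun z e hz => ?_⟩
  have : form n V (fun r => - u r) (fun r => - d r) (fun r => - u r) (fun r => - d r) =
      form n V u d u d := by
    unfold form
    congr 1; ext r; ring
  rw [this]
  exact h.le z e hz

/-- A minimizer, nonnegative at `s`, which is a regular solution of its Euler equation. -/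
structure IsRegMin (n : ℕ) (V : ℝ → ℝ) (s R b c p : ℝ) (w d h : ℝ → ℝ) (a : ℝ) : Prop where
  isFeasMin : IsFeasMin n V R b c p w d
  nonneg : 0 ≤ w s
  eq : w = radialSol n h a
  cont : Continuous h
  equation : ∀ r ∈ Icc (0 : ℝ) 1, h r = V r * w r - n * form n V w d w d * sgnPow p (w r)
  flux_one : ballAvg n h 1 = 0
  deriv_eq : ∀ᵐ t ∂(wt n), d t = t * ballAvg n h t

namespace IsRegMin

variable {n : ℕ} {V : ℝ → ℝ} {s R b c p : ℝ} {w d h : ℝ → ℝ} {a : ℝ}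

lemma continuous (hw : IsRegMin n V s R b c p w d h a) : Continuous w := by
  rw [hw.eq]
  exact continuous_radialSol n hw.cont a

lemma ae_hasDerivAt (hw : IsRegMin n V s R b c p w d h a) :
    ∀ᵐ r ∂(wt n), HasDerivAt w (d r) r := by
  filter_upwards [hw.deriv_eq] with r hr
  rw [hr, hw.eq]
  exact hasDerivAt_radialSol n hw.cont a r

lemma exists_bound_deriv (hw : IsRegMin n V s R b c p w d h a) :
    ∃ M : ℝ, ∀ᵐ r ∂(wt n), |d r| ≤ M := by
  have hc : Continuous fun t => t * ballAvg n h t :=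
    continuous_id.mul (continuous_ballAvg n hw.cont)
  obtain ⟨M, hM⟩ := (isCompact_Icc (a := (0 : ℝ)) (b := 1)).exists_bound_of_continuousOn
    hc.continuousOn
  refine ⟨M, ?_⟩
  filter_upwards [hw.deriv_eq, ae_wt_of_forall (n := n) fun r hr => hr] with r hr hr'
  rw [hr]
  exact hM r ⟨hr'.1.le, hr'.2⟩

end IsRegMin

namespace Setup

variable {n : ℕ} {V φ ψ P S : ℝ → ℝ} {C s R b c : ℝ}

/-- A minimizer or its negative is nonnegative at the pole. It is replaced by the regular solution
equal to it on `(0, 1]`, which also fixes its value at the origin. -/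
theorem eventually_exists_isRegMin (H : Setup n V φ ψ P S C s R b c) :
    ∀ᶠ p in atTop, ∃ z : ((ℝ → ℝ) × (ℝ → ℝ)) × ((ℝ → ℝ) × ℝ),
      IsRegMin n V s R b c p z.1.1 z.1.2 z.2.1 z.2.2 := by
  filter_upwards [H.eventually_energy_le one_pos, H.eventually_natural, eventually_ge_atTop 1]
    with p h1 h2 hp
  obtain ⟨w, d, hw, hws⟩ : ∃ w d, IsFeasMin n V R b c p w d ∧ 0 ≤ w s := by
    obtain ⟨w, d, hw⟩ := H.pair.exists_isFeasMin H.cont H.nonneg H.R_mem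
      (zero_le_one.trans hp) h1.1
    rcases le_total 0 (w s) with h | h
    · exact ⟨w, d, hw, h⟩
    · exact ⟨_, _, hw.neg, by simpa using h⟩
  obtain ⟨-, -, -, hEL⟩ := h2 w d hw hws
  obtain ⟨h, a, hh, heq, hode, hflux, hd⟩ := exists_radialSol H.one_le H.cont hp hw.rad hEL
  refine ⟨((radialSol n h a, d), (h, a)), hw.congr heq, ?_, rfl, hh, fun r hr => ?_, hflux, hd⟩
  · simp only
    rw [heq s H.mem]
    exact hws
  · simp only
    rw [form_congr heq]
    exact hode r hr

end Setup

/-! ### Convergence -/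

lemma HasH1Grad.congr {n : ℕ} {u v : E n → ℝ} {g : E n → E n} (h : HasH1Grad n u g)
    (huv : u =ᵐ[volB n] v) : HasH1Grad n v g := by
  refine ⟨h.1.ae_eq huv, h.2.1, fun φ hφ hc hs i => ?_⟩
  rw [← h.2.2 φ hφ hc hs i]
  exact integral_congr_ae (huv.mono fun x hx => by simp only [hx])

lemma h1Norm_congr {n : ℕ} {u v : E n → ℝ} {g : E n → E n} (h : HasH1Grad n u g)
    (huv : u =ᵐ[volB n] v) : h1Norm n u = h1Norm n v := by
  have h' := h.congr huv
  have hu : MemH1 n u := ⟨g, h⟩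
  have hv : MemH1 n v := ⟨g, h'⟩
  rw [h1Norm, h1Norm, if_pos hu, if_pos hv, eLpNorm_congr_ae huv,
    eLpNorm_congr_ae (weakGrad_ae_eq h), eLpNorm_congr_ae (weakGrad_ae_eq h')]

lemma FundPair.hasH1Grad_peak {n : ℕ} {V φ ψ P S : ℝ → ℝ} {C s : ℝ} (hn : 1 ≤ n)
    (hp : FundPair n V φ ψ P S C) (hV : Continuous V) (hs : s ∈ Ioc (0 : ℝ) 1) :
    (∃ M : ℝ, ∀ᵐ r ∂(wt n), |deriv (peak φ ψ s) r| ≤ M) ∧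
    (∀ᵐ r ∂(wt n), HasDerivAt (peak φ ψ s) (deriv (peak φ ψ s) r) r) ∧
    HasH1Grad n (fun x => peak φ ψ s ‖x‖)
      (fun x => (deriv (peak φ ψ s) ‖x‖ * ‖x‖⁻¹) • x) := by
  have hae : ∀ᵐ r ∂(wt n), r ∈ Ioo (0 : ℝ) 1 ∧ r ≠ s := by
    rw [ae_wt_iff, ← Measure.restrict_congr_set Ioo_ae_eq_Ioc]
    filter_upwards [ae_restrict_mem measurableSet_Ioo,
      ae_restrict_of_ae (Measure.ae_ne volume s)] with r h1 h2 using ⟨h1, h2⟩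
  obtain ⟨M, hM⟩ := hp.bound_deriv_peak hV hs
  have h1 : ∃ M : ℝ, ∀ᵐ r ∂(wt n), |deriv (peak φ ψ s) r| ≤ M :=
    ⟨M, hae.mono fun r hr => hM r hr.1 hr.2⟩
  have h2 : ∀ᵐ r ∂(wt n), HasDerivAt (peak φ ψ s) (deriv (peak φ ψ s) r) r :=
    hae.mono fun r hr => hp.hasDerivAt_peak hs hr.1 hr.2
  exact ⟨h1, h2, hasH1Grad_of_rad hn (hp.rad_peak hV hs) h1 h2⟩

namespace Setup

variable {n : ℕ} {V φ ψ P S : ℝ → ℝ} {C s R b c : ℝ} {w d h : ℝ → ℝ → ℝ} {a : ℝ → ℝ}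

lemma eventually_close_Icc (H : Setup n V φ ψ P S C s R b c)
    (hw : ∀ᶠ p in atTop, IsRegMin n V s R b c p (w p) (d p) (h p) (a p)) {ε : ℝ} (hε : 0 < ε) :
    ∀ᶠ p in atTop, ∀ r ∈ Icc (0 : ℝ) 1, |w p r - peak φ ψ s r| ≤ ε := by
  filter_upwards [hw, H.eventually_close hε] with p hp hc r hr
  have hcont : ContinuousOn (fun r => |w p r - peak φ ψ s r|) (Icc 0 1) :=
    (hp.continuous.continuousOn.sub (H.pair.continuousOn_peak H.mem)).abs
  have hcl : r ∈ closure (Ioo (0 : ℝ) 1) := by rwa [closure_Ioo zero_ne_one]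
  have hne : (𝓝[Ioo 0 1] r).NeBot := mem_closure_iff_nhdsWithin_neBot.1 hcl
  exact le_of_tendsto ((hcont r hr).mono Ioo_subset_Icc_self)
    (eventually_mem_nhdsWithin.mono fun t ht =>
      hc _ _ hp.isFeasMin hp.nonneg t ⟨ht.1, ht.2.le⟩)

lemma tendsto_eval (H : Setup n V φ ψ P S C s R b c)
    (hw : ∀ᶠ p in atTop, IsRegMin n V s R b c p (w p) (d p) (h p) (a p)) :
    Tendsto (fun p => w p s - 1) atTop (𝓝 0) := by
  rw [Metric.tendsto_nhds]
  intro ε hε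
  filter_upwards [H.eventually_close_Icc hw (half_pos hε)] with p hp
  have := hp s ⟨H.mem.1.le, H.mem.2⟩
  rw [H.pair.peak_self H.mem] at this
  rw [Real.dist_eq, sub_zero]
  linarith

lemma tendsto_form_sub (H : Setup n V φ ψ P S C s R b c)
    (hw : ∀ᶠ p in atTop, IsRegMin n V s R b c p (w p) (d p) (h p) (a p)) :
    Tendsto (fun p => form n V (fun r => w p r - peak φ ψ s r)
      (fun r => d p r - deriv (peak φ ψ s) r) (fun r => w p r - peak φ ψ s r)
      (fun r => d p r - deriv (peak φ ψ s) r)) atTop (𝓝 0) := by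
  rw [Metric.tendsto_nhds]
  intro ε hε
  filter_upwards [hw, H.eventually_energy_close (half_pos hε)] with p hp hc
  rw [Real.dist_eq, sub_zero, abs_of_nonneg (form_self_nonneg H.nonneg)]
  linarith [hc _ _ hp.isFeasMin hp.nonneg]

lemma tendsto_form (H : Setup n V φ ψ P S C s R b c)
    (hw : ∀ᶠ p in atTop, IsRegMin n V s R b c p (w p) (d p) (h p) (a p)) :
    Tendsto (fun p => form n V (w p) (d p) (w p) (d p)) atTop (𝓝 (peakEnergy φ ψ C s)) := by
  have h1 := ((H.tendsto_form_sub hw).add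
    ((H.tendsto_eval hw).const_mul (2 * peakEnergy φ ψ C s))).add_const (peakEnergy φ ψ C s)
  rw [mul_zero, add_zero, zero_add] at h1
  refine h1.congr' (hw.mono fun p hp => ?_)
  rw [form_sub_self H.cont hp.isFeasMin.rad H.rad_peak, 
    form_comm n V (w p) (d p) (peak φ ψ s), H.pair.form_peak H.cont H.mem hp.isFeasMin.rad,
    H.pair.form_peak_self H.cont H.mem]
  ring

/-- The factor turning a minimizer into a solution. -/
def factor (n : ℕ) (V : ℝ → ℝ) (w d : ℝ → ℝ → ℝ) (p : ℝ) : ℝ :=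
  (n * form n V (w p) (d p) (w p) (d p)) ^ (1 / (p - 1))

lemma energy_limit_pos (H : Setup n V φ ψ P S C s R b c) : 0 < n * peakEnergy φ ψ C s := by
  have : (0 : ℝ) < n := by exact_mod_cast H.one_le
  exact mul_pos this (H.pair.peakEnergy_pos H.mem)

lemma eventually_factor_pos (H : Setup n V φ ψ P S C s R b c)
    (hw : ∀ᶠ p in atTop, IsRegMin n V s R b c p (w p) (d p) (h p) (a p)) :
    ∀ᶠ p in atTop, 0 < n * form n V (w p) (d p) (w p) (d p) :=
  ((H.tendsto_form hw).const_mul (n : ℝ)).eventually_const_lt H.energy_limit_pos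

/-- The base tends to the positive number `n Γ(s)` and the exponent tends to 0. -/
lemma tendsto_factor (H : Setup n V φ ψ P S C s R b c)
    (hw : ∀ᶠ p in atTop, IsRegMin n V s R b c p (w p) (d p) (h p) (a p)) :
    Tendsto (factor n V w d) atTop (𝓝 1) := by
  have h1 := (H.tendsto_form hw).const_mul (n : ℝ)
  have h2 : Tendsto (fun p : ℝ => 1 / (p - 1)) atTop (𝓝 0) := by
    simp only [one_div]
    exact tendsto_inv_atTop_zero.comp (tendsto_atTop_add_const_right _ (-1) tendsto_id)
  have h3 := h1.rpow h2 (Or.inl H.energy_limit_pos.ne')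
  rwa [Real.rpow_zero] at h3

lemma eventually_close_factor (H : Setup n V φ ψ P S C s R b c)
    (hw : ∀ᶠ p in atTop, IsRegMin n V s R b c p (w p) (d p) (h p) (a p)) {ε : ℝ} (hε : 0 < ε) :
    ∀ᶠ p in atTop, ∀ r ∈ Icc (0 : ℝ) 1,
      |factor n V w d p * w p r - peak φ ψ s r| ≤ ε := by
  have h1 := (H.tendsto_factor hw).eventually
    (Metric.ball_mem_nhds 1 (lt_min (half_pos hε) one_pos))
  filter_upwards [h1, H.eventually_close_Icc hw (show 0 < ε / 4 by linarith)] with p hp hc r hr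
  rw [Real.dist_eq, lt_min_iff] at hp
  have h2 := hc r hr
  have h3 := H.pair.peak_le_one H.mem hr
  have h4 := (H.pair.peak_pos H.mem hr).le
  have h5 : |factor n V w d p| ≤ 2 := by
    have := abs_sub_abs_le_abs_sub (factor n V w d p) 1
    rw [abs_one] at this
    linarith [hp.2]
  have h6 : factor n V w d p * w p r - peak φ ψ s r = factor n V w d p *
      (w p r - peak φ ψ s r) + (factor n V w d p - 1) * peak φ ψ s r := by ring
  have h7 : |factor n V w d p * (w p r - peak φ ψ s r)| ≤ 2 * (ε / 4) := by
    rw [abs_mul]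
    exact mul_le_mul h5 h2 (abs_nonneg _) zero_le_two
  have h8 : |(factor n V w d p - 1) * peak φ ψ s r| ≤ ε / 2 * 1 := by
    rw [abs_mul, abs_of_nonneg h4]
    exact mul_le_mul hp.1.le h3 h4 (half_pos hε).le
  rw [h6]
  exact (abs_add_le _ _).trans (by linarith)

lemma hasH1Grad_diff (H : Setup n V φ ψ P S C s R b c) {p : ℝ}
    (hp : IsRegMin n V s R b c p (w p) (d p) (h p) (a p)) (κ : ℝ) :
    Rad n (fun r => κ * w p r - peak φ ψ s r) (fun r => κ * d p r - deriv (peak φ ψ s) r) ∧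
    HasH1Grad n (fun x => κ * w p ‖x‖ - peak φ ψ s ‖x‖)
      (fun x => ((κ * d p ‖x‖ - deriv (peak φ ψ s) ‖x‖) * ‖x‖⁻¹) • x) := by
  obtain ⟨⟨M, hM⟩, h2, -⟩ := H.pair.hasH1Grad_peak H.one_le H.cont H.mem
  obtain ⟨N, hN⟩ := hp.exists_bound_deriv
  have hr := (hp.isFeasMin.rad.const_mul κ).sub H.rad_peak
  refine ⟨hr, hasH1Grad_of_rad H.one_le hr ⟨|κ| * N + M, ?_⟩ ?_⟩
  · filter_upwards [hM, hN] with r h3 h4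
    refine (abs_sub _ _).trans (add_le_add ?_ h3)
    rw [abs_mul]
    exact mul_le_mul_of_nonneg_left h4 (abs_nonneg _)
  · filter_upwards [h2, hp.ae_hasDerivAt] with r h3 h4
    exact (h4.const_mul κ).sub h3

lemma hasH1Grad_mul (H : Setup n V φ ψ P S C s R b c) {p : ℝ}
    (hp : IsRegMin n V s R b c p (w p) (d p) (h p) (a p)) (κ : ℝ) :
    HasH1Grad n (fun x => κ * w p ‖x‖) (fun x => (κ * d p ‖x‖ * ‖x‖⁻¹) • x) := by
  obtain ⟨N, hN⟩ := hp.exists_bound_deriv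
  refine hasH1Grad_of_rad H.one_le (hp.isFeasMin.rad.const_mul κ) ⟨|κ| * N, ?_⟩ ?_
  · filter_upwards [hN] with r h4
    rw [abs_mul]
    exact mul_le_mul_of_nonneg_left h4 (abs_nonneg _)
  · filter_upwards [hp.ae_hasDerivAt] with r h4
    exact h4.const_mul κ

/-- Uniform convergence handles the functions. For the derivatives, the potential term is
nonnegative, so their `L²` distance is at most the energy of the difference. -/
lemma tendsto_h1_sq (H : Setup n V φ ψ P S C s R b c)
    (hw : ∀ᶠ p in atTop, IsRegMin n V s R b c p (w p) (d p) (h p) (a p)) :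
    Tendsto (fun p => ∫ r, (factor n V w d p * w p r - peak φ ψ s r) ^ 2 ∂(wt n) +
      ∫ r, (factor n V w d p * d p r - deriv (peak φ ψ s) r) ^ 2 ∂(wt n)) atTop (𝓝 0) := by
  have hn1 : (1 : ℝ) ≤ n := by exact_mod_cast H.one_le
  have t1 : Tendsto (fun p => ∫ r, (factor n V w d p * w p r - peak φ ψ s r) ^ 2 ∂(wt n))
      atTop (𝓝 0) := by
    rw [Metric.tendsto_nhds]
    intro ε hε
    have hm : 0 < min (ε / 2) 1 := lt_min (half_pos hε) one_pos
    filter_upwards [hw, H.eventually_close_factor hw hm] with p hp hc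
    have hnn : 0 ≤ ∫ r, (factor n V w d p * w p r - peak φ ψ s r) ^ 2 ∂(wt n) :=
      integral_nonneg fun r => sq_nonneg _
    rw [Real.dist_eq, sub_zero, abs_of_nonneg hnn]
    have hb : ∀ r ∈ Ioc (0 : ℝ) 1,
        (factor n V w d p * w p r - peak φ ψ s r) ^ 2 ≤ ε / 2 := fun r hr => by
      have h1 := hc r ⟨hr.1.le, hr.2⟩
      have h2 := h1.trans (min_le_left _ _)
      have h3 := h1.trans (min_le_right _ _)
      rw [← sq_abs]
      nlinarith [abs_nonneg (factor n V w d p * w p r - peak φ ψ s r)]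
    have h4 : ∫ r, (factor n V w d p * w p r - peak φ ψ s r) ^ 2 ∂(wt n) ≤
        ∫ _, ε / 2 ∂(wt n) := by
      refine integral_mono_ae ?_ (integrable_const _) (ae_wt_of_forall hb)
      refine integrable_wt (M := ε / 2) ?_ fun r hr => ?_
      · exact ((H.hasH1Grad_diff hp _).1.continuousOn).pow 2
      · rw [abs_of_nonneg (sq_nonneg _)]
        exact hb r hr
    rw [integral_wt_const H.one_le] at h4
    have h5 : ε / 2 / n ≤ ε / 2 := div_le_self (half_pos hε).le hn1
    linarith
  have t2 : Tendsto (fun p => ∫ r, (factor n V w d p * d p r - deriv (peak φ ψ s) r) ^ 2 ∂(wt n))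
      atTop (𝓝 0) := by
    have hκ := H.tendsto_factor hw
    have hκ1 : Tendsto (fun p => factor n V w d p - 1) atTop (𝓝 0) := by
      simpa using hκ.sub_const 1
    have hlim := (((hκ.pow 2).mul (H.tendsto_form_sub hw)).add
      (((hκ1.mul hκ).mul (H.tendsto_eval hw)).const_mul (2 * peakEnergy φ ψ C s))).add
      ((hκ1.pow 2).mul_const (peakEnergy φ ψ C s))
    simp only [mul_zero, add_zero, ne_eq, OfNat.ofNat_ne_zero, not_false_eq_true, zero_pow,
      zero_mul] at hlim
    refine squeeze_zero' (Eventually.of_forall fun p => integral_nonneg fun r => sq_nonneg _)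
      (hw.mono fun p hp => ?_) hlim
    set κ := factor n V w d p with hκdef
    have hz := H.rad_peak
    have hD := hp.isFeasMin.rad.sub hz
    have hrad := (H.hasH1Grad_diff hp κ).1
    -- Split the difference as `κ (w - peak) + (κ - 1) peak`; the cross term is an evaluation at the
    -- pole.
    have e1 : form n V (fun r => κ * w p r - peak φ ψ s r)
        (fun r => κ * d p r - deriv (peak φ ψ s) r) (fun r => κ * w p r - peak φ ψ s r)
        (fun r => κ * d p r - deriv (peak φ ψ s) r) = κ ^ 2 * form n V
        (fun r => w p r - peak φ ψ s r) (fun r => d p r - deriv (peak φ ψ s) r)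
        (fun r => w p r - peak φ ψ s r) (fun r => d p r - deriv (peak φ ψ s) r) +
        2 * peakEnergy φ ψ C s * ((κ - 1) * κ * (w p s - 1)) +
        (κ - 1) ^ 2 * peakEnergy φ ψ C s := by
      have e2 := form_add_mul_self H.cont (hD.const_mul κ) hz (κ - 1)
      have e3 : ∀ x y : ℝ, κ * (x - y) + (κ - 1) * y = κ * x - y := fun x y => by ring
      simp only [e3] at e2
      rw [e2, form_smul_self, form_const_mul_left, form_comm n V _ _ (peak φ ψ s),
        H.pair.form_peak H.cont H.mem hD, H.pair.form_peak_self H.cont H.mem,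
        H.pair.peak_self H.mem]
      ring
    rw [← e1, form_eq_add H.cont hrad hrad]
    simp only [sq]
    refine le_add_of_nonneg_right (integral_nonneg fun r => ?_)
    exact mul_nonneg (H.nonneg r) (mul_self_nonneg _)
  simpa using t1.add t2

theorem tendstoH1 (H : Setup n V φ ψ P S C s R b c)
    (hw : ∀ᶠ p in atTop, IsRegMin n V s R b c p (w p) (d p) (h p) (a p)) {q : E n → ℝ}
    (hq : ∀ᵐ x ∂(volB n), q x = peak φ ψ s ‖x‖) :
    TendstoH1 n (fun p x => factor n V w d p * w p ‖x‖) q := by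
  have hpk := (H.pair.hasH1Grad_peak H.one_le H.cont H.mem).2.2
  refine ⟨hw.mono fun p hp => ⟨_, H.hasH1Grad_mul hp _⟩,
    ⟨_, hpk.congr (hq.mono fun x hx => hx.symm)⟩, ?_⟩
  have h1 := (H.tendsto_h1_sq hw).const_mul (sphereArea n)
  have h2 := (ENNReal.continuous_rpow_const (y := 1 / 2)).tendsto _ |>.comp
    ((ENNReal.continuous_ofReal.tendsto _).comp h1)
  have h0 : ENNReal.ofReal (sphereArea n * 0) ^ (1 / 2 : ℝ) = 0 := by simp
  rw [h0] at h2
  refine h2.congr' (hw.mono fun p hp => ?_)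
  have h3 := (H.hasH1Grad_diff hp (factor n V w d p)).2
  exact (h1Norm_radial H.one_le h3).symm.trans
    (h1Norm_congr h3 (hq.mono fun x hx => by simp only [hx]))

theorem tendstoLinfty (H : Setup n V φ ψ P S C s R b c)
    (hw : ∀ᶠ p in atTop, IsRegMin n V s R b c p (w p) (d p) (h p) (a p)) {q : E n → ℝ}
    (hq : ∀ᵐ x ∂(volB n), q x = peak φ ψ s ‖x‖) :
    TendstoLinfty n (fun p x => factor n V w d p * w p ‖x‖) q := by
  refine ⟨hw.mono fun p hp => ?_, ?_, ?_⟩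
  · have hr := hp.isFeasMin.rad.const_mul (factor n V w d p)
    obtain ⟨M, hM⟩ := hr.bdd
    exact memLp_volB_norm H.one_le (memLp_wt ∞ hr.continuousOn hM)
  · obtain ⟨M, hM⟩ := H.rad_peak.bdd
    exact (memLp_volB_norm H.one_le (memLp_wt ∞ H.rad_peak.continuousOn hM)).ae_eq
      (hq.mono fun x hx => hx.symm)
  · rw [ENNReal.tendsto_nhds_zero]
    intro ε hε
    obtain ⟨δ, -, hδ0, hδ⟩ := ENNReal.lt_iff_exists_real_btwn.1 hε
    have hδ0 : 0 < δ := by simpa using hδ0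
    filter_upwards [H.eventually_close_factor hw hδ0] with p hp
    rw [eLpNorm_exponent_top]
    refine (eLpNormEssSup_le_of_ae_bound (C := δ) ?_).trans hδ.le
    filter_upwards [hq, ae_volB_pos H.one_le] with x hx hx'
    rw [hx]
    exact hp _ ⟨hx'.1.le, hx'.2.le⟩

/-- Positivity comes from uniform closeness to the peak, whose minimum on `[0, 1]` is positive; no
maximum principle is needed. -/
theorem eventually_isNeumannSolution (H : Setup n V φ ψ P S C s R b c)
    (hw : ∀ᶠ p in atTop, IsRegMin n V s R b c p (w p) (d p) (h p) (a p)) :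
    ∀ᶠ p in atTop, IsNeumannSolution n V p (fun x => factor n V w d p * w p ‖x‖) := by
  obtain ⟨r₀, hr₀, hmin⟩ := isCompact_Icc.exists_isMinOn (nonempty_Icc.2 zero_le_one)
    (H.pair.continuousOn_peak H.mem)
  have hm := H.pair.peak_pos H.mem hr₀
  filter_upwards [hw, H.eventually_factor_pos hw, H.eventually_close_Icc hw (half_pos hm),
    eventually_gt_atTop 1] with p hp hl hc hp1
  have hpos : ∀ r ∈ Icc (0 : ℝ) 1, 0 < w p r := fun r hr => by
    have h1 := (abs_le.1 (hc r hr)).1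
    have h2 : peak φ ψ s r₀ ≤ peak φ ψ s r := hmin hr
    linarith
  have hκ : 0 < factor n V w d p := Real.rpow_pos_of_pos hl _
  -- This relation absorbs the multiplier into the `p`-th power when the equation for `w` is
  -- multiplied by the factor.
  have hκp : factor n V w d p ^ p =
      factor n V w d p * (n * form n V (w p) (d p) (w p) (d p)) := by
    have h1 : factor n V w d p ^ (p - 1) = n * form n V (w p) (d p) (w p) (d p) := by
      rw [factor, ← Real.rpow_mul hl.le, one_div_mul_cancel (by linarith), Real.rpow_one]
    rw [← h1, ← Real.rpow_one_add' hκ.le (by linarith)]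
    congr 1; ring
  have hC2 : ContDiff ℝ 2 (fun x : E n => w p ‖x‖) := by
    rw [hp.eq]
    exact contDiff_radialSol H.one_le hp.cont (a p)
  have hmem : ∀ x ∈ B n, ‖x‖ ∈ Icc (0 : ℝ) 1 := fun x hx =>
    ⟨norm_nonneg _, by simpa [B] using (Metric.mem_ball.1 hx).le⟩
  refine ⟨(contDiff_const.mul hC2).contDiffOn, fun x hx => ?_,
    fun x hx => mul_pos hκ (hpos _ (hmem x hx)), fun x hx => ?_⟩
  · have h1 : Laplacian.laplacian (fun x : E n => factor n V w d p * w p ‖x‖) x =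
        factor n V w d p * h p ‖x‖ := by
      have h2 := InnerProductSpace.laplacian_smul (factor n V w d p) (hC2.contDiffAt (x := x))
      have h3 : Laplacian.laplacian (fun x : E n => w p ‖x‖) x = h p ‖x‖ := by
        rw [hp.eq]
        exact laplacian_radialSol H.one_le hp.cont (a p) x
      rw [h3] at h2
      exact h2
    have hwx := hpos _ (hmem x hx)
    rw [h1, hp.equation _ (hmem x hx), sgnPow_of_nonneg hp1.le hwx.le,
      Real.mul_rpow hκ.le hwx.le, hκp]
    ring
  · have hx1 : ‖x‖ = 1 := by simpa using hx
    have h1 : HasFDerivAt (fun x : E n => factor n V w d p * w p ‖x‖)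
        (factor n V w d p • ballAvg n (h p) ‖x‖ • innerSL ℝ x) x := by
      rw [hp.eq]
      exact (hasFDerivAt_radialSol hp.cont (a p) x).const_mul _
    have hu : UniqueDiffWithinAt ℝ (Metric.closedBall (0 : E n) 1) x :=
      uniqueDiffOn_convex (convex_closedBall 0 1)
        ⟨0, by rw [interior_closedBall _ one_ne_zero]; exact Metric.mem_ball_self one_pos⟩ x
        (Metric.sphere_subset_closedBall hx)
    rw [h1.hasFDerivWithinAt.fderivWithin hu, hx1, hp.flux_one]
    simp

theorem eventually_isNaturalMinimizer (H : Setup n V φ ψ P S C s R b c) {R₂ : ℝ}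
    (hR₂ : 0 < R₂) (hb : (b = R₂ ∧ R₂ < 1) ∨ (R₂ = 1 ∧ 1 < b))
    (hw : ∀ᶠ p in atTop, IsRegMin n V s R b c p (w p) (d p) (h p) (a p)) :
    ∀ᶠ p in atTop, ∃ t : ℝ, 0 < t ∧ IsNaturalMinimizer n V R R₂ c p
      (fun x => t * (factor n V w d p * w p ‖x‖)) := by
  have hε : 0 < (c - peak φ ψ s R) / 2 := by linarith [H.inner]
  filter_upwards [hw, H.eventually_factor_pos hw, H.eventually_close_Icc hw hε,
    H.eventually_natural, eventually_ge_atTop 0] with p hp hl hc hnat hp0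
  obtain ⟨hlt, -, hmass, -⟩ := hnat _ _ hp.isFeasMin hp.nonneg
  have hκ : 0 < factor n V w d p := Real.rpow_pos_of_pos hl _
  refine ⟨(factor n V w d p)⁻¹, inv_pos.2 hκ, ?_⟩
  have e : (fun x : E n => (factor n V w d p)⁻¹ * (factor n V w d p * w p ‖x‖)) =
      fun x => w p ‖x‖ := by
    ext x; rw [inv_mul_cancel_left₀ hκ.ne']
  rw [e]
  have hgrad : HasH1Grad n (fun x => w p ‖x‖) (fun x => (d p ‖x‖ * ‖x‖⁻¹) • x) := by
    simpa using H.hasH1Grad_mul hp 1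
  refine isNaturalMinimizer_of_isFeasMin H.one_le H.cont H.R_mem hR₂ hb hp0 hp.isFeasMin hmass
    hgrad fun r hr hr' => ?_
  -- The origin is not in `conSet`, so its bound comes from uniform closeness and `peak 0 ≤ peak R <
  -- c`.
  rcases hr.1.eq_or_lt with h0 | h0
  · subst h0
    have h1 := hc 0 ⟨le_rfl, zero_le_one⟩
    have hφ := (H.pair.φ_pos' H.mem)
    have h2 : peak φ ψ s 0 ≤ peak φ ψ s R := by
      rw [H.pair.peak_of_le H.mem H.mem.1.le, H.pair.peak_of_le H.mem H.R_lt.le]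
      exact div_le_div_of_nonneg_right (H.pair.φ_mono ⟨le_rfl, zero_le_one⟩
        ⟨H.R_pos.le, H.R_mem.2⟩ H.R_pos.le) hφ.le
    have h3 := (H.pair.peak_pos H.mem (r := 0) ⟨le_rfl, zero_le_one⟩)
    have h4 := abs_sub_abs_le_abs_sub (w p 0) (peak φ ψ s 0)
    rw [abs_of_pos h3] at h4
    linarith [H.inner]
  · refine hlt r ⟨⟨h0, hr.2.le⟩, hr'.imp_right fun h2 => ?_⟩
    rcases hb with ⟨rfl, -⟩ | ⟨h3, -⟩
    · exact h2
    · exact absurd (h3 ▸ h2) (not_le.2 hr.2)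

end Setup

/-! ### Continuous potentials on the line -/

theorem exists_solutions {n : ℕ} (hn : 1 ≤ n) {V : ℝ → ℝ} (hV : Continuous V)
    (hV0 : ∀ r, 0 ≤ V r) (hV1 : ∃ r ∈ Icc (0 : ℝ) 1, V r ≠ 0) {s : ℝ}
    (hs : IsStrictLocalMin (F n V) s) :
    ∃ u : ℝ → ℝ → ℝ,
      (∀ᶠ p in atTop, IsNeumannSolution n V p (fun x : E n => u p ‖x‖)) ∧
      TendstoH1 n (fun p x => u p ‖x‖) (profile n V s) ∧
      TendstoLinfty n (fun p x => u p ‖x‖) (profile n V s) ∧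
      ∃ R₁ R₂ c : ℝ, Admissible n V s R₁ R₂ c ∧
        ∀ᶠ p in atTop, ∃ t : ℝ, 0 < t ∧
          IsNaturalMinimizer n V R₁ R₂ c p (fun x : E n => t * u p ‖x‖) := by
  obtain ⟨φ, ψ, P, S, C, hp⟩ := exists_fundPair hn hV hV0 hV1
  obtain ⟨R₁, R₂, b, c, H, hA, hb⟩ := exists_setup hn hV hV0 hV1 hp hs
  obtain ⟨z, hz⟩ := H.eventually_exists_isRegMin.choice
  have hw : ∀ᶠ p in atTop, IsRegMin n V s R₁ b c p ((fun p => (z p).1.1) p)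
      ((fun p => (z p).1.2) p) ((fun p => (z p).2.1) p) ((fun p => (z p).2.2) p) := hz
  have hq : ∀ᵐ x ∂(volB n), profile n V s x = peak φ ψ s ‖x‖ := by
    filter_upwards [ae_volB_pos hn] with x hx
    exact green_div_green hn hV hV0 hV1 hp ⟨hx.1.le, hx.2.le⟩ hs.1
  have hR₂ : 0 < R₂ := by
    rcases hA.outer with h | h
    · exact hs.1.1.trans h.1
    · rw [h.2]; exact one_pos
  exact ⟨fun p r => Setup.factor n V (fun p => (z p).1.1) (fun p => (z p).1.2) p * (z p).1.1 r,
    H.eventually_isNeumannSolution hw, H.tendstoH1 hw hq, H.tendstoLinfty hw hq, R₁, R₂, c, hA,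
    H.eventually_isNaturalMinimizer hR₂ hb hw⟩

/-! ### Dependence on the potential -/

section Congr

variable {n : ℕ} {V W : ℝ → ℝ}

lemma isGreenAt_congr (h : EqOn V W (Icc 0 1)) (s : ℝ) : IsGreenAt n V s = IsGreenAt n W s := by
  have key : ∀ {V W : ℝ → ℝ}, EqOn V W (Icc 0 1) → ∀ g, IsGreenAt n V s g → IsGreenAt n W s g :=
    fun h g hg => ⟨hg.1, hg.2, hg.3, fun r hr hrs => by
      rw [← h ⟨hr.1.le, hr.2.le⟩]; exact hg.equation r hr hrs, hg.5, hg.6, hg.7⟩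
  exact funext fun g => propext ⟨key h g, key h.symm g⟩

lemma green_congr (h : EqOn V W (Icc 0 1)) : green n V = green n W := by
  have h1 : interiorGreen n V = interiorGreen n W := by
    ext s
    unfold interiorGreen
    rw [isGreenAt_congr h s]
  ext r s
  rw [green, green, h1]

lemma F_congr (h : EqOn V W (Icc 0 1)) : F n V = F n W := by
  ext r
  rw [F, F, green_congr h]

lemma profile_congr (h : EqOn V W (Icc 0 1)) : profile n V = profile n W := by
  ext s x
  rw [profile, profile, green_congr h]

lemma norm_mem_Icc {x : E n} (hx : x ∈ B n) : ‖x‖ ∈ Icc (0 : ℝ) 1 :=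
  ⟨norm_nonneg _, by simpa [B] using (Metric.mem_ball.1 hx).le⟩

lemma IsNeumannSolution.congr (h : EqOn V W (Icc 0 1)) {p : ℝ} {u : E n → ℝ}
    (hu : IsNeumannSolution n V p u) : IsNeumannSolution n W p u :=
  ⟨hu.1, fun x hx => by rw [← h (norm_mem_Icc hx)]; exact hu.equation x hx, hu.3, hu.4⟩

lemma Q_congr (h : EqOn V W (Icc 0 1)) : Q n V = Q n W := by
  ext u
  refine setIntegral_congr_fun measurableSet_ball fun x hx => ?_
  simp only [h (norm_mem_Icc hx)]

lemma Admissible.congr (h : EqOn V W (Icc 0 1)) {s R₁ R₂ c : ℝ}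
    (hA : Admissible n V s R₁ R₂ c) : Admissible n W s R₁ R₂ c := by
  obtain ⟨h1, h2, h3, h4, h5, h6⟩ := hA
  rw [green_congr h] at h3 h5
  rw [F_congr h] at h4
  exact ⟨h1, h2, h3, h4, h5, h6⟩

lemma IsNaturalMinimizer.congr (h : EqOn V W (Icc 0 1)) {R₁ R₂ c p : ℝ} {w : E n → ℝ}
    (hw : IsNaturalMinimizer n V R₁ R₂ c p w) : IsNaturalMinimizer n W R₁ R₂ c p w := by
  obtain ⟨h1, h2, h3⟩ := hw
  rw [Q_congr h] at h2
  exact ⟨h1, h2, h3⟩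

/-- Clamp the radius to `[0, 1]`; continuity of the result is read off along a ray of the ball. -/
lemma exists_continuous_extension (hn : 1 ≤ n)
    (hV : ContinuousOn (fun x : E n => V ‖x‖) (Metric.closedBall 0 1))
    (hV0 : ∀ r ∈ Icc (0 : ℝ) 1, 0 ≤ V r) :
    ∃ W : ℝ → ℝ, Continuous W ∧ (∀ r, 0 ≤ W r) ∧ EqOn W V (Icc 0 1) := by
  have hmem : ∀ r : ℝ, max 0 (min r 1) ∈ Icc (0 : ℝ) 1 := fun r =>
    ⟨le_max_left _ _, max_le zero_le_one (min_le_right _ _)⟩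
  refine ⟨fun r => V (max 0 (min r 1)), ?_, fun r => hV0 _ (hmem r), fun r hr => ?_⟩
  · set e : E n := EuclideanSpace.single ⟨0, hn⟩ 1 with he
    have hnorm : ∀ r : ℝ, ‖max 0 (min r 1) • e‖ = max 0 (min r 1) := fun r => by
      rw [norm_smul, he, PiLp.norm_single, norm_one, mul_one, Real.norm_eq_abs,
        abs_of_nonneg (hmem r).1]
    have h1 : Continuous fun r : ℝ => V ‖max 0 (min r 1) • e‖ :=
      hV.comp_continuous (f := fun r : ℝ => max 0 (min r 1) • e) (by fun_prop) fun r => by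
        rw [mem_closedBall_zero_iff, hnorm]
        exact (hmem r).2
    simpa only [hnorm] using h1
  · simp only
    rw [min_eq_left hr.2, max_eq_right hr.1]

end Congr

end RadialNeumann

end

/-! ### Reduction of the theorem to a continuous potential on the line -/

theorem mainTheorem1 (n : ℕ) (hn : 2 ≤ n) (V : ℝ → ℝ)
    (hV_smooth : ContDiffOn ℝ ∞ (fun x : RadialNeumann.E n => V ‖x‖) (Metric.closedBall 0 1))
    (hV_nonneg : ∀ r ∈ Icc (0 : ℝ) 1, 0 ≤ V r)
    (hV_ne : ∃ r ∈ Icc (0 : ℝ) 1, V r ≠ 0) :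
    -- the Green function exists and is unique, `G(r, 1)` is a true limit, and `F` is well defined
    ((∀ s ∈ Ioo (0 : ℝ) 1,
        RadialNeumann.IsGreenAt n V s (fun r => RadialNeumann.green n V r s) ∧
        ∀ g, RadialNeumann.IsGreenAt n V s g →
          ∀ r ∈ Icc (0 : ℝ) 1, g r = RadialNeumann.green n V r s) ∧
      (∀ r ∈ Icc (0 : ℝ) 1,
        Tendsto (fun s => RadialNeumann.green n V r s) (𝓝[<] 1)
          (𝓝 (RadialNeumann.green n V r 1))) ∧
      ∀ r ∈ Ioc (0 : ℝ) 1, 0 < RadialNeumann.green n V r r) ∧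
    ∀ rbar : ℝ, RadialNeumann.IsStrictLocalMin (RadialNeumann.F n V) rbar →
      ∃ u : ℝ → ℝ → ℝ,
        (∀ᶠ p in atTop,
          RadialNeumann.IsNeumannSolution n V p (fun x : RadialNeumann.E n => u p ‖x‖)) ∧
        RadialNeumann.TendstoH1 n (fun p x => u p ‖x‖) (RadialNeumann.profile n V rbar) ∧
        RadialNeumann.TendstoLinfty n (fun p x => u p ‖x‖) (RadialNeumann.profile n V rbar) ∧
        ∃ R₁ R₂ c : ℝ, RadialNeumann.Admissible n V rbar R₁ R₂ c ∧
          ∀ᶠ p in atTop, ∃ t : ℝ, 0 < t ∧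
            RadialNeumann.IsNaturalMinimizer n V R₁ R₂ c p
              (fun x : RadialNeumann.E n => t * u p ‖x‖) := by
  have hn1 : 1 ≤ n := one_le_two.trans hn
  -- The statement only involves the potential on `[0, 1]`, so it may be replaced by a continuous
  -- nonnegative function on the line and the conclusions carried back.
  obtain ⟨W, hW, hW0, hWV⟩ := RadialNeumann.exists_continuous_extension hn1
    hV_smooth.continuousOn hV_nonneg
  have hW1 : ∃ r ∈ Icc (0 : ℝ) 1, W r ≠ 0 := by
    obtain ⟨r, hr, hne⟩ := hV_ne
    exact ⟨r, hr, by rwa [hWV hr]⟩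
  obtain ⟨φ, ψ, P, S, C, hp⟩ := RadialNeumann.exists_fundPair hn1 hW hW0 hW1
  have hgreen := RadialNeumann.green_spec hn1 hW hW0 hW1 hp
  simp only [RadialNeumann.green_congr hWV, RadialNeumann.isGreenAt_congr hWV] at hgreen
  refine ⟨hgreen, fun rbar hr => ?_⟩
  rw [← RadialNeumann.F_congr hWV] at hr
  obtain ⟨u, hu, hH1, hLi, R₁, R₂, c, hA, hmin⟩ :=
    RadialNeumann.exists_solutions hn1 hW hW0 hW1 hr
  rw [RadialNeumann.profile_congr hWV] at hH1 hLi
  exact ⟨u, hu.mono fun p h => h.congr hWV, hH1, hLi, R₁, R₂, c, hA.congr hWV,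
    hmin.mono fun p ⟨t, ht, h⟩ => ⟨t, ht, h.congr hWV⟩⟩
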